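/- Let $G$ be a finite simple undirected graph on $\{1,\dots,n\}$, cubic (every vertex has degree $3$), drawn in the plane without crossings, and equipped with an orientation of its edges. Definitions. A cycle $C$ of $G$ is *central* if $G\setminus V(C)$ has a perfect matching. An even cycle is *oddly oriented* if, for either direction of traversal, the number of its edges directed along the traversal is odd. The orientation is *semi-Pfaffian* if every central cycle of length $2k$ is oddly oriented if and only if $k$ is odd. Let $C$ be a cycle; it bounds a closed bounded part $P_*$ of the plane. A vertex $v$ of $C$ is an *in-vertex* if the unique edge at $v$ that is not in $C$ is drawn in $P_*$, and an *out-vertex* otherwise. If $C$ is even with bipartition $V_1,V_2$ of its vertices, its *tension* is the absolute value of the difference between the numbers of out-vertices in $V_1$ and in $V_2$. The plane graph $G$ is *without tension* if every even central cycle has tension $0$. A *cycle cover* $c$ of $G$ is a spanning subgraph in which every vertex has degree $2$; $|c|$ is the number of its connected components, and $\bar c=E(G)\setminus c$ is the complementary perfect matching. For a perfect matching $a=\{i_1j_1,\dots,i_mj_m\}$ (so $n=2m$), with each edge $i_kj_k$ directed from $i_k$ to $j_k$, $\operatorname{sgn}_G(a)$ is the sign of the permutation $$\begin{pmatrix}1&2&\cdots&2m-1&2m\\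 i_1&j_1&\cdots&i_m&j_m\end{pmatrix},$$ which does not depend on the order in which the edges are listed. Proposition. If $G$ is without tension and its orientation is semi-Pfaffian, then the function $$f_G(c)=(-1)^{|c|}\operatorname{sgn}_G(\bar c)$$ from the set of cycle covers of $G$ to $\{-1,1\}$ is constant. -/

import Mathlib

namespace SimpleGraph

/-- An embedding of a graph in the plane `ℂ`: distinct vertices are distinct points, every edge
`uv` is an arc (the image of an injective path) from `u` to `v`, an arc contains no vertex other
than the two ends of its edge, and two distinct arcs meet only in common ends of their edges.
The values of `arc` off the edge set of `G` play no role. -/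
structure PlaneEmbedding {V : Type*} (G : SimpleGraph V) where
  pos : V → ℂ
  arc : Sym2 V → Set ℂ
  pos_injective : Function.Injective pos
  exists_path : ∀ u v, G.Adj u v →
    ∃ γ : _root_.Path (pos u) (pos v), Function.Injective γ ∧ Set.range γ = arc s(u, v)
  mem_of_pos_mem_arc : ∀ e ∈ G.edgeSet, ∀ w, pos w ∈ arc e → w ∈ e
  arc_inter_arc : ∀ e ∈ G.edgeSet, ∀ f ∈ G.edgeSet, e ≠ f →
    arc e ∩ arc f ⊆ pos '' {w | w ∈ e ∧ w ∈ f}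

/-- An orientation of a graph: every edge gets exactly one of its two directions. -/
structure EdgeOrientation {V : Type*} (G : SimpleGraph V) where
  /-- `Dir u v`: there is an edge between `u` and `v`, and it is directed from `u` to `v`. -/
  Dir : V → V → Prop
  adj_of_dir : ∀ u v, Dir u v → G.Adj u v
  dir_or_dir : ∀ u v, G.Adj u v → Dir u v ∨ Dir v u
  not_dir_of_dir : ∀ u v, Dir u v → ¬ Dir v u

section Cycles

variable {V : Type*} {G : SimpleGraph V}

/-- A cycle `C` is central if `G ∖ V(C)` has a perfect matching, that is, if some matching of `G`
covers exactly the vertices that are not on `C`. -/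
def Walk.IsCentral {v : V} (C : G.Walk v v) : Prop :=
  ∃ M : G.Subgraph, M.IsMatching ∧ M.verts = {w | w ∉ C.support}

open Classical in
/-- The number of edges of a walk that are directed in the direction of traversal. -/
noncomputable def EdgeOrientation.forwardCount (D : G.EdgeOrientation) {u v : V}
    (C : G.Walk u v) : ℕ :=
  C.darts.countP (fun d => decide (D.Dir d.fst d.snd))

/-- A cycle is oddly oriented if, for either choice of direction of traversal, the number of its
edges directed in the direction of the traversal is odd. (Used for even cycles only.) -/
def EdgeOrientation.OddlyOriented (D : G.EdgeOrientation) {v : V} (C : G.Walk v v) : Prop :=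
  Odd (D.forwardCount C) ∧ Odd (D.forwardCount C.reverse)

/-- Every central cycle of length `2k` is oddly oriented if and only if `k` is odd. -/
def EdgeOrientation.IsSemiPfaffian (D : G.EdgeOrientation) : Prop :=
  ∀ (v : V) (C : G.Walk v v), C.IsCycle → C.IsCentral →
    ∀ k : ℕ, C.length = 2 * k → (D.OddlyOriented C ↔ Odd k)

namespace PlaneEmbedding

variable (P : G.PlaneEmbedding)

/-- The closed curve in the plane traced by a cycle. -/
def curve {v : V} (C : G.Walk v v) : Set ℂ :=
  {z | ∃ e ∈ C.edges, z ∈ P.arc e}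

/-- The closed bounded part of the plane cut out by a cycle: the curve, together with the points
that lie in a bounded component of its complement. -/
def boundedPart {v : V} (C : G.Walk v v) : Set ℂ :=
  P.curve C ∪
    {z | z ∈ (P.curve C)ᶜ ∧ Bornology.IsBounded (connectedComponentIn (P.curve C)ᶜ z)}

/-- `w` is an in-vertex of the cycle `C`: it lies on `C`, and the edge at `w` that is not in `C`
(it is unique if `G` is cubic) is drawn in the bounded part. -/
def IsInVertex {v : V} (C : G.Walk v v) (w : V) : Prop :=
  w ∈ C.support ∧ ∃ x, G.Adj w x ∧ s(w, x) ∉ C.edges ∧ P.arc s(w, x) ⊆ P.boundedPart C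

/-- The vertices of a cycle that are not in-vertices. -/
def IsOutVertex {v : V} (C : G.Walk v v) (w : V) : Prop :=
  w ∈ C.support ∧ ¬ P.IsInVertex C w

open Classical in
/-- The tension of an even cycle `C = w₀ w₁ … w_{2k-1} w₀`. The classes of its bipartition are
the `wᵢ` with `i < 2k` even and those with `i < 2k` odd; the tension is the absolute value of the
difference of their numbers of out-vertices. -/
noncomputable def tension {v : V} (C : G.Walk v v) : ℤ :=
  |(((Finset.range C.length).filter
        (fun i => Even i ∧ P.IsOutVertex C (C.getVert i))).card : ℤ) -
    (((Finset.range C.length).filter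
        (fun i => Odd i ∧ P.IsOutVertex C (C.getVert i))).card : ℤ)|

/-- Every even central cycle has tension zero. -/
def WithoutTension : Prop :=
  ∀ (v : V) (C : G.Walk v v), C.IsCycle → Even C.length → C.IsCentral → P.tension C = 0

end PlaneEmbedding

/-- A cycle cover of `G`, as a spanning subgraph: all its vertices have degree `2`. -/
def IsCycleCover (G c : SimpleGraph V) : Prop :=
  c ≤ G ∧ ∀ v, (c.neighborSet v).ncard = 2

end Cycles

section Sign

variable {n : ℕ} {G : SimpleGraph (Fin n)}

/-- The permutation `π` lists the edges of the matching `M` along the orientation: with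
`i_k = π (2k)` and `j_k = π (2k+1)` (positions counted from `0`), the edges of `M`, each written
in its direction, are exactly `i_0 j_0, i_1 j_1, …`. -/
def EdgeOrientation.IsListing (D : G.EdgeOrientation) (M : SimpleGraph (Fin n))
    (π : Equiv.Perm (Fin n)) : Prop :=
  ∀ u v : Fin n, (M.Adj u v ∧ D.Dir u v) ↔
    ∃ (k : ℕ) (h : 2 * k + 1 < n), π ⟨2 * k, by omega⟩ = u ∧ π ⟨2 * k + 1, h⟩ = v

open Classical in
/-- The sign of a perfect matching `M`, with respect to the orientation: the sign of any
permutation listing `M`. By the two facts below, such a permutation exists, and its choice does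
not matter; the value `1` in the other case is never used. -/
noncomputable def EdgeOrientation.matchingSign (D : G.EdgeOrientation)
    (M : SimpleGraph (Fin n)) : ℤˣ :=
  if h : ∃ π, D.IsListing M π then Equiv.Perm.sign h.choose else 1

theorem EdgeOrientation.exists_isListing (D : G.EdgeOrientation) {M : SimpleGraph (Fin n)}
    (hMG : M ≤ G) (hM : ∀ v, ∃! w, M.Adj v w) : ∃ π, D.IsListing M π := by
  classical
  let S := {p : Fin n × Fin n // M.Adj p.1 p.2 ∧ D.Dir p.1 p.2}
  let g : S × Fin 2 → Fin n := fun q => if q.2 = 0 then q.1.1.1 else q.1.1.2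
  have key : ∀ a b c : Fin n, M.Adj a b → M.Adj a c → b = c := fun a b c h1 h2 =>
    (hM a).unique h1 h2
  have hg : Function.Bijective g := by
    constructor
    · rintro ⟨⟨⟨a, b⟩, hab, dab⟩, i⟩ ⟨⟨⟨c, d⟩, hcd, dcd⟩, j⟩ h
      simp only at hab dab hcd dcd
      fin_cases i <;> fin_cases j <;> simp [g] at h <;> subst h
      · have := key _ _ _ hab hcd
        subst this; rfl
      · have := key _ _ _ hab hcd.symm
        subst this; exact absurd dcd (D.not_dir_of_dir _ _ dab)
      · have := key _ _ _ hab.symm hcd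
        subst this; exact absurd dcd (D.not_dir_of_dir _ _ dab)
      · have := key _ _ _ hab.symm hcd.symm
        subst this; rfl
    · intro v
      obtain ⟨w, hw, -⟩ := hM v
      rcases D.dir_or_dir v w (hMG hw) with h | h
      · exact ⟨(⟨(v, w), hw, h⟩, 0), by simp [g]⟩
      · exact ⟨(⟨(w, v), hw.symm, h⟩, 1), by simp [g]⟩
  let e := Fintype.equivFin S
  let f : Fin (Fintype.card S * 2) ≃ Fin n :=
    finProdFinEquiv.symm.trans ((e.symm.prodCongr (Equiv.refl _)).trans (Equiv.ofBijective g hg))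
  have hn : n = Fintype.card S * 2 := by simpa using (Fintype.card_congr f).symm
  have hf0 : ∀ (s : S) (h : 2 * (e s : ℕ) < Fintype.card S * 2),
      f ⟨2 * (e s : ℕ), h⟩ = s.1.1 := by
    intro s h
    have : (⟨2 * (e s : ℕ), h⟩ : Fin (Fintype.card S * 2)) = finProdFinEquiv (e s, 0) := by
      ext; simp
    rw [this]; simp [f, g]
  have hf1 : ∀ (s : S) (h : 2 * (e s : ℕ) + 1 < Fintype.card S * 2),
      f ⟨2 * (e s : ℕ) + 1, h⟩ = s.1.2 := by
    intro s h
    have : (⟨2 * (e s : ℕ) + 1, h⟩ : Fin (Fintype.card S * 2)) = finProdFinEquiv (e s, 1) := by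
      ext; simp [add_comm]
    rw [this]; simp [f, g]
  refine ⟨(finCongr hn).trans f, fun u v => ⟨fun h => ?_, ?_⟩⟩
  · have hlt := (e ⟨(u, v), h⟩).2
    refine ⟨e ⟨(u, v), h⟩, by omega, ?_, ?_⟩
    · exact hf0 ⟨(u, v), h⟩ (by omega)
    · exact hf1 ⟨(u, v), h⟩ (by omega)
  · rintro ⟨k, hk, rfl, rfl⟩
    have hk' : k < Fintype.card S := by omega
    obtain ⟨s, hs⟩ := e.surjective ⟨k, hk'⟩
    have hs' : k = (e s : ℕ) := by rw [hs]
    subst hs'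
    have h0 := hf0 s (by omega)
    have h1 := hf1 s (by omega)
    simp only [Equiv.trans_apply, finCongr_apply, Fin.cast_mk]
    rw [h0, h1]
    exact s.2

theorem EdgeOrientation.matchingSign_eq (D : G.EdgeOrientation) {M : SimpleGraph (Fin n)}
    (hn : Even n) {π : Equiv.Perm (Fin n)} (hπ : D.IsListing M π) :
    D.matchingSign M = Equiv.Perm.sign π := by
  classical
  have hex : ∃ π, D.IsListing M π := ⟨π, hπ⟩
  rw [EdgeOrientation.matchingSign, dif_pos hex]
  generalize hex.choose = ρ, hex.choose_spec = hρ
  obtain ⟨m, rfl⟩ := hn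
  have hstep : ∀ k : Fin m, ∃ l : Fin m,
      ρ ⟨2 * l, by omega⟩ = π ⟨2 * k, by omega⟩ ∧
      ρ ⟨2 * l + 1, by omega⟩ = π ⟨2 * k + 1, by omega⟩ := by
    intro k
    obtain ⟨l, hl, h0, h1⟩ := (hρ _ _).1 ((hπ _ _).2 ⟨k, by omega, rfl, rfl⟩)
    exact ⟨⟨l, by omega⟩, h0, h1⟩
  choose τ hτ0 hτ1 using hstep
  have hinj : Function.Injective τ := by
    intro a b hab
    have h := (hτ0 a).symm.trans ((by simp only [hab] : _ = _).trans (hτ0 b))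
    have := congrArg Fin.val (π.injective h)
    ext; simpa using this
  let t : Equiv.Perm (Fin m) := Equiv.ofBijective τ (Finite.injective_iff_bijective.1 hinj)
  let q : Fin m × Fin 2 ≃ Fin (m + m) := finProdFinEquiv.trans (finCongr (by omega))
  have hπρ : π = ρ * (q.permCongr (Equiv.prodCongrLeft fun _ : Fin 2 => t)) := by
    ext x
    obtain ⟨⟨k, i⟩, rfl⟩ := q.surjective x
    congr 1
    have e0 : ∀ j : Fin m, q (j, 0) = ⟨2 * j, by omega⟩ := by intro j; ext; simp [q]
    have e1 : ∀ j : Fin m, q (j, 1) = ⟨2 * j + 1, by omega⟩ := by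
      intro j; ext; simp [q, add_comm]
    have hq : (ρ * q.permCongr (Equiv.prodCongrLeft fun _ : Fin 2 => t)) (q (k, i)) =
        ρ (q (τ k, i)) := by
      simp [Equiv.permCongr_apply, Equiv.prodCongrLeft, t]
    rw [hq]
    fin_cases i
    · change π (q (k, 0)) = ρ (q (τ k, 0))
      rw [e0, e0, hτ0]
    · change π (q (k, 1)) = ρ (q (τ k, 1))
      rw [e1, e1, hτ1]
  rw [hπρ, Equiv.Perm.sign_mul, Equiv.Perm.sign_permCongr, Equiv.Perm.sign_prodCongrLeft]
  simp

/-- `f_G(c) = (-1)^{|c|} sgn_G(c̄)`, where `|c|` is the number of components of `c`, and the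
complement `c̄ = E(G) ∖ c` is the graph `G \ c`. -/
noncomputable def EdgeOrientation.coverSign (D : G.EdgeOrientation) (c : SimpleGraph (Fin n)) :
    ℤˣ :=
  (-1) ^ Nat.card c.ConnectedComponent * D.matchingSign (G \ c)

end Sign

end SimpleGraph

/-! The complement of a cycle cover of a cubic graph is a perfect matching, here encoded by a
fixed-point-free involution. Two matchings that differ at some vertex differ along an alternating
cycle, and switching one of them along it lowers the number of disagreements. Hence it suffices to
compare matchings `a`, `a'` that differ exactly on one alternating cycle `C` of length `2k`. This
cycle is central, because `a` matches the vertices off `C`.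

Matching signs (`AlternatingCycle.matchingSign_eq`): rotating `C` by one step carries `a` to `a'`.
The rotation has sign `-1`, and correcting the directions contributes `-1` to the number of forward
edges of `C`. By the semi-Pfaffian condition the signs therefore differ by `(-1)^(k+1)`, and the
same factor must be found for the numbers of components of the two covers (`neg_one_pow_card_mul`).

Component counts: both covers contain the graph `rest` of the edges in neither matching. It consists
of circuits off `C` and of paths, the chords, that pair the vertices of `C`; each cover adds every
other edge of `C`. If a direction makes chords and added edges alternate, the components that meet
`C` are the orbits of a permutation `κ` of the heads, so the parity of their number is a matter of
`sign κ`. The two signs are compared by carrying directed matchings around a closed loop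
(`sign_heads_mul_sign_heads`): their product is the sign `-1` of the rotation times one factor `-1`
for each reversed edge. Suitable directions come from ranking the vertices of `C` among those on the
same side. They alternate on chords because chords on one side do not cross, and tension zero makes
the number of reversed edges `k`.

Topology: two crossing chords on the same side would give a drawing of the complete bipartite graph
on three and three vertices (`not_crossing`). Of the Jordan curve theorem only the uniqueness of the
bounded and of the unbounded component is needed. Both facts are derived from continuous logarithms.
-/

section PlaneTopology

open Complex Set

/-! ### Continuous logarithms -/

section ContinuousLogarithms

/-- A nonvanishing continuous function on a simply connected space has a continuous logarithm. -/
theorem exists_continuous_log {A : Type*} [TopologicalSpace A] [SimplyConnectedSpace A]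
    [LocallyPathConnectedSpace A] {f : A → ℂ} (hf : Continuous f) (h0 : ∀ a, f a ≠ 0) :
    ∃ g : A → ℂ, Continuous g ∧ ∀ a, exp (g a) = f a := by
  obtain ⟨a₀⟩ : Nonempty A := inferInstance
  obtain ⟨F, ⟨-, hF⟩, -⟩ := isCoveringMapOn_exp.existsUnique_continuousMap_lifts
    (⟨f, hf⟩ : C(A, ℂ)) (a₀ := a₀) (e₀ := log (f a₀)) (exp_log (h0 a₀)) (fun a => h0 a)
  exact ⟨F, F.continuous, fun a => congrFun hF a⟩

/-- Two continuous logarithms of proportional functions have equal increments. -/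
theorem sub_eq_sub_of_exp_eq_mul {A : Type*} [TopologicalSpace A] {s : Set A}
    (hs : IsPreconnected s)
    {f g : A → ℂ} (hf : ContinuousOn f s) (hg : ContinuousOn g s) (c : ℂ)
    (h : ∀ a ∈ s, exp (f a) = c * exp (g a)) {a b : A} (ha : a ∈ s) (hb : b ∈ s) :
    f a - f b = g a - g b := by
  have hex : ∀ x ∈ s, exp (f x - g x) = c := fun x hx => by
    rw [exp_sub, h x hx, mul_div_assoc, div_self (exp_ne_zero _), mul_one]
  -- The change of `f - g` from its value at `b`, in units of `2πi`: a continuous integer-valued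
  -- function, hence constant.
  let φ : A → ℝ := fun x => (f x - g x - (f b - g b)).im / (2 * Real.pi)
  have hint : ∀ x ∈ s, ∃ n : ℤ,
      f x - g x - (f b - g b) = n * (2 * Real.pi * I) ∧ φ x = n := fun x hx => by
    obtain ⟨n, hn⟩ := exp_eq_exp_iff_exists_int.1 ((hex x hx).trans (hex b hb).symm)
    have hn' : f x - g x - (f b - g b) = n * (2 * Real.pi * I) := by rw [hn]; ring
    have hpi : (2 * Real.pi) ≠ 0 := by positivity
    refine ⟨n, hn', ?_⟩
    simp only [φ]
    rw [hn', div_eq_iff hpi]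
    simp
  have hφ : ContinuousOn φ s :=
    (continuous_im.comp_continuousOn ((hf.sub hg).sub continuousOn_const)).div_const _
  have : DiscreteTopology (range ((↑) : ℤ → ℝ)) :=
    Int.isClosedEmbedding_coe_real.isEmbedding.toHomeomorph.symm.isEmbedding.discreteTopology
  have hab := hs.constant_of_mapsTo (T := range ((↑) : ℤ → ℝ)) ⟨this⟩ hφ
    (fun x hx => (hint x hx).imp fun n hn => hn.2.symm) ha hb
  obtain ⟨n, hn, hφn⟩ := hint a ha
  have hφb : φ b = 0 := by simp [φ]
  have hn0 : n = 0 := by exact_mod_cast (hφn.symm.trans hab).trans hφb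
  subst hn0
  linear_combination hn

end ContinuousLogarithms

/-! ### Nonplanarity of the complete bipartite graph on three and three vertices -/

section Nonplanarity

/-- Add all eighteen relations: every unknown that occurs does so exactly twice, up to sign, so the
left side is even, whereas the right side is `-9`. -/
theorem parity_contradiction (m n : Fin 3 → Fin 3 → Fin 3 → ℤ)
    (h : ∀ i k j l, i < k → j ≠ l →
      m k i j + n j k l - m i k l - n l i j = if j < l then -1 else 0) : False := by
  have h' := fun i k (hik : i < k) => And.intro (h i k 0 1 hik (by decide))
    (And.intro (h i k 0 2 hik (by decide)) (And.intro (h i k 1 2 hik (by decide))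
    (And.intro (h i k 1 0 hik (by decide)) (And.intro (h i k 2 0 hik (by decide))
      (h i k 2 1 hik (by decide))))))
  have h01 := h' 0 1 (by decide)
  have h02 := h' 0 2 (by decide)
  have h12 := h' 1 2 (by decide)
  simp only [show ((0 : Fin 3) < 1) = True by decide, show ((0 : Fin 3) < 2) = True by decide,
    show ((1 : Fin 3) < 2) = True by decide, show ((1 : Fin 3) < 0) = False by decide,
    show ((2 : Fin 3) < 0) = False by decide, show ((2 : Fin 3) < 1) = False by decide,
    if_true, if_false] at h01 h02 h12
  omega

/-- The complete bipartite graph on three and three vertices cannot be drawn in the plane in such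
a way that edges without common end are drawn disjointly. -/
theorem not_joinedIn_completeBipartite (x y : Fin 3 → ℂ) (E : Fin 3 → Fin 3 → Set ℂ)
    (hE : ∀ i j, JoinedIn (E i j) (x i) (y j))
    (hd : ∀ i k j l, i ≠ k → j ≠ l → Disjoint (E i j) (E k l)) : False := by
  choose p hp using hE
  let γ : Fin 3 → Fin 3 → ℝ → ℂ := fun i j t => p i j (projIcc 0 1 zero_le_one t)
  have hγc : ∀ i j, Continuous (γ i j) := fun i j =>
    (p i j).continuous.comp continuous_projIcc
  have hγ : ∀ i j t, γ i j t ∈ E i j := fun i j t => hp i j _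
  have hγ0 : ∀ i j, γ i j 0 = x i := fun i j => by simp [γ]
  have hγ1 : ∀ i j, γ i j 1 = y j := fun i j => by simp [γ]
  have hne : ∀ i k j l, i ≠ k → j ≠ l → ∀ s t, γ i j s - γ k l t ≠ 0 :=
    fun i k j l hik hjl s t h0 =>
      (hd i k j l hik hjl).ne_of_mem (hγ i j s) (hγ k l t) (sub_eq_zero.1 h0)
  have hother : ∀ j : Fin 3, ∃ l, j ≠ l := by decide
  have hx1 : ∀ k i j, k ≠ i → ∃ f : ℝ → ℂ, Continuous f ∧ ∀ t, exp (f t) = γ i j t - x k := by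
    intro k i j hki
    obtain ⟨l, hl⟩ := hother j
    exact exists_continuous_log (by fun_prop)
      (fun t => by simpa [hγ0, hγ1] using hne i k j l hki.symm hl t 0)
  have hy1 : ∀ l i j, l ≠ j → ∃ f : ℝ → ℂ, Continuous f ∧ ∀ t, exp (f t) = γ i j t - y l := by
    intro l i j hlj
    obtain ⟨k, hk⟩ := hother i
    exact exists_continuous_log (by fun_prop)
      (fun t => by simpa [hγ0, hγ1] using hne i k j l hk hlj.symm t 1)
  choose! a hac ha using hx1
  choose! b hbc hb using hy1
  have hpre : IsPreconnected (univ : Set ℝ) := isPreconnected_univ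
  -- For disjoint edges the difference of the two parametrizations has no zero, so its logarithm `L`
  -- has total increment zero around the unit square. On each side of the square one parameter sits
  -- at a vertex, and `L` varies there like one of the logarithms `a`, `b`.
  have hrel : ∀ i k j l, i ≠ k → j ≠ l →
      (a k i j 1 - a k i j 0) + (b j k l 1 - b j k l 0) =
        (a i k l 1 - a i k l 0) + (b l i j 1 - b l i j 0) := by
    intro i k j l hik hjl
    obtain ⟨L, hLc, hL⟩ := exists_continuous_log (A := ℝ × ℝ)
      (f := fun p => γ i j p.1 - γ k l p.2) (by fun_prop)
      (fun p => hne i k j l hik hjl p.1 p.2)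
    have e1 := sub_eq_sub_of_exp_eq_mul hpre
      (f := fun s => L (s, 0)) (g := a k i j) (by fun_prop) (hac k i j hik.symm).continuousOn 1
      (fun s _ => by rw [hL, ha k i j hik.symm]; simp [hγ0]) (mem_univ 1) (mem_univ 0)
    have e2 := sub_eq_sub_of_exp_eq_mul hpre
      (f := fun t => L (1, t)) (g := b j k l) (by fun_prop) (hbc j k l hjl).continuousOn (-1)
      (fun s _ => by rw [hL, hb j k l hjl]; simp [hγ1]) (mem_univ 1) (mem_univ 0)
    have e3 := sub_eq_sub_of_exp_eq_mul hpre
      (f := fun s => L (s, 1)) (g := b l i j) (by fun_prop) (hbc l i j hjl.symm).continuousOn 1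
      (fun s _ => by rw [hL, hb l i j hjl.symm]; simp [hγ1]) (mem_univ 1) (mem_univ 0)
    have e4 := sub_eq_sub_of_exp_eq_mul hpre
      (f := fun t => L (0, t)) (g := a i k l) (by fun_prop) (hac i k l hik).continuousOn (-1)
      (fun s _ => by rw [hL, ha i k l hik]; simp [hγ0]) (mem_univ 1) (mem_univ 0)
    linear_combination -e1 - e2 + e3 + e4
  have hxx : ∀ i k, i ≠ k → x i - x k ≠ 0 := fun i k hik => by
    simpa [hγ0, hγ1] using hne i k 0 1 hik (by decide) 0 0
  have hyy : ∀ j l, j ≠ l → y j - y l ≠ 0 := fun j l hjl => by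
    simpa [hγ0, hγ1] using hne 0 1 j l (by decide) hjl 1 1
  have hyx : ∀ j k, y j - x k ≠ 0 := fun j k => by
    obtain ⟨i, hi⟩ := hother k
    obtain ⟨l, hl⟩ := hother j
    simpa [hγ0, hγ1] using hne i k j l hi.symm hl 1 0
  let U : Fin 3 → Fin 3 → ℂ := fun j k => log (y j - x k)
  -- Branches with `X k i - X i k = πi` for `i < k`, and likewise for `Y`. These half turns add up
  -- to a whole turn or cancel, which produces the right side of `parity_contradiction`.
  let X : Fin 3 → Fin 3 → ℂ := fun i k =>
    if i < k then log (x i - x k) else log (x k - x i) + Real.pi * I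
  let Y : Fin 3 → Fin 3 → ℂ := fun i k =>
    if i < k then log (y i - y k) else log (y k - y i) + Real.pi * I
  have hU : ∀ j k, exp (U j k) = y j - x k := fun j k => exp_log (hyx j k)
  have hX : ∀ i k, i ≠ k → exp (X i k) = x i - x k := by
    intro i k hik
    simp only [X]
    split_ifs
    · exact exp_log (hxx i k hik)
    · rw [exp_add, exp_pi_mul_I, exp_log (hxx k i hik.symm)]; ring
  have hY : ∀ i k, i ≠ k → exp (Y i k) = y i - y k := by
    intro i k hik
    simp only [Y]
    split_ifs
    · exact exp_log (hyy i k hik)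
    · rw [exp_add, exp_pi_mul_I, exp_log (hyy k i hik.symm)]; ring
  have hm : ∀ k i j, k ≠ i → ∃ m : ℤ,
      a k i j 1 - a k i j 0 = U j k - X i k + m * (2 * Real.pi * I) := by
    intro k i j hki
    apply exp_eq_exp_iff_exists_int.1
    rw [exp_sub, exp_sub, ha k i j hki, ha k i j hki, hU, hX i k hki.symm]
    simp [hγ0, hγ1]
  have hn : ∀ l i j, l ≠ j → ∃ m : ℤ,
      b l i j 1 - b l i j 0 = Y j l - (U l i + Real.pi * I)
        + m * (2 * Real.pi * I) := by
    intro l i j hlj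
    apply exp_eq_exp_iff_exists_int.1
    rw [exp_sub, exp_sub, exp_add, exp_pi_mul_I, hb l i j hlj, hb l i j hlj, hU,
      hY j l hlj.symm]
    simp [hγ0, hγ1]
  choose! m hm using hm
  choose! n hn using hn
  refine parity_contradiction m n fun i k j l hik hjl => ?_
  have h := hrel i k j l hik.ne hjl
  rw [hm k i j hik.ne', hm i k l hik.ne, hn j k l hjl, hn l i j hjl.symm] at h
  have hXik : X k i - X i k = Real.pi * I := by
    simp only [X, if_pos hik, if_neg hik.not_gt]; ring
  have h2 : (2 * Real.pi * I : ℂ) ≠ 0 := by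
    simp [Real.pi_ne_zero]
  have hgoal : ((m k i j + n j k l - m i k l - n l i j : ℤ) : ℂ) =
      ((if j < l then -1 else 0 : ℤ) : ℂ) := by
    apply mul_right_cancel₀ h2
    split_ifs with hlt
    · have hYjl : Y l j - Y j l = Real.pi * I := by
        simp only [Y, if_pos hlt, if_neg hlt.not_gt]; ring
      push_cast
      linear_combination h - hXik - hYjl
    · have hlt' : l < j := lt_of_le_of_ne (not_lt.1 hlt) hjl.symm
      have hYjl : Y j l - Y l j = Real.pi * I := by
        simp only [Y, if_pos hlt', if_neg hlt'.not_gt]; ring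
      push_cast
      linear_combination h - hXik + hYjl
  exact_mod_cast hgoal

end Nonplanarity

/-! ### Uniqueness of the bounded side of a closed curve -/

section JordanCurve

/-- The maps `z ↦ z - p` with `p ∉ X` have continuous logarithms on `X`. -/
def HasContinuousLogs (X : Set ℂ) : Prop :=
  ∀ p ∉ X, ∃ h : ℂ → ℂ, ContinuousOn h X ∧ ∀ z ∈ X, exp (h z) = z - p

/-- A logarithm along the parameter interval passes to the arc because `γ` is a closed embedding;
the extension theorem only makes it a function on all of `ℂ`. -/
theorem hasContinuousLogs_range {u v : ℂ} (γ : Path u v) (hγ : Function.Injective γ) :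
    HasContinuousLogs (range γ) := by
  intro p hp
  let g : ℝ → ℂ := fun t => γ (projIcc 0 1 zero_le_one t) - p
  have hg : Continuous g := (γ.continuous.comp continuous_projIcc).sub continuous_const
  obtain ⟨f, hf, hfe⟩ := exists_continuous_log hg
    (fun t h => hp ⟨_, sub_eq_zero.1 h⟩)
  have hemb : Topology.IsClosedEmbedding γ := γ.continuous.isClosedEmbedding hγ
  obtain ⟨h, hh⟩ := ContinuousMap.exists_extension' hemb
    (⟨fun t : unitInterval => f t, by fun_prop⟩ : C(unitInterval, ℂ))
  refine ⟨h, h.continuous.continuousOn, ?_⟩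
  rintro _ ⟨t, rfl⟩
  have := congrFun hh t
  simp only [Function.comp_apply, ContinuousMap.coe_mk] at this
  rw [this, hfe]
  simp [g]

theorem ContinuousOn.exists_union_of_isClosed {A B : Set ℂ} (hA : IsClosed A) (hB : IsClosed B)
    {f g : ℂ → ℂ} (hf : ContinuousOn f A) (hg : ContinuousOn g B)
    (hfg : ∀ z ∈ A ∩ B, f z = g z) :
    ∃ h : ℂ → ℂ, ContinuousOn h (A ∪ B) ∧ EqOn h f A ∧ EqOn h g B := by
  classical
  have h1 : EqOn (A.piecewise f g) f A := fun z hz => piecewise_eq_of_mem _ _ _ hz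
  have h2 : EqOn (A.piecewise f g) g B := fun z hz => by
    by_cases hzA : z ∈ A
    · rw [h1 hzA, hfg z ⟨hzA, hz⟩]
    · exact piecewise_eq_of_notMem _ _ _ hzA
  exact ⟨A.piecewise f g, (hf.congr h1).union_of_isClosed (hg.congr h2) hA hB, h1, h2⟩

/-- At the only common point the two logarithms differ by a multiple of `2πi`; shifting one of them
by this constant makes them fit together. -/
theorem HasContinuousLogs.union {A B : Set ℂ} (hA : IsClosed A) (hB : IsClosed B)
    (hAl : HasContinuousLogs A) (hBl : HasContinuousLogs B) {x : ℂ} (hxA : x ∈ A) (hxB : x ∈ B)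
    (hAB : A ∩ B ⊆ {x}) : HasContinuousLogs (A ∪ B) := by
  intro p hp
  obtain ⟨f, hf, hfe⟩ := hAl p (fun h => hp (Or.inl h))
  obtain ⟨g, hg, hge⟩ := hBl p (fun h => hp (Or.inr h))
  have hx : exp (f x - g x) = 1 := by
    rw [exp_sub, hfe x hxA, hge x hxB]
    exact div_self (sub_ne_zero.2 fun h => hp (h ▸ Or.inl hxA))
  obtain ⟨h, hh, h1, h2⟩ := ContinuousOn.exists_union_of_isClosed hA hB hf
    (hg.add (continuousOn_const (c := f x - g x))) (fun z hz => by
      rw [show z = x from hAB hz]; simp)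
  refine ⟨h, hh, ?_⟩
  rintro z (hz | hz)
  · rw [h1 hz, hfe z hz]
  · rw [h2 hz, Pi.add_apply, exp_add, hx, mul_one, hge z hz]

/-- A boundary point off `X` would have an open component of its own that meets the component of
`p`, hence equals it. -/
theorem frontier_connectedComponentIn_compl_subset {X : Set ℂ} (hX : IsClosed X) (p : ℂ) :
    frontier (connectedComponentIn Xᶜ p) ⊆ X := by
  intro z hz
  by_contra hzX
  have hopen : IsOpen (connectedComponentIn Xᶜ z) := hX.isOpen_compl.connectedComponentIn
  have hopen' : IsOpen (connectedComponentIn Xᶜ p) := hX.isOpen_compl.connectedComponentIn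
  rw [hopen'.frontier_eq] at hz
  obtain ⟨w, hw, hw'⟩ := mem_closure_iff.1 hz.1 _ hopen (mem_connectedComponentIn hzX)
  have e1 := connectedComponentIn_eq hw
  have e2 := connectedComponentIn_eq hw'
  exact hz.2 (e2 ▸ e1 ▸ mem_connectedComponentIn hzX)

/-- Extend the logarithm to a function `H` on the plane by Tietze's theorem. On the component `U` of
`p` take `(z - q)^n exp(-H)`, elsewhere `(z - p)^(-m)`; the two agree on the frontier of `U`, which
lies in `X`. The result is continuous without zeros on the plane, so it has a logarithm, and its
winding number `-m` along a large circle around `p` must vanish. -/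
theorem exponent_eq_zero_of_log {X : Set ℂ} (hX : IsClosed X) {p q : ℂ} (hp : p ∉ X)
    (hq : q ∉ X) (hpq : q ∉ connectedComponentIn Xᶜ p)
    (hb : Bornology.IsBounded (connectedComponentIn Xᶜ p)) (m n : ℤ) {h : ℂ → ℂ}
    (hh : ContinuousOn h X) (he : ∀ z ∈ X, exp (h z) = (z - p) ^ m * (z - q) ^ n) : m = 0 := by
  classical
  obtain ⟨H, hH⟩ := ContinuousMap.exists_restrict_eq hX
    (⟨X.domRestrict h, continuousOn_iff_continuous_domRestrict.1 hh⟩ : C(X, ℂ))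
  have hHX : ∀ z ∈ X, H z = h z := fun z hz => congrArg (fun f : C(X, ℂ) => f ⟨z, hz⟩) hH
  set U := connectedComponentIn Xᶜ p with hU
  have hpU : p ∈ U := mem_connectedComponentIn hp
  have hUo : IsOpen U := hX.isOpen_compl.connectedComponentIn
  have hfr : frontier U ⊆ X := frontier_connectedComponentIn_compl_subset hX p
  have hqcl : ∀ z ∈ closure U, z - q ≠ 0 := by
    intro z hz h0
    rw [sub_eq_zero] at h0
    subst h0
    exact hq (hfr (hUo.frontier_eq ▸ ⟨hz, hpq⟩))
  have hpcl : ∀ z ∈ closure Uᶜ, z - p ≠ 0 := by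
    intro z hz h0
    rw [hUo.isClosed_compl.closure_eq] at hz
    rw [sub_eq_zero] at h0
    exact hz (h0 ▸ hpU)
  have hcont : Continuous (U.piecewise (fun z => (z - q) ^ n * exp (-H z))
      (fun z => (z - p) ^ (-m))) := by
    refine continuous_piecewise ?_ ?_ ?_
    · intro z hz
      have hzX := hfr hz
      have h1 : z - p ≠ 0 := fun h0 => hp (by rwa [← sub_eq_zero.1 h0])
      have h2 : z - q ≠ 0 := fun h0 => hq (by rwa [← sub_eq_zero.1 h0])
      have h3 := zpow_ne_zero m h1
      have h4 := zpow_ne_zero n h2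
      rw [hHX z hzX, exp_neg, he z hzX, zpow_neg]
      field_simp
    · exact (ContinuousOn.zpow₀ (by fun_prop) n fun z hz => Or.inl (hqcl z hz)).mul
        (by fun_prop)
    · exact ContinuousOn.zpow₀ (by fun_prop) (-m) fun z hz => Or.inl (hpcl z hz)
  obtain ⟨g, hg, hge⟩ := exists_continuous_log hcont (fun z => by
    by_cases hz : z ∈ U
    · rw [piecewise_eq_of_mem _ _ _ hz]
      exact mul_ne_zero (zpow_ne_zero _ (hqcl z (subset_closure hz))) (exp_ne_zero _)
    · rw [piecewise_eq_of_notMem _ _ _ hz]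
      exact zpow_ne_zero _ (hpcl z (subset_closure hz)))
  obtain ⟨R, hR⟩ := hb.subset_ball p
  -- The circle of radius `r` misses `U`; the maximum with `1` only ensures a positive radius.
  set r : ℝ := max R 1 with hr
  have hr0 : 0 < r := lt_max_of_lt_right one_pos
  let c : ℝ → ℂ := fun t => p + r * exp (t * I)
  have hc : Continuous c := by fun_prop
  have hcU : ∀ t, c t ∉ U := by
    intro t ht
    have := hR ht
    simp only [c, Metric.mem_ball, dist_eq_norm, add_sub_cancel_left, norm_mul,
      norm_exp_ofReal_mul_I, mul_one, norm_real, Real.norm_eq_abs, abs_of_pos hr0] at this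
    exact absurd (le_max_left R 1) (not_le.2 this)
  have key := sub_eq_sub_of_exp_eq_mul (isPreconnected_univ (α := ℝ))
    (f := fun t => g (c t)) (g := fun t : ℝ => -(m * (t * I))) (by fun_prop) (by fun_prop)
    ((r : ℂ) ^ (-m)) (fun t _ => by
      rw [hge, piecewise_eq_of_notMem _ _ _ (hcU t)]
      simp only [c, add_sub_cancel_left]
      rw [mul_zpow, ← exp_int_mul]
      congr 2
      push_cast
      ring) (mem_univ (2 * Real.pi)) (mem_univ 0)
  have hper : c (2 * Real.pi) = c 0 := by simp [c]
  rw [hper, sub_self] at key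
  have : (m : ℂ) * (2 * Real.pi * I) = 0 := by
    push_cast at key
    linear_combination key
  simpa [Real.pi_ne_zero] using this

/-- A closed curve that consists of two arcs with two common points has at most one bounded
complementary component. -/
theorem connectedComponentIn_compl_eq_of_isBounded {A B : Set ℂ} (hA : IsClosed A)
    (hB : IsClosed B) (hAl : HasContinuousLogs A) (hBl : HasContinuousLogs B) {x y : ℂ}
    (hx : x ∈ A ∩ B) (hy : y ∈ A ∩ B) (hAB : A ∩ B ⊆ {x, y}) {p q : ℂ} (hp : p ∉ A ∪ B)
    (hq : q ∉ A ∪ B) (hpb : Bornology.IsBounded (connectedComponentIn (A ∪ B)ᶜ p))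
    (hqb : Bornology.IsBounded (connectedComponentIn (A ∪ B)ᶜ q)) :
    connectedComponentIn (A ∪ B)ᶜ p = connectedComponentIn (A ∪ B)ᶜ q := by
  by_contra hne
  have hpq : q ∉ connectedComponentIn (A ∪ B)ᶜ p := fun h => hne (connectedComponentIn_eq h)
  have hqp : p ∉ connectedComponentIn (A ∪ B)ᶜ q := fun h => hne (connectedComponentIn_eq h).symm
  have hX : IsClosed (A ∪ B) := hA.union hB
  -- The integer `d` measures how far the logarithms on `A` and on `B` are from matching at both
  -- common points: up to sign, the winding number of the curve around `p`.
  have hdiff : ∀ p ∉ A ∪ B, ∃ f g : ℂ → ℂ, ∃ d : ℤ, ContinuousOn f A ∧ ContinuousOn g B ∧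
      (∀ z ∈ A, exp (f z) = z - p) ∧ (∀ z ∈ B, exp (g z) = z - p) ∧
      (f x - g x) - (f y - g y) = d * (2 * Real.pi * I) := by
    intro p hp
    obtain ⟨f, hf, hfe⟩ := hAl p (fun h => hp (Or.inl h))
    obtain ⟨g, hg, hge⟩ := hBl p (fun h => hp (Or.inr h))
    have h1 : ∀ z ∈ A ∩ B, exp (f z - g z) = 1 := fun z hz => by
      rw [exp_sub, hfe z hz.1, hge z hz.2]
      exact div_self (sub_ne_zero.2 fun h => hp (h ▸ Or.inl hz.1))
    obtain ⟨d, hd⟩ := exp_eq_exp_iff_exists_int.1 ((h1 x hx).trans (h1 y hy).symm)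
    exact ⟨f, g, d, hf, hg, hfe, hge, by rw [hd]; ring⟩
  obtain ⟨f₁, g₁, d₁, hf₁, hg₁, hfe₁, hge₁, hd₁⟩ := hdiff p hp
  obtain ⟨f₂, g₂, d₂, hf₂, hg₂, hfe₂, hge₂, hd₂⟩ := hdiff q hq
  have glue : ∀ m n : ℤ, m * d₁ + n * d₂ = 0 → ∃ h : ℂ → ℂ, ContinuousOn h (A ∪ B) ∧
      ∀ z ∈ A ∪ B, exp (h z) = (z - p) ^ m * (z - q) ^ n := by
    intro m n hmn
    have hmn' : (m : ℂ) * d₁ + n * d₂ = 0 := by exact_mod_cast hmn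
    let c : ℂ := m * (f₁ x - g₁ x) + n * (f₂ x - g₂ x)
    have hxX : x - p ≠ 0 := sub_ne_zero.2 fun h => hp (h ▸ Or.inl hx.1)
    have hxX' : x - q ≠ 0 := sub_ne_zero.2 fun h => hq (h ▸ Or.inl hx.1)
    have hc : exp c = 1 := by
      simp only [c]
      rw [exp_add, exp_int_mul, exp_int_mul, exp_sub, exp_sub, hfe₁ x hx.1, hge₁ x hx.2,
        hfe₂ x hx.1, hge₂ x hx.2, div_self hxX, div_self hxX']
      simp
    obtain ⟨h, hh, h1, h2⟩ := ContinuousOn.exists_union_of_isClosed hA hB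
      (f := fun z => m * f₁ z + n * f₂ z) (g := fun z => m * g₁ z + n * g₂ z + c)
      (by fun_prop) (by fun_prop) (fun z hz => by
        rcases hAB hz with rfl | rfl
        · simp only [c]; ring
        · simp only [c]
          linear_combination (-m : ℂ) * hd₁ - n * hd₂ - (2 * Real.pi * I) * hmn')
    refine ⟨h, hh, ?_⟩
    rintro z (hz | hz)
    · rw [h1 hz, exp_add, exp_int_mul, exp_int_mul, hfe₁ z hz, hfe₂ z hz]
    · rw [h2 hz, exp_add, hc, mul_one, exp_add, exp_int_mul, exp_int_mul, hge₁ z hz, hge₂ z hz]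
  by_cases hd : d₁ = 0
  · obtain ⟨h, hh, he⟩ := glue 1 0 (by simp [hd])
    exact one_ne_zero (exponent_eq_zero_of_log hX hp hq hpq hpb 1 0 hh he)
  · obtain ⟨h, hh, he⟩ := glue d₂ (-d₁) (by ring)
    exact hd (neg_eq_zero.1 (exponent_eq_zero_of_log hX hq hp hqp hqb (-d₁) d₂ hh
      fun z hz => by rw [he z hz, mul_comm]))

end JordanCurve

/-! ### Arcs of a plane embedding -/

namespace SimpleGraph.PlaneEmbedding

variable {V : Type*} {G : SimpleGraph V} (P : G.PlaneEmbedding)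

theorem pos_left_mem_arc {u v : V} (h : G.Adj u v) : P.pos u ∈ P.arc s(u, v) := by
  obtain ⟨γ, -, hγ⟩ := P.exists_path u v h
  exact hγ ▸ ⟨0, γ.source⟩

theorem pos_mem_arc_iff {e : Sym2 V} (he : e ∈ G.edgeSet) (w : V) : P.pos w ∈ P.arc e ↔ w ∈ e := by
  refine ⟨P.mem_of_pos_mem_arc e he w, ?_⟩
  induction e with | h u v =>
  intro h
  rcases Sym2.mem_iff.1 h with rfl | rfl
  · exact P.pos_left_mem_arc he
  · rw [Sym2.eq_swap]
    exact P.pos_left_mem_arc (SimpleGraph.Adj.symm he)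

theorem isClosed_arc {e : Sym2 V} (he : e ∈ G.edgeSet) : IsClosed (P.arc e) := by
  induction e with | h u v =>
  obtain ⟨γ, -, hγ⟩ := P.exists_path u v he
  rw [← hγ]
  exact (isCompact_range γ.continuous).isClosed

theorem isBounded_arc {e : Sym2 V} (he : e ∈ G.edgeSet) : Bornology.IsBounded (P.arc e) := by
  induction e with | h u v =>
  obtain ⟨γ, -, hγ⟩ := P.exists_path u v he
  rw [← hγ]
  exact (isCompact_range γ.continuous).isBounded

theorem hasContinuousLogs_arc {e : Sym2 V} (he : e ∈ G.edgeSet) :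
    HasContinuousLogs (P.arc e) := by
  induction e with | h u v =>
  obtain ⟨γ, hγi, hγ⟩ := P.exists_path u v he
  rw [← hγ]
  exact hasContinuousLogs_range γ hγi

/-- An arc stays connected when some of its ends are removed. -/
theorem isPreconnected_arc_diff {e : Sym2 V} (he : e ∈ G.edgeSet) (T : Set V) :
    IsPreconnected (P.arc e \ P.pos '' T) := by
  induction e with | h u v =>
  obtain ⟨γ, hγi, hγ⟩ := P.exists_path u v he
  have hJ : IsPreconnected (γ '' Ioo 0 1) :=
    isPreconnected_Ioo.image _ γ.continuous.continuousOn
  refine hJ.subset_closure ?_ ?_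
  · rintro _ ⟨t, ht, rfl⟩
    refine ⟨hγ ▸ mem_range_self t, ?_⟩
    rintro ⟨w, -, hw⟩
    have hw' : P.pos w ∈ P.arc s(u, v) := hw ▸ hγ ▸ mem_range_self t
    rcases Sym2.mem_iff.1 (P.mem_of_pos_mem_arc _ he w hw') with rfl | rfl
    · exact ht.1.ne (hγi (γ.source.trans hw))
    · exact ht.2.ne' (hγi (γ.target.trans hw))
  · rintro z ⟨hz, -⟩
    rw [← hγ] at hz
    obtain ⟨t, rfl⟩ := hz
    refine image_closure_subset_closure_image γ.continuous ⟨t, ?_, rfl⟩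
    rw [closure_Ioo zero_ne_one]
    exact ⟨unitInterval.nonneg', unitInterval.le_one'⟩

/-- The point `m` serves as an extra vertex on the edge. Each half has to avoid the far end of the
edge, so as to be disjoint from other edges drawn there. -/
theorem exists_midpoint {u v : V} (h : G.Adj u v) :
    ∃ m ∈ P.arc s(u, v), (∀ w, m ≠ P.pos w) ∧
      JoinedIn (P.arc s(u, v) \ {P.pos v}) (P.pos u) m ∧
      JoinedIn (P.arc s(u, v) \ {P.pos u}) m (P.pos v) := by
  obtain ⟨γ, hγi, hγ⟩ := P.exists_path u v h
  have hne0 : ∀ t : unitInterval, t ≠ 0 → γ t ≠ P.pos u := fun t ht h =>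
    ht (hγi (h.trans γ.source.symm))
  have hne1 : ∀ t : unitInterval, t ≠ 1 → γ t ≠ P.pos v := fun t ht h =>
    ht (hγi (h.trans γ.target.symm))
  let c : unitInterval := ⟨1 / 2, by norm_num, by norm_num⟩
  have hc0 : c ≠ 0 := fun h => by simpa [c] using congrArg Subtype.val h
  have hc1 : c ≠ 1 := fun h => by
    have := congrArg Subtype.val h
    norm_num [c] at this
  have hmem : ∀ t, γ t ∈ P.arc s(u, v) := fun t => hγ ▸ mem_range_self t
  have hval : ∀ s (hs : s ∈ Icc (0 : ℝ) 1), γ (projIcc 0 1 zero_le_one s) = γ ⟨s, hs⟩ :=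
    fun s hs => by rw [projIcc_of_mem _ hs]
  refine ⟨γ c, hmem c, ?_, ?_, ?_⟩
  · intro w hw
    rcases Sym2.mem_iff.1 (P.mem_of_pos_mem_arc _ h w (hw ▸ hmem c)) with rfl | rfl
    · exact hne0 c hc0 hw
    · exact hne1 c hc1 hw
  · refine JoinedIn.ofLine (f := fun t => γ (projIcc 0 1 zero_le_one (t / 2)))
      (γ.continuous.comp (continuous_projIcc.comp (by fun_prop))).continuousOn ?_ ?_ ?_
    · simp
    · exact hval _ _
    · rintro _ ⟨t, ht, rfl⟩
      refine ⟨hmem _, ?_⟩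
      have ht' : t / 2 ∈ Icc (0 : ℝ) 1 := ⟨by linarith [ht.1], by linarith [ht.2]⟩
      change γ _ ≠ _
      rw [hval _ ht']
      refine hne1 _ fun h => ?_
      have := congrArg Subtype.val h
      simp only [Set.Icc.coe_one] at this
      linarith [ht.2]
  · refine JoinedIn.ofLine (f := fun t => γ (projIcc 0 1 zero_le_one ((1 + t) / 2)))
      (γ.continuous.comp (continuous_projIcc.comp (by fun_prop))).continuousOn ?_ ?_ ?_
    · have := hval (1 / 2) (by norm_num)
      simpa only [add_zero] using this
    · simp
    · rintro _ ⟨t, ht, rfl⟩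
      refine ⟨hmem _, ?_⟩
      have ht' : (1 + t) / 2 ∈ Icc (0 : ℝ) 1 := ⟨by linarith [ht.1], by linarith [ht.2]⟩
      change γ _ ≠ _
      rw [hval _ ht']
      refine hne0 _ fun h => ?_
      have := congrArg Subtype.val h
      simp only [Set.Icc.coe_zero] at this
      linarith [ht.1]

/-- The union of the arcs of a set of edges. -/
def arcUnion (E : Set (Sym2 V)) : Set ℂ := {z | ∃ e ∈ E, z ∈ P.arc e}

theorem arcUnion_mono {E F : Set (Sym2 V)} (h : E ⊆ F) : P.arcUnion E ⊆ P.arcUnion F :=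
  fun _ ⟨e, he, hz⟩ => ⟨e, h he, hz⟩

theorem exists_pos_of_mem_arcUnion {E F : Set (Sym2 V)} (hE : E ⊆ G.edgeSet) (hF : F ⊆ G.edgeSet)
    (hEF : Disjoint E F) {z : ℂ} (hzE : z ∈ P.arcUnion E) (hzF : z ∈ P.arcUnion F) :
    ∃ v, P.pos v = z ∧ (∃ e ∈ E, v ∈ e) ∧ ∃ f ∈ F, v ∈ f := by
  obtain ⟨e, he, hze⟩ := hzE
  obtain ⟨f, hf, hzf⟩ := hzF
  obtain ⟨v, ⟨hve, hvf⟩, hv⟩ :=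
    P.arc_inter_arc e (hE he) f (hF hf) (hEF.ne_of_mem he hf) ⟨hze, hzf⟩
  exact ⟨v, hv, ⟨e, he, hve⟩, f, hf, hvf⟩

theorem joinedIn_arc {u v : V} (h : G.Adj u v) :
    JoinedIn (P.arc s(u, v)) (P.pos u) (P.pos v) := by
  obtain ⟨m, -, -, h1, h2⟩ := P.exists_midpoint h
  exact (h1.mono sdiff_subset).trans (h2.mono sdiff_subset)

end SimpleGraph.PlaneEmbedding

/-- The exterior of a large disc is connected, by polar coordinates, and every unbounded component
meets it. -/
theorem connectedComponentIn_compl_eq_of_not_isBounded {X : Set ℂ} (hX : Bornology.IsBounded X)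
    {p q : ℂ} (hp : ¬ Bornology.IsBounded (connectedComponentIn Xᶜ p))
    (hq : ¬ Bornology.IsBounded (connectedComponentIn Xᶜ q)) :
    connectedComponentIn Xᶜ p = connectedComponentIn Xᶜ q := by
  obtain ⟨R, hR⟩ := hX.subset_closedBall 0
  have hfar : IsPreconnected (Metric.closedBall (0 : ℂ) (max R 0))ᶜ := by
    have : (Metric.closedBall (0 : ℂ) (max R 0))ᶜ =
        (fun a : ℝ × ℝ => (a.1 : ℂ) * exp (a.2 * I)) '' (Ioi (max R 0) ×ˢ univ) := by
      ext z
      simp only [mem_compl_iff, Metric.mem_closedBall, dist_zero_right, not_le, mem_image,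
        mem_prod, mem_Ioi, mem_univ, and_true, Prod.exists]
      constructor
      · intro hz
        exact ⟨‖z‖, arg z, hz, norm_mul_exp_arg_mul_I z⟩
      · rintro ⟨r, θ, hr, rfl⟩
        rw [norm_mul, norm_exp_ofReal_mul_I, mul_one, norm_real, Real.norm_eq_abs]
        exact hr.trans_le (le_abs_self r)
    rw [this]
    exact (isPreconnected_Ioi.prod isPreconnected_univ).image _ (by fun_prop)
  have hsub : (Metric.closedBall (0 : ℂ) (max R 0))ᶜ ⊆ Xᶜ :=
    compl_subset_compl.2 (hR.trans (Metric.closedBall_subset_closedBall (le_max_left _ _)))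
  have hmeet : ∀ p, ¬ Bornology.IsBounded (connectedComponentIn Xᶜ p) →
      ∃ z ∈ connectedComponentIn Xᶜ p, z ∈ (Metric.closedBall (0 : ℂ) (max R 0))ᶜ := by
    intro p hp
    by_contra! h
    exact hp (Metric.isBounded_closedBall.subset fun z hz => not_not.1 (h z hz))
  obtain ⟨z, hz, hz'⟩ := hmeet p hp
  obtain ⟨y, hy, hy'⟩ := hmeet q hq
  rw [connectedComponentIn_eq hz, connectedComponentIn_eq hy]
  exact connectedComponentIn_eq (hfar.subset_connectedComponentIn hz' hsub hy')

/-! ### Cycles with chords and their two sides -/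

namespace SimpleGraph

/-- A cycle `w 0, w 1, …, w L = w 0` of a graph `G` together with a subgraph `H` of `G` that has
no edge of the cycle and in which every vertex of the cycle has a unique neighbour `x v`. -/
structure ChordedCycle {V : Type*} (G : SimpleGraph V) where
  L : ℕ
  w : ℕ → V
  H : SimpleGraph V
  x : V → V
  three_le : 3 ≤ L
  w_inj : ∀ i j, i < L → j < L → w i = w j → i = j
  w_L : w L = w 0
  adj : ∀ i < L, G.Adj (w i) (w (i + 1))
  H_le : H ≤ G
  not_H_adj : ∀ i < L, ¬ H.Adj (w i) (w (i + 1))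
  adj_x : ∀ i < L, H.Adj (w i) (x (w i))
  eq_x : ∀ i < L, ∀ y, H.Adj (w i) y → y = x (w i)
  H_adj_or : ∀ i < L, ∀ y, G.Adj (w i) y → H.Adj (w i) y ∨ ∃ j < L, s(w i, y) = s(w j, w (j + 1))

namespace ChordedCycle

variable {V : Type*} {G : SimpleGraph V} (Q : ChordedCycle G) (P : G.PlaneEmbedding)

/-- The edges of the cycle whose index lies in a given set. -/
def edgesIn (I : Set ℕ) : Set (Sym2 V) := {e | ∃ i ∈ I, i < Q.L ∧ e = s(Q.w i, Q.w (i + 1))}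

/-- The edges of the component of a vertex in the subgraph `H`. -/
def compEdges (a : V) : Set (Sym2 V) := {e ∈ Q.H.edgeSet | ∀ v ∈ e, Q.H.Reachable a v}

/-- The curve traced by the cycle. -/
def curve : Set ℂ := P.arcUnion (Q.edgesIn univ)

theorem edgesIn_subset (I : Set ℕ) : Q.edgesIn I ⊆ G.edgeSet := by
  rintro _ ⟨i, -, hi, rfl⟩
  exact Q.adj i hi

theorem edgesIn_mono {I J : Set ℕ} (h : I ⊆ J) : Q.edgesIn I ⊆ Q.edgesIn J := by
  rintro _ ⟨i, hI, hi, rfl⟩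
  exact ⟨i, h hI, hi, rfl⟩

theorem arcUnion_edgesIn_subset_curve (I : Set ℕ) : P.arcUnion (Q.edgesIn I) ⊆ Q.curve P :=
  P.arcUnion_mono (Q.edgesIn_mono (subset_univ I))

theorem H_edgeSet_subset : Q.H.edgeSet ⊆ G.edgeSet := edgeSet_subset_edgeSet.2 Q.H_le

theorem disjoint_H_edgeSet (I : Set ℕ) : Disjoint Q.H.edgeSet (Q.edgesIn I) := by
  rw [Set.disjoint_left]
  rintro _ h ⟨i, -, hi, rfl⟩
  exact Q.not_H_adj i hi h

theorem exists_index_of_mem_edgesIn {I : Set ℕ} {e : Sym2 V} (he : e ∈ Q.edgesIn I) {v : V}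
    (hv : v ∈ e) : ∃ i ∈ I, i < Q.L ∧ (v = Q.w i ∨ v = Q.w (i + 1)) := by
  obtain ⟨i, hI, hi, rfl⟩ := he
  exact ⟨i, hI, hi, Sym2.mem_iff.1 hv⟩

theorem exists_lt_of_succ {i : ℕ} (hi : i < Q.L) :
    ∃ j < Q.L, Q.w (i + 1) = Q.w j ∧ (i + 1 < Q.L ∧ j = i + 1 ∨ i + 1 = Q.L ∧ j = 0) := by
  rcases Nat.lt_or_ge (i + 1) Q.L with h | h
  · exact ⟨i + 1, h, rfl, Or.inl ⟨h, rfl⟩⟩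
  · have hL : i + 1 = Q.L := by omega
    exact ⟨0, by omega, by rw [hL, Q.w_L], Or.inr ⟨hL, rfl⟩⟩

theorem exists_lt_of_mem_edgesIn {I : Set ℕ} {e : Sym2 V} (he : e ∈ Q.edgesIn I) {v : V}
    (hv : v ∈ e) : ∃ i < Q.L, v = Q.w i := by
  obtain ⟨i, -, hi, rfl | rfl⟩ := Q.exists_index_of_mem_edgesIn he hv
  · exact ⟨i, hi, rfl⟩
  · obtain ⟨j, hj, h, -⟩ := Q.exists_lt_of_succ hi
    exact ⟨j, hj, h⟩

/-- An arc of `H` meets the cycle at vertices of the cycle only. -/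
theorem exists_of_mem_arc_of_mem_edgesIn {E : Set (Sym2 V)} (hE : E ⊆ Q.H.edgeSet) {I : Set ℕ}
    {z : ℂ} (h1 : z ∈ P.arcUnion E) (h2 : z ∈ P.arcUnion (Q.edgesIn I)) :
    ∃ v, P.pos v = z ∧ (∃ e ∈ E, v ∈ e) ∧ ∃ f ∈ Q.edgesIn I, v ∈ f :=
  P.exists_pos_of_mem_arcUnion (hE.trans Q.H_edgeSet_subset) (Q.edgesIn_subset I)
    ((Q.disjoint_H_edgeSet I).mono_left hE) h1 h2

theorem arc_diff_subset_compl_curve {e : Sym2 V} (he : e ∈ Q.H.edgeSet) :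
    P.arc e \ P.pos '' {v | ∃ i < Q.L, v = Q.w i} ⊆ (Q.curve P)ᶜ := by
  rintro z ⟨hz, hzp⟩ hzc
  obtain ⟨v, rfl, -, f, hf, hvf⟩ := Q.exists_of_mem_arc_of_mem_edgesIn P
    (singleton_subset_iff.2 he) ⟨e, rfl, hz⟩ hzc
  exact hzp ⟨v, Q.exists_lt_of_mem_edgesIn hf hvf, rfl⟩

theorem isPreconnected_arc_diff {e : Sym2 V} (he : e ∈ Q.H.edgeSet) :
    IsPreconnected (P.arc e \ P.pos '' {v | ∃ i < Q.L, v = Q.w i}) :=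
  P.isPreconnected_arc_diff (Q.H_edgeSet_subset he) _

section Jordan

theorem isClosed_arcUnion_edgesIn (I : Set ℕ) : IsClosed (P.arcUnion (Q.edgesIn I)) := by
  have : P.arcUnion (Q.edgesIn I) =
      ⋃ i ∈ {i | i ∈ I ∧ i < Q.L}, P.arc s(Q.w i, Q.w (i + 1)) := by
    ext z
    simp only [PlaneEmbedding.arcUnion, edgesIn, mem_ofPred_eq, mem_iUnion, exists_prop]
    constructor
    · rintro ⟨_, ⟨i, hI, hi, rfl⟩, hz⟩
      exact ⟨i, ⟨hI, hi⟩, hz⟩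
    · rintro ⟨i, ⟨hI, hi⟩, hz⟩
      exact ⟨_, ⟨i, hI, hi, rfl⟩, hz⟩
  rw [this]
  exact ((Set.finite_lt_nat Q.L).subset fun i hi => hi.2).isClosed_biUnion
    fun i hi => P.isClosed_arc (Q.adj i hi.2)

theorem isBounded_curve : Bornology.IsBounded (Q.curve P) := by
  have : Q.curve P ⊆ ⋃ i ∈ {i | i < Q.L}, P.arc s(Q.w i, Q.w (i + 1)) := by
    rintro z ⟨_, ⟨i, -, hi, rfl⟩, hz⟩
    exact mem_iUnion₂.2 ⟨i, hi, hz⟩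
  exact ((Bornology.isBounded_biUnion (Set.finite_lt_nat Q.L)).2
    fun i hi => P.isBounded_arc (Q.adj i hi)).subset this

theorem edgesIn_Iio_succ {m : ℕ} (hm : m < Q.L) :
    P.arcUnion (Q.edgesIn (Iio (m + 1))) =
      P.arcUnion (Q.edgesIn (Iio m)) ∪ P.arc s(Q.w m, Q.w (m + 1)) := by
  ext z
  constructor
  · rintro ⟨_, ⟨i, hI, hi, rfl⟩, hz⟩
    rcases Nat.lt_succ_iff_lt_or_eq.1 hI with h | rfl
    · exact Or.inl ⟨_, ⟨i, h, hi, rfl⟩, hz⟩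
    · exact Or.inr hz
  · rintro (⟨_, ⟨i, hI, hi, rfl⟩, hz⟩ | hz)
    · exact ⟨_, ⟨i, Nat.lt_succ_of_lt hI, hi, rfl⟩, hz⟩
    · exact ⟨_, ⟨m, Nat.lt_succ_self m, hm, rfl⟩, hz⟩

/-- Consecutive edges share one vertex; only the closing edge, with `m + 1 = L`, also returns to `w
0`. -/
theorem edgesIn_Iio_inter_arc {m : ℕ} (hm : m < Q.L) {z : ℂ}
    (h1 : z ∈ P.arcUnion (Q.edgesIn (Iio m))) (h2 : z ∈ P.arc s(Q.w m, Q.w (m + 1))) :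
    z = P.pos (Q.w m) ∨ (m + 1 = Q.L ∧ z = P.pos (Q.w 0)) := by
  have hdis : Disjoint (Q.edgesIn (Iio m)) {s(Q.w m, Q.w (m + 1))} := by
    rw [Set.disjoint_singleton_right]
    rintro ⟨i, hi, hiL, he⟩
    have h3 := Q.three_le
    have hi' : i < m := hi
    obtain ⟨j, hj, hwj, hj'⟩ := Q.exists_lt_of_succ hm
    rcases Sym2.eq_iff.1 he with ⟨h, -⟩ | ⟨h, h'⟩
    · have := Q.w_inj _ _ hm hiL h; omega
    · have e1 := Q.w_inj _ _ hm (by omega) h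
      rw [hwj] at h'
      have e2 := Q.w_inj _ _ hj hiL h'
      omega
  obtain ⟨v, rfl, ⟨e, he, hve⟩, f, rfl, hvf⟩ := P.exists_pos_of_mem_arcUnion
    (Q.edgesIn_subset _) (singleton_subset_iff.2 (Q.adj m hm)) hdis h1 ⟨_, rfl, h2⟩
  rcases Sym2.mem_iff.1 hvf with rfl | rfl
  · exact Or.inl rfl
  · obtain ⟨j, hj, hwj, hj'⟩ := Q.exists_lt_of_succ hm
    rcases hj' with ⟨h, rfl⟩ | ⟨h, rfl⟩
    · obtain ⟨i, hi, hiL, hiv⟩ := Q.exists_index_of_mem_edgesIn he hve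
      have hi' : i < m := hi
      rcases hiv with hiv | hiv
      · have := Q.w_inj _ _ h hiL hiv; omega
      · have := Q.w_inj _ _ h (by omega) hiv; omega
    · exact Or.inr ⟨h, congrArg P.pos hwj⟩

/-- All edges but the closing one form a path, built by adding arcs that meet the preceding part in
a single point. -/
theorem hasContinuousLogs_edgesIn {m : ℕ} (hm : m + 1 < Q.L) :
    HasContinuousLogs (P.arcUnion (Q.edgesIn (Iio (m + 1)))) := by
  induction m with
  | zero =>
    rw [Q.edgesIn_Iio_succ P (by omega)]
    have : P.arcUnion (Q.edgesIn (Iio 0)) = ∅ := by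
      ext z
      simp [PlaneEmbedding.arcUnion, edgesIn]
    rw [this, empty_union]
    exact P.hasContinuousLogs_arc (Q.adj 0 (by omega))
  | succ m ih =>
    rw [Q.edgesIn_Iio_succ P (by omega)]
    refine (ih (by omega)).union (Q.isClosed_arcUnion_edgesIn P _)
      (P.isClosed_arc (Q.adj _ (by omega))) (P.hasContinuousLogs_arc (Q.adj _ (by omega)))
      (x := P.pos (Q.w (m + 1))) ?_ (P.pos_left_mem_arc (Q.adj _ (by omega))) ?_
    · refine ⟨_, ⟨m, Nat.lt_succ_self m, by omega, rfl⟩, ?_⟩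
      exact (P.pos_mem_arc_iff (Q.adj _ (by omega)) _).2 (Sym2.mem_mk_right _ _)
    · rintro z ⟨h1, h2⟩
      rcases Q.edgesIn_Iio_inter_arc P (by omega) h1 h2 with h | ⟨h, -⟩
      · exact h
      · omega

/-- This presents the cycle as two arcs with two common points, the form required by
`connectedComponentIn_compl_eq_of_isBounded`. -/
theorem curve_eq : Q.curve P = P.arcUnion (Q.edgesIn (Iio (Q.L - 1))) ∪
    P.arc s(Q.w (Q.L - 1), Q.w (Q.L - 1 + 1)) := by
  have := Q.three_le
  rw [← Q.edgesIn_Iio_succ P (by omega)]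
  refine Subset.antisymm (P.arcUnion_mono ?_) (Q.arcUnion_edgesIn_subset_curve P _)
  rintro _ ⟨i, -, hi, rfl⟩
  exact ⟨i, by rw [mem_Iio]; omega, hi, rfl⟩

/-- Whether two points off the curve lie in bounded components determines whether they lie in the
same component. -/
theorem connectedComponentIn_compl_curve_eq {p q : ℂ} (hp : p ∉ Q.curve P) (hq : q ∉ Q.curve P)
    (h : Bornology.IsBounded (connectedComponentIn (Q.curve P)ᶜ p) ↔
      Bornology.IsBounded (connectedComponentIn (Q.curve P)ᶜ q)) :
    connectedComponentIn (Q.curve P)ᶜ p = connectedComponentIn (Q.curve P)ᶜ q := by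
  by_cases hb : Bornology.IsBounded (connectedComponentIn (Q.curve P)ᶜ p)
  · have hb' := h.1 hb
    have h3 := Q.three_le
    have hadj := Q.adj (Q.L - 1) (by omega)
    have hsucc : Q.L - 1 + 1 = Q.L := by omega
    have hl : ∀ i (hi : i < Q.L - 1) v, v ∈ s(Q.w i, Q.w (i + 1)) →
        P.pos v ∈ P.arcUnion (Q.edgesIn (Iio (Q.L - 1))) := fun i hi v hv =>
      ⟨_, ⟨i, hi, by omega, rfl⟩, (P.pos_mem_arc_iff (Q.adj i (by omega)) v).2 hv⟩
    rw [Q.curve_eq P] at hp hq hb hb' ⊢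
    refine connectedComponentIn_compl_eq_of_isBounded (Q.isClosed_arcUnion_edgesIn P _)
      (P.isClosed_arc hadj) ?_ (P.hasContinuousLogs_arc hadj)
      (x := P.pos (Q.w (Q.L - 1))) (y := P.pos (Q.w 0)) ⟨?_, ?_⟩ ⟨?_, ?_⟩ ?_ hp hq hb hb'
    · have := Q.hasContinuousLogs_edgesIn P (m := Q.L - 2) (by omega)
      rwa [show Q.L - 2 + 1 = Q.L - 1 by omega] at this
    · refine hl (Q.L - 2) (by omega) _ ?_
      rw [show Q.L - 2 + 1 = Q.L - 1 by omega]
      exact Sym2.mem_mk_right _ _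
    · exact P.pos_left_mem_arc hadj
    · exact hl 0 (by omega) _ (Sym2.mem_mk_left _ _)
    · rw [P.pos_mem_arc_iff hadj, hsucc, Q.w_L]
      exact Sym2.mem_mk_right _ _
    · rintro z ⟨h1, h2⟩
      rcases Q.edgesIn_Iio_inter_arc P (by omega) h1 h2 with h | ⟨-, h⟩
      · exact Or.inl h
      · exact Or.inr h
  · exact connectedComponentIn_compl_eq_of_not_isBounded (Q.isBounded_curve P) hb
      fun hb' => hb (h.2 hb')

end Jordan

section Sides

/-- A point in the interior of the arc of `H` at a vertex of the cycle. -/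
noncomputable def mid (i : ℕ) : ℂ := by
  classical
  exact if h : i < Q.L then (P.exists_midpoint (Q.H_le (Q.adj_x i h))).choose else 0

variable {Q} in
theorem mid_spec {i : ℕ} (h : i < Q.L) :
    Q.mid P i ∈ P.arc s(Q.w i, Q.x (Q.w i)) ∧ (∀ v, Q.mid P i ≠ P.pos v) ∧
      JoinedIn (P.arc s(Q.w i, Q.x (Q.w i)) \ {P.pos (Q.x (Q.w i))}) (P.pos (Q.w i))
        (Q.mid P i) ∧
      JoinedIn (P.arc s(Q.w i, Q.x (Q.w i)) \ {P.pos (Q.w i)}) (Q.mid P i)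
        (P.pos (Q.x (Q.w i))) := by
  rw [mid, dif_pos h]
  exact (P.exists_midpoint (Q.H_le (Q.adj_x i h))).choose_spec

variable {Q} in
theorem mid_mem_arc_diff {i : ℕ} (h : i < Q.L) (T : Set V) :
    Q.mid P i ∈ P.arc s(Q.w i, Q.x (Q.w i)) \ P.pos '' T :=
  ⟨(mid_spec P h).1, fun ⟨v, _, hv⟩ => (mid_spec P h).2.1 v hv.symm⟩

variable {Q} in
theorem mid_notMem_curve {i : ℕ} (h : i < Q.L) : Q.mid P i ∉ Q.curve P :=
  Q.arc_diff_subset_compl_curve P (Q.adj_x i h) (mid_mem_arc_diff P h _)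

/-- The arc of `H` at the `i`-th vertex of the cycle lies on the bounded side of the cycle. -/
def Inner (i : ℕ) : Prop :=
  Bornology.IsBounded (connectedComponentIn (Q.curve P)ᶜ (Q.mid P i))

theorem connectedComponentIn_eq_of_mem_arc_diff {e : Sym2 V} (he : e ∈ Q.H.edgeSet) {z y : ℂ}
    (hz : z ∈ P.arc e \ P.pos '' {v | ∃ i < Q.L, v = Q.w i})
    (hy : y ∈ P.arc e \ P.pos '' {v | ∃ i < Q.L, v = Q.w i}) :
    connectedComponentIn (Q.curve P)ᶜ z = connectedComponentIn (Q.curve P)ᶜ y :=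
  connectedComponentIn_eq ((Q.isPreconnected_arc_diff P he).subset_connectedComponentIn hz
    (Q.arc_diff_subset_compl_curve P he) hy)

/-- Apart from its ends on the cycle, the third edge is connected and misses the curve, so the
position of its single point `mid` decides on which side it is drawn. -/
theorem isInVertex_iff {v : V} (C : G.Walk v v)
    (hC : ∀ e, e ∈ C.edges ↔ e ∈ Q.edgesIn univ) (hs : ∀ i < Q.L, Q.w i ∈ C.support) {i : ℕ}
    (hi : i < Q.L) : P.IsInVertex C (Q.w i) ↔ Q.Inner P i := by
  have hcurve : P.curve C = Q.curve P := by
    ext z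
    simp only [PlaneEmbedding.curve, ChordedCycle.curve, PlaneEmbedding.arcUnion, hC]
  simp only [PlaneEmbedding.IsInVertex, PlaneEmbedding.boundedPart, hcurve, hC, Inner]
  constructor
  · rintro ⟨-, y, hy, hyC, hsub⟩
    rcases Q.H_adj_or i hi y hy with h | ⟨j, hj, h⟩
    · obtain rfl := Q.eq_x i hi y h
      rcases hsub (mid_spec P hi).1 with h | h
      · exact absurd h (mid_notMem_curve P hi)
      · exact h.2
    · exact absurd ⟨j, mem_univ j, hj, h⟩ hyC
  · intro hb
    refine ⟨hs i hi, Q.x (Q.w i), Q.H_le (Q.adj_x i hi), ?_, ?_⟩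
    · exact fun h => (Q.disjoint_H_edgeSet univ).ne_of_mem (Q.adj_x i hi) h rfl
    · intro z hz
      by_cases hzc : z ∈ Q.curve P
      · exact Or.inl hzc
      · refine Or.inr ⟨hzc, ?_⟩
        rwa [Q.connectedComponentIn_eq_of_mem_arc_diff P (Q.adj_x i hi) ⟨hz, ?_⟩
          (mid_mem_arc_diff P hi _)]
        rintro ⟨v, ⟨j, hj, rfl⟩, rfl⟩
        exact hzc ⟨_, ⟨j, mem_univ j, hj, rfl⟩, P.pos_left_mem_arc (Q.adj j hj)⟩

open Classical in
/-- A point off the cycle on every arc of `H` at a vertex. -/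
noncomputable def rep (v : V) : ℂ :=
  if h : ∃ i < Q.L, v = Q.w i then Q.mid P h.choose else P.pos v

theorem rep_w {i : ℕ} (hi : i < Q.L) : Q.rep P (Q.w i) = Q.mid P i := by
  have h : ∃ j < Q.L, Q.w i = Q.w j := ⟨i, hi, rfl⟩
  rw [rep, dif_pos h, ← Q.w_inj _ _ hi h.choose_spec.1 h.choose_spec.2]

theorem rep_mem {u v : V} (h : Q.H.Adj u v) :
    Q.rep P u ∈ P.arc s(u, v) \ P.pos '' {v | ∃ i < Q.L, v = Q.w i} := by
  by_cases hu : ∃ i < Q.L, u = Q.w i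
  · obtain ⟨i, hi, rfl⟩ := hu
    rw [Q.rep_w P hi, Q.eq_x i hi v h]
    exact mid_mem_arc_diff P hi _
  · rw [rep, dif_neg hu]
    refine ⟨P.pos_left_mem_arc (Q.H_le h), ?_⟩
    rintro ⟨y, hy, hyu⟩
    exact hu (P.pos_injective hyu ▸ hy)

theorem connectedComponentIn_rep_eq {u v : V} (h : Q.H.Reachable u v) :
    connectedComponentIn (Q.curve P)ᶜ (Q.rep P u) =
      connectedComponentIn (Q.curve P)ᶜ (Q.rep P v) := by
  obtain ⟨W⟩ := h
  induction W with
  | nil => rfl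
  | cons hadj _ ih =>
    refine Eq.trans ?_ ih
    refine Q.connectedComponentIn_eq_of_mem_arc_diff P hadj (Q.rep_mem P hadj) ?_
    rw [Sym2.eq_swap]
    exact Q.rep_mem P hadj.symm

/-- The two ends of a chord lie on the same side. -/
theorem inner_iff_of_reachable {i j : ℕ} (hi : i < Q.L) (hj : j < Q.L)
    (h : Q.H.Reachable (Q.w i) (Q.w j)) : Q.Inner P i ↔ Q.Inner P j := by
  have := Q.connectedComponentIn_rep_eq P h
  rw [Q.rep_w P hi, Q.rep_w P hj] at this
  rw [Inner, Inner, this]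

end Sides

end ChordedCycle

end SimpleGraph

/-! ### Chords on the same side do not cross -/

namespace SimpleGraph.ChordedCycle

variable {V : Type*} {G : SimpleGraph V} (Q : ChordedCycle G) (P : G.PlaneEmbedding)

section Chords

theorem joinedIn_edgesIn {p q : ℕ} (hpq : p < q) (hq : q ≤ Q.L) :
    JoinedIn (P.arcUnion (Q.edgesIn (Ico p q))) (P.pos (Q.w p)) (P.pos (Q.w q)) := by
  induction q, hpq using Nat.le_induction with
  | base =>
    exact (P.joinedIn_arc (Q.adj p hq)).mono
      fun z hz => ⟨_, ⟨p, ⟨le_rfl, p.lt_succ_self⟩, hq, rfl⟩, hz⟩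
  | succ q hpq ih =>
    refine ((ih (by omega)).mono (P.arcUnion_mono (Q.edgesIn_mono
      (Ico_subset_Ico_right q.le_succ)))).trans ?_
    exact (P.joinedIn_arc (Q.adj q hq)).mono
      fun z hz => ⟨_, ⟨q, ⟨by omega, q.lt_succ_self⟩, hq, rfl⟩, hz⟩

theorem compEdges_subset (a : V) : Q.compEdges a ⊆ Q.H.edgeSet := fun _ h => h.1

theorem mem_compEdges {a u v : V} (h : Q.H.Adj u v) (hu : Q.H.Reachable a u) :
    s(u, v) ∈ Q.compEdges a := by
  refine ⟨h, fun y hy => ?_⟩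
  rcases Sym2.mem_iff.1 hy with rfl | rfl
  · exact hu
  · exact hu.trans h.reachable

theorem arc_subset_arcUnion_compEdges {a u v : V} (h : Q.H.Adj u v) (hu : Q.H.Reachable a u) :
    P.arc s(u, v) ⊆ P.arcUnion (Q.compEdges a) :=
  fun _ hz => ⟨_, Q.mem_compEdges h hu, hz⟩

/-- Used for the rest of a chord after its first edge: since the chord is a path, this part can be
traced without returning to the starting vertex `b`. -/
theorem joinedIn_of_walk {a b u v : V} (W : Q.H.Walk u v) (hu : Q.H.Reachable a u)
    (hb : b ∉ W.support) (hmem : P.pos u ∈ P.arcUnion (Q.compEdges a)) :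
    JoinedIn (P.arcUnion (Q.compEdges a) \ {P.pos b}) (P.pos u) (P.pos v) := by
  induction W with
  | nil =>
    refine JoinedIn.refl ⟨hmem, fun h => hb ?_⟩
    rw [P.pos_injective h]
    exact Walk.start_mem_support _
  | @cons u y v h W ih =>
    rw [Walk.support_cons, List.mem_cons, not_or] at hb
    have hsub := Q.arc_subset_arcUnion_compEdges P h hu
    have hy : y ≠ b := fun h => hb.2 (h ▸ W.start_mem_support)
    have hstep : P.arc s(u, y) ⊆ P.arcUnion (Q.compEdges a) \ {P.pos b} := by
      refine fun z hz => ⟨hsub hz, ?_⟩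
      rintro rfl
      rcases Sym2.mem_iff.1 (P.mem_of_pos_mem_arc _ (Q.H_le h) b hz) with rfl | rfl
      · exact hb.1 rfl
      · exact hy rfl
    exact ((P.joinedIn_arc (Q.H_le h)).mono hstep).trans
      (ih (hu.trans h.reachable) hb.2 (hsub ((P.pos_mem_arc_iff (Q.H_le h) y).2
        (Sym2.mem_mk_right _ _))))

variable {Q} in
/-- The point `mid` splits the chord between two vertices of the cycle into two pieces, each of
which avoids the opposite end. -/
theorem joinedIn_mid {i j : ℕ} (hi : i < Q.L) (hij : Q.w i ≠ Q.w j)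
    (h : Q.H.Reachable (Q.w i) (Q.w j)) :
    JoinedIn (P.arcUnion (Q.compEdges (Q.w i)) \ {P.pos (Q.w j)}) (P.pos (Q.w i)) (Q.mid P i) ∧
      JoinedIn (P.arcUnion (Q.compEdges (Q.w i)) \ {P.pos (Q.w i)}) (Q.mid P i)
        (P.pos (Q.w j)) := by
  classical
  obtain ⟨W, hW⟩ := h.exists_isPath
  have hadj := Q.adj_x i hi
  have hsub := Q.arc_subset_arcUnion_compEdges P hadj (Reachable.refl _)
  obtain ⟨-, -, h1, h2⟩ := mid_spec P hi
  constructor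
  · refine h1.mono fun z hz => ⟨hsub hz.1, ?_⟩
    rintro rfl
    rcases Sym2.mem_iff.1 (P.mem_of_pos_mem_arc _ (Q.H_le hadj) _ hz.1) with h | h
    · exact hij h.symm
    · exact hz.2 (by rw [h]; rfl)
  · generalize Q.w j = b at *
    cases W with
    | nil => exact absurd rfl hij
    | @cons _ y _ hy W =>
      obtain rfl := Q.eq_x i hi y hy
      rw [Walk.cons_isPath_iff] at hW
      refine (h2.mono (sdiff_subset_sdiff_left hsub)).trans
        (Q.joinedIn_of_walk P W hadj.reachable hW.2 (hsub ?_))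
      exact (P.pos_mem_arc_iff (Q.H_le hadj) _).2 (Sym2.mem_mk_right _ _)

theorem disjoint_compEdges {a b : V} (h : ¬ Q.H.Reachable a b) :
    Disjoint (P.arcUnion (Q.compEdges a)) (P.arcUnion (Q.compEdges b)) := by
  rw [Set.disjoint_left]
  intro z hza hzb
  have hdis : Disjoint (Q.compEdges a) (Q.compEdges b) := by
    rw [Set.disjoint_left]
    intro e hea heb
    induction e with | h u v =>
    exact h ((hea.2 u (Sym2.mem_mk_left _ _)).trans (heb.2 u (Sym2.mem_mk_left _ _)).symm)
  obtain ⟨v, -, ⟨e, he, hve⟩, f, hf, hvf⟩ := P.exists_pos_of_mem_arcUnion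
    ((Q.compEdges_subset a).trans Q.H_edgeSet_subset)
    ((Q.compEdges_subset b).trans Q.H_edgeSet_subset) hdis hza hzb
  exact h ((he.2 v hve).trans (hf.2 v hvf).symm)

theorem disjoint_edgesIn {I J : Set ℕ} (hI : ∀ i ∈ I, ∀ j ∈ J, i < Q.L → j < Q.L →
      i ≠ j ∧ i + 1 ≠ j ∧ j + 1 ≠ i ∧ (i + 1 = Q.L → j ≠ 0) ∧ (j + 1 = Q.L → i ≠ 0)) :
    Disjoint (P.arcUnion (Q.edgesIn I)) (P.arcUnion (Q.edgesIn J)) := by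
  have key : ∀ v, (∃ e ∈ Q.edgesIn I, v ∈ e) → (∃ f ∈ Q.edgesIn J, v ∈ f) → False := by
    rintro v ⟨e, he, hve⟩ ⟨f, hf, hvf⟩
    obtain ⟨i, hi, hiL, hvi⟩ := Q.exists_index_of_mem_edgesIn he hve
    obtain ⟨j, hj, hjL, hvj⟩ := Q.exists_index_of_mem_edgesIn hf hvf
    have hij := hI i hi j hj hiL hjL
    obtain ⟨i', hi', hwi, hi''⟩ := Q.exists_lt_of_succ hiL
    obtain ⟨j', hj', hwj, hj''⟩ := Q.exists_lt_of_succ hjL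
    rw [hwi] at hvi
    rw [hwj] at hvj
    rcases hvi with rfl | rfl <;> rcases hvj with h | h
    · have := Q.w_inj _ _ hiL hjL h; omega
    · have := Q.w_inj _ _ hiL hj' h; omega
    · have := Q.w_inj _ _ hi' hjL h; omega
    · have := Q.w_inj _ _ hi' hj' h; omega
  rw [Set.disjoint_left]
  intro z hzI hzJ
  have hdis : Disjoint (Q.edgesIn I) (Q.edgesIn J) := by
    rw [Set.disjoint_left]
    intro e heI heJ
    induction e with | h u v =>
    exact key u ⟨_, heI, Sym2.mem_mk_left _ _⟩ ⟨_, heJ, Sym2.mem_mk_left _ _⟩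
  obtain ⟨v, -, h1, h2⟩ := P.exists_pos_of_mem_arcUnion (Q.edgesIn_subset I)
    (Q.edgesIn_subset J) hdis hzI hzJ
  exact key v h1 h2

/-- A piece of a chord is disjoint from the parts of the cycle that avoid the end of the piece. -/
theorem disjoint_compEdges_edgesIn {a b : ℕ} (hb : b < Q.L)
    (honly : ∀ i < Q.L, Q.H.Reachable (Q.w a) (Q.w i) → i = a ∨ i = b) {I : Set ℕ}
    (hI : ∀ i ∈ I, i < Q.L → i ≠ b ∧ i + 1 ≠ b ∧ (i + 1 = Q.L → b ≠ 0)) :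
    Disjoint (P.arcUnion (Q.compEdges (Q.w a)) \ {P.pos (Q.w a)})
      (P.arcUnion (Q.edgesIn I)) := by
  rw [Set.disjoint_left]
  rintro z ⟨hz, hza⟩ hzI
  obtain ⟨v, rfl, ⟨e, he, hve⟩, f, hf, hvf⟩ := Q.exists_of_mem_arc_of_mem_edgesIn P
    (Q.compEdges_subset _) hz hzI
  obtain ⟨i, hi, hiL, hvi⟩ := Q.exists_index_of_mem_edgesIn hf hvf
  have hib := hI i hi hiL
  obtain ⟨i', hi', hwi, hi''⟩ := Q.exists_lt_of_succ hiL
  rw [hwi] at hvi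
  rcases hvi with rfl | rfl
  · rcases honly i hiL (he.2 _ hve) with rfl | rfl
    · exact hza rfl
    · exact hib.1 rfl
  · rcases honly i' hi' (he.2 _ hve) with rfl | rfl
    · exact hza rfl
    · omega

/-- Two chords on the same side of the cycle do not cross. -/
theorem not_crossing {p q r s : ℕ} (hpq : p < q) (hqr : q < r) (hrs : r < s) (hs : s < Q.L)
    (hpr : Q.H.Reachable (Q.w p) (Q.w r)) (hqs : Q.H.Reachable (Q.w q) (Q.w s))
    (honly : ∀ i < Q.L, Q.H.Reachable (Q.w p) (Q.w i) → i = p ∨ i = r)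
    (honly' : ∀ i < Q.L, Q.H.Reachable (Q.w q) (Q.w i) → i = q ∨ i = s)
    (hside : Q.Inner P p ↔ Q.Inner P q) : False := by
  have hp : p < Q.L := by omega
  have hq : q < Q.L := by omega
  have hr : r < Q.L := by omega
  have hnpq : ¬ Q.H.Reachable (Q.w p) (Q.w q) := fun h => by
    have := honly q hq h; omega
  obtain ⟨hP1, hP2⟩ := joinedIn_mid P hp
    (fun h => by have := Q.w_inj _ _ hp hr h; omega) hpr
  obtain ⟨hQ1, hQ2⟩ := joinedIn_mid P hq
    (fun h => by have := Q.w_inj _ _ hq hs h; omega) hqs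
  have hmp : Q.mid P p ∉ Q.curve P := mid_notMem_curve P hp
  have hmq : Q.mid P q ∉ Q.curve P := mid_notMem_curve P hq
  have hcomp := Q.connectedComponentIn_compl_curve_eq P hmp hmq hside
  set R := connectedComponentIn (Q.curve P)ᶜ (Q.mid P p) with hR
  have hopen : IsOpen R :=
    (Q.isClosed_arcUnion_edgesIn P univ).isOpen_compl.connectedComponentIn
  have hconn : IsPathConnected R :=
    hopen.isConnected_iff_isPathConnected.1 (isConnected_connectedComponentIn_iff.2 hmp)
  -- Both midpoints lie in one open component of the complement of the curve, which is path
  -- connected; a path in it is the ninth edge of the forbidden drawing.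
  have hRjoin : JoinedIn R (Q.mid P q) (Q.mid P p) :=
    hconn.joinedIn _ (hcomp ▸ mem_connectedComponentIn hmq) _ (mem_connectedComponentIn hmp)
  have hRdis : ∀ I, Disjoint R (P.arcUnion (Q.edgesIn I)) := fun I =>
    Set.disjoint_left.2 fun z hz hzI =>
      connectedComponentIn_subset _ _ hz (Q.arcUnion_edgesIn_subset_curve P I hzI)
  have hK := Q.disjoint_compEdges P hnpq
  have honly2 : ∀ i < Q.L, Q.H.Reachable (Q.w r) (Q.w i) → i = r ∨ i = p :=
    fun i hi h => (honly i hi (hpr.trans h)).symm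
  have honly2' : ∀ i < Q.L, Q.H.Reachable (Q.w s) (Q.w i) → i = s ∨ i = q :=
    fun i hi h => (honly' i hi (hqs.trans h)).symm
  have hKr : P.arcUnion (Q.compEdges (Q.w r)) = P.arcUnion (Q.compEdges (Q.w p)) :=
    congrArg _ (Set.ext fun e => and_congr_right fun _ => forall₂_congr fun v _ =>
      ⟨hpr.trans, hpr.symm.trans⟩)
  have hKs : P.arcUnion (Q.compEdges (Q.w s)) = P.arcUnion (Q.compEdges (Q.w q)) :=
    congrArg _ (Set.ext fun e => and_congr_right fun _ => forall₂_congr fun v _ =>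
      ⟨hqs.trans, hqs.symm.trans⟩)
  have hPI := fun (I : Set ℕ) => Q.disjoint_compEdges_edgesIn P (I := I) hr honly
  have hPI' := fun (I : Set ℕ) => Q.disjoint_compEdges_edgesIn P (I := I) hp honly2
  have hQI := fun (I : Set ℕ) => Q.disjoint_compEdges_edgesIn P (I := I) hs honly'
  have hQI' := fun (I : Set ℕ) => Q.disjoint_compEdges_edgesIn P (I := I) hq honly2'
  rw [hKr] at hPI'
  rw [hKs] at hQI'
  have hwrap : JoinedIn (P.arcUnion (Q.edgesIn (Ico s Q.L ∪ Ico 0 p))) (P.pos (Q.w s))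
      (P.pos (Q.w p)) := by
    have h1 := (Q.joinedIn_edgesIn P hs le_rfl).mono
      (P.arcUnion_mono (Q.edgesIn_mono (subset_union_left (t := Ico 0 p))))
    rw [Q.w_L] at h1
    rcases Nat.eq_zero_or_pos p with rfl | h0
    · exact h1
    · exact h1.trans ((Q.joinedIn_edgesIn P h0 hp.le).mono
        (P.arcUnion_mono (Q.edgesIn_mono subset_union_right)))
  -- The two classes are `w p`, `w r`, `mid q` and `w q`, `w s`, `mid p`. Four edges run along the
  -- cycle, four are pieces of the two chords, and the last crosses the component `R`. The two
  -- pieces of one chord may overlap as sets: these edges have a common end, so their disjointness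
  -- is not required.
  let E : Fin 3 → Fin 3 → Set ℂ :=
    ![![P.arcUnion (Q.edgesIn (Ico p q)), P.arcUnion (Q.edgesIn (Ico s Q.L ∪ Ico 0 p)),
        P.arcUnion (Q.compEdges (Q.w p)) \ {P.pos (Q.w r)}],
      ![P.arcUnion (Q.edgesIn (Ico q r)), P.arcUnion (Q.edgesIn (Ico r s)),
        P.arcUnion (Q.compEdges (Q.w p)) \ {P.pos (Q.w p)}],
      ![P.arcUnion (Q.compEdges (Q.w q)) \ {P.pos (Q.w s)},
        P.arcUnion (Q.compEdges (Q.w q)) \ {P.pos (Q.w q)}, R]]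
  have d1 : Disjoint (E 0 0) (E 1 1) := Q.disjoint_edgesIn P fun i hi j hj hiL hjL => by
    simp only [mem_Ico] at hi hj; omega
  have d2 : Disjoint (E 0 1) (E 1 0) := Q.disjoint_edgesIn P fun i hi j hj hiL hjL => by
    simp only [mem_Ico, mem_union] at hi hj; omega
  have d3 : Disjoint (E 0 2) (E 1 0) := hPI' _ fun i hi hiL => by
    simp only [mem_Ico] at hi; omega
  have d4 : Disjoint (E 0 2) (E 1 1) := hPI' _ fun i hi hiL => by
    simp only [mem_Ico] at hi; omega
  have d5 : Disjoint (E 1 2) (E 0 0) := hPI _ fun i hi hiL => by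
    simp only [mem_Ico] at hi; omega
  have d6 : Disjoint (E 1 2) (E 0 1) := hPI _ fun i hi hiL => by
    simp only [mem_Ico, mem_union] at hi; omega
  have d7 : Disjoint (E 2 0) (E 0 1) := hQI' _ fun i hi hiL => by
    simp only [mem_Ico, mem_union] at hi; omega
  have d8 : Disjoint (E 2 0) (E 1 1) := hQI' _ fun i hi hiL => by
    simp only [mem_Ico] at hi; omega
  have d9 : Disjoint (E 2 1) (E 0 0) := hQI _ fun i hi hiL => by
    simp only [mem_Ico] at hi; omega
  have d10 : Disjoint (E 2 1) (E 1 0) := hQI _ fun i hi hiL => by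
    simp only [mem_Ico] at hi; omega
  have d11 : Disjoint (E 0 2) (E 2 0) := hK.mono sdiff_subset sdiff_subset
  have d12 : Disjoint (E 0 2) (E 2 1) := hK.mono sdiff_subset sdiff_subset
  have d13 : Disjoint (E 1 2) (E 2 0) := hK.mono sdiff_subset sdiff_subset
  have d14 : Disjoint (E 1 2) (E 2 1) := hK.mono sdiff_subset sdiff_subset
  have d15 : Disjoint (E 2 2) (E 0 0) := hRdis _
  have d16 : Disjoint (E 2 2) (E 0 1) := hRdis _
  have d17 : Disjoint (E 2 2) (E 1 0) := hRdis _
  have d18 : Disjoint (E 2 2) (E 1 1) := hRdis _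
  refine not_joinedIn_completeBipartite ![P.pos (Q.w p), P.pos (Q.w r), Q.mid P q]
    ![P.pos (Q.w q), P.pos (Q.w s), Q.mid P p] E ?_ ?_
  · intro i j
    fin_cases i <;> fin_cases j
    · exact Q.joinedIn_edgesIn P hpq hq.le
    · exact hwrap.symm
    · exact hP1
    · exact (Q.joinedIn_edgesIn P hqr hr.le).symm
    · exact Q.joinedIn_edgesIn P hrs hs.le
    · exact hP2.symm
    · exact hQ1.symm
    · exact hQ2
    · exact hRjoin
  · have hsymm : ∀ i k j l, Disjoint (E i j) (E k l) → Disjoint (E k l) (E i j) :=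
      fun i k j l h => h.symm
    intro i k j l hik hjl
    fin_cases i <;> fin_cases k <;> first | exact absurd rfl hik | skip
    all_goals fin_cases j <;> fin_cases l <;> first | exact absurd rfl hjl | skip
    all_goals first | assumption | (apply hsymm; assumption)

end Chords

end SimpleGraph.ChordedCycle

end PlaneTopology

section PerfectMatchings

open Equiv

/-! ### Signs of permutations and numbers of orbits -/

section OrbitSign

variable {α : Type*} [Fintype α] [DecidableEq α]

/-- The number of orbits of a permutation determines its sign. -/
theorem Equiv.Perm.neg_one_pow_card_orbits (σ : Perm α) :
    (-1 : ℤˣ) ^ Nat.card (Quotient (Perm.SameCycle.setoid σ)) =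
      (-1) ^ Fintype.card α * Perm.sign σ := by
  have hcard : Nat.card (Quotient (Perm.SameCycle.setoid σ)) =
      σ.cycleFactorsFinset.card + Fintype.card {x // σ x = x} := by
    let f : α → σ.cycleFactorsFinset ⊕ {x // σ x = x} := fun x =>
      if h : σ x = x then Sum.inr ⟨x, h⟩ else
        Sum.inl ⟨σ.cycleOf x, Perm.cycleOf_mem_cycleFactorsFinset_iff.2 (Perm.mem_support.2 h)⟩
    have hf : ∀ x y, σ.SameCycle x y ↔ f x = f y := by
      intro x y
      by_cases hx : σ x = x
      · by_cases hy : σ y = y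
        · simp only [f, dif_pos hx, dif_pos hy, Sum.inr.injEq, Subtype.mk.injEq]
          exact ⟨fun h => h.eq_of_left hx, fun h => h ▸ Perm.SameCycle.refl σ x⟩
        · simp only [f, dif_pos hx, dif_neg hy, reduceCtorEq, iff_false]
          exact fun h => hy (h.apply_eq_self_iff.1 hx)
      · by_cases hy : σ y = y
        · simp only [f, dif_neg hx, dif_pos hy, reduceCtorEq, iff_false]
          exact fun h => hx (h.apply_eq_self_iff.2 hy)
        · simp only [f, dif_neg hx, dif_neg hy, Sum.inl.injEq, Subtype.mk.injEq]
          exact Perm.sameCycle_iff_cycleOf_eq_of_mem_support (Perm.mem_support.2 hx)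
            (Perm.mem_support.2 hy)
    let F : Quotient (Perm.SameCycle.setoid σ) → σ.cycleFactorsFinset ⊕ {x // σ x = x} :=
      Quotient.lift f fun x y h => (hf x y).1 h
    have hF : Function.Bijective F := by
      constructor
      · intro a b
        induction a using Quotient.inductionOn
        induction b using Quotient.inductionOn
        exact fun h => Quotient.sound ((hf _ _).2 h)
      · rintro (⟨c, hc⟩ | ⟨x, hx⟩)
        · obtain ⟨x, hx⟩ := (Perm.mem_cycleFactorsFinset_iff.1 hc).1.nonempty_support
          have hcx := Perm.cycle_is_cycleOf hx hc
          have hx' : σ x ≠ x := Perm.mem_support.1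
            (Perm.mem_cycleFactorsFinset_support_le hc hx)
          refine ⟨Quotient.mk _ x, ?_⟩
          change f x = _
          simp only [f, dif_neg hx', ← hcx]
        · exact ⟨Quotient.mk _ x, dif_pos hx⟩
    rw [Nat.card_congr (Equiv.ofBijective F hF), Nat.card_eq_fintype_card, Fintype.card_sum,
      Fintype.card_coe]
  have hfix : Fintype.card α = σ.support.card + Fintype.card {x // σ x = x} := by
    rw [Fintype.card_subtype, ← Finset.card_univ,
      ← Finset.card_filter_add_card_filter_not (s := Finset.univ) (fun x => σ x = x), add_comm]
    congr 2
  have hsign : Perm.sign σ = (-1) ^ (σ.support.card + σ.cycleFactorsFinset.card) := by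
    rw [Perm.sign_of_cycleType, Perm.sum_cycleType, Perm.cycleType_def, Multiset.card_map]
    rfl
  rw [hcard, hsign, hfix, ← pow_add]
  rw [show σ.support.card + Fintype.card {x // σ x = x} +
    (σ.support.card + σ.cycleFactorsFinset.card) = σ.cycleFactorsFinset.card +
      Fintype.card {x // σ x = x} + 2 * σ.support.card by ring, pow_add _ _ (2 * _), pow_mul]
  simp

end OrbitSign

/-! ### Permutations that carry directed matchings -/

section DirectedMatchings

variable {ι : Type*}

/-- The permutation `g` carries the matching `α`, directed by `o`, to the matching `β`, directed
by `o'`. Here a matching is given by its fixed-point-free involution and a direction of its edges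
by the set of their tails. -/
def Carries (g : Perm ι) (α : ι → ι) (o : ι → Bool) (β : ι → ι) (o' : ι → Bool) : Prop :=
  (∀ i, g (α i) = β (g i)) ∧ ∀ i, o' (g i) = o i

theorem Carries.mul {g h : Perm ι} {α β γ : ι → ι} {o o' o'' : ι → Bool}
    (hg : Carries g β o' γ o'') (hh : Carries h α o β o') : Carries (g * h) α o γ o'' :=
  ⟨fun i => by rw [Perm.mul_apply, Perm.mul_apply, hh.1, hg.1],
    fun i => by rw [Perm.mul_apply, hg.2, hh.2]⟩

theorem Carries.inv {g : Perm ι} {α β : ι → ι} {o o' : ι → Bool} (hg : Carries g α o β o') :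
    Carries g⁻¹ β o' α o :=
  ⟨fun i => by rw [Perm.inv_eq_iff_eq, hg.1, show g (g⁻¹ i) = i from g.apply_symm_apply i],
    fun i => by rw [← hg.2, show g (g⁻¹ i) = i from g.apply_symm_apply i]⟩

variable [Fintype ι] [DecidableEq ι]

/-- The involution `μ` conjugates the action of `g` on tails to its action on heads, so the two have
equal signs. -/
theorem Carries.sign_eq_one {g : Perm ι} {μ : ι → ι} {o : ι → Bool}
    (hμ : Function.Involutive μ) (hμo : ∀ i, o (μ i) = !o i) (hg : Carries g μ o μ o) :
    Perm.sign g = 1 := by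
  let g₁ : Perm {i // o i = true} := g.subtypePerm fun i => by rw [hg.2]
  let g₂ : Perm {i // ¬ o i = true} := g.subtypePerm fun i => by rw [hg.2]
  have hg12 : g = g₁.subtypeCongr g₂ := by
    ext i
    by_cases hi : o i = true
    · rw [Perm.subtypeCongr.left_apply (p := fun i => o i = true) _ _ hi]; rfl
    · rw [Perm.subtypeCongr.right_apply (p := fun i => o i = true) _ _ hi]; rfl
  let e : {i // o i = true} ≃ {i // ¬ o i = true} :=
    (hμ.toPerm μ).subtypeEquiv fun i => by
      change _ ↔ ¬ o (μ i) = true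
      rw [hμo]; simp
  have h12 : Perm.sign g₁ = Perm.sign g₂ :=
    Perm.sign_eq_sign_of_equiv g₁ g₂ e fun i => Subtype.ext (hg.1 i).symm
  rw [hg12, Perm.sign_subtypeCongr, h12, Int.units_mul_self]

/-- Changing the direction of some edges of a matching. -/
theorem exists_carries_reorient {α : ι → ι} (hα : Function.Involutive α) {o o' : ι → Bool}
    (ho : ∀ i, o (α i) = !o i) (ho' : ∀ i, o' (α i) = !o' i) :
    ∃ g : Perm ι, Carries g α o α o' ∧ (∀ i, g i = if o i = o' i then i else α i) ∧
      Perm.sign g = (-1) ^ Fintype.card {i // o i = false ∧ o' i = true} := by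
  -- One transposition for each reversed edge; the edge is indexed by its end that becomes a tail.
  let f : {i // o i = false ∧ o' i = true} × Bool → {i // o i ≠ o' i} := fun q =>
    if q.2 then ⟨α q.1.1, by rw [ho, ho', q.1.2.1, q.1.2.2]; simp⟩ else
      ⟨q.1.1, by rw [q.1.2.1, q.1.2.2]; simp⟩
  have hf : Function.Bijective f := by
    constructor
    · rintro ⟨⟨i, hi, hi'⟩, a⟩ ⟨⟨j, hj, hj'⟩, b⟩ h
      cases a <;> cases b <;> simp only [f, if_true, if_false, Subtype.mk.injEq,
        Bool.false_eq_true] at h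
      · subst h; rfl
      · subst h; simp [ho, hj] at hi
      · subst h; simp [ho, hi] at hj
      · obtain rfl := hα.injective h; rfl
    · rintro ⟨i, hi⟩
      rcases hoi : o i with _ | _
      · refine ⟨(⟨i, hoi, ?_⟩, false), rfl⟩
        rw [hoi] at hi
        simpa using hi.symm
      · refine ⟨(⟨α i, ?_, ?_⟩, true), ?_⟩
        · rw [ho, hoi]; rfl
        · rw [hoi] at hi
          rw [ho']
          simpa using hi.symm
        · simp [f, hα i]
  let s : Perm ({i // o i = false ∧ o' i = true} × Bool) :=
    Equiv.prodCongrRight fun _ => Equiv.swap false true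
  let g : Perm ι := s.extendDomain (Equiv.ofBijective f hf)
  have hs : ∀ q, ((f (s q)).1 : ι) = α (f q).1 := by
    rintro ⟨i, _ | _⟩
    · simp [s, f]
    · simp [s, f, hα i.1]
  have hg : ∀ i, g i = if o i = o' i then i else α i := by
    intro i
    by_cases hi : o i = o' i
    · rw [if_pos hi]
      exact Perm.extendDomain_apply_not_subtype _ _ (not_not.2 hi)
    · rw [if_neg hi]
      obtain ⟨q, hq⟩ := hf.2 ⟨i, hi⟩
      have hq' : i = (Equiv.ofBijective f hf q : ι) := by simp [hq]
      rw [hq']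
      exact (Perm.extendDomain_apply_image _ _ q).trans (hs q)
  refine ⟨g, ⟨fun i => ?_, fun i => ?_⟩, hg, ?_⟩
  · rw [hg, hg, ho, ho']
    by_cases hi : o i = o' i <;> simp [hi]
  · rw [hg]
    split_ifs with hi
    · exact hi.symm
    · rw [ho']
      cases h : o i <;> cases h' : o' i <;> simp_all
  · rw [Perm.sign_extendDomain, Perm.sign_prodCongrRight]
    simp

/-- For two matchings with common direction `o`: the permutation of the heads. -/
theorem exists_perm_heads {α μ : ι → ι} (hα : Function.Involutive α)
    (hμ : Function.Involutive μ) {o : ι → Bool} (ho : ∀ i, o (α i) = !o i)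
    (ho' : ∀ i, o (μ i) = !o i) :
    ∃ κ : Perm {i // o i = false}, (∀ i, (κ i : ι) = α (μ i)) ∧
      ∃ g : Perm ι, Carries g μ o α o ∧ Perm.sign g = Perm.sign κ := by
  let κ : Perm {i // o i = false} :=
    { toFun := fun i => ⟨α (μ i), by rw [ho, ho', i.2]; rfl⟩
      invFun := fun i => ⟨μ (α i), by rw [ho', ho, i.2]; rfl⟩
      left_inv := fun i => Subtype.ext (by simp [hα (μ i), hμ i.1])
      right_inv := fun i => Subtype.ext (by simp [hμ (α i), hα i.1]) }
  -- Extended by the identity on tails, `κ` sends the head of each `μ`-edge to the head of the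
  -- `α`-edge with the same tail.
  refine ⟨κ, fun i => rfl, Perm.ofSubtype κ, ?_, Perm.sign_ofSubtype κ⟩
  have h0 : ∀ i, o i = false → Perm.ofSubtype κ i = α (μ i) := fun i hi =>
    Perm.ofSubtype_apply_of_mem κ hi
  have h1 : ∀ i, o i = true → Perm.ofSubtype κ i = i := fun i hi =>
    Perm.ofSubtype_apply_of_not_mem κ (by simp [hi])
  constructor
  · intro i
    cases hi : o i
    · rw [h1 (μ i) (by rw [ho', hi]; rfl), h0 i hi, hα]
    · rw [h0 (μ i) (by rw [ho', hi]; rfl), h1 i hi, hμ]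
  · intro i
    cases hi : o i
    · rw [h0 i hi, ho, ho', hi]; rfl
    · rw [h1 i hi, hi]

/-- Reorienting after transport by `ζ`. -/
theorem Carries.exists_of_conj {α β : ι → ι} {ζ : Perm ι} (hβ : Function.Involutive β)
    {o o' : ι → Bool} (ho : ∀ i, o (α i) = !o i) (ho' : ∀ i, o' (β i) = !o' i)
    (hζ : ∀ i, ζ (α i) = β (ζ i)) :
    ∃ g : Perm ι, Carries g α o β o' ∧
      Perm.sign g = Perm.sign ζ * (-1) ^ Fintype.card {i // o i = false ∧ o' (ζ i) = true} := by
  have hoζ : ∀ i, o (ζ.symm (β i)) = !o (ζ.symm i) := fun i => by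
    rw [← ho]
    congr 1
    rw [Equiv.symm_apply_eq, hζ, Equiv.apply_symm_apply]
  obtain ⟨r, hr, -, hs⟩ := exists_carries_reorient hβ (o := fun i => o (ζ.symm i)) hoζ ho'
  refine ⟨r * ζ, hr.mul ⟨hζ, fun i => by simp⟩, ?_⟩
  rw [Perm.sign_mul, hs, mul_comm]
  congr 2
  refine Fintype.card_congr (ζ.symm.subtypeEquiv fun i => ?_)
  simp

/-- Carry `(μ, o)` to `(α, o)` by `κ`, then to `(β, o')` by `ζ` and a reorientation, then to `(μ,
o')` by the inverse of `κ'`, and back to `(μ, o)` by a reorientation. The composite is an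
automorphism of a directed matching, hence even. -/
theorem sign_heads_mul_sign_heads {α β μ : ι → ι} (hα : Function.Involutive α)
    (hβ : Function.Involutive β) (hμ : Function.Involutive μ) {o o' : ι → Bool}
    (hαo : ∀ i, o (α i) = !o i) (hβo : ∀ i, o' (β i) = !o' i) (hμo : ∀ i, o (μ i) = !o i)
    (hμo' : ∀ i, o' (μ i) = !o' i) {ζ : Perm ι} (hζ : ∀ i, ζ (α i) = β (ζ i))
    {κ : Perm {i // o i = false}} {κ' : Perm {i // o' i = false}}
    (hκ : ∀ i, (κ i : ι) = α (μ i)) (hκ' : ∀ i, (κ' i : ι) = β (μ i)) :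
    Perm.sign κ * Perm.sign κ' = Perm.sign ζ *
      (-1) ^ (Fintype.card {i // o i = false ∧ o' (ζ i) = true} +
        Fintype.card {i // o' i = false ∧ o i = true}) := by
  obtain ⟨κ₁, hκ₁, g₁, hg₁, hs₁⟩ := exists_perm_heads hα hμ hαo hμo
  obtain ⟨κ₂, hκ₂, g₂, hg₂, hs₂⟩ := exists_perm_heads hβ hμ hβo hμo'
  obtain rfl : κ = κ₁ := Equiv.ext fun i => Subtype.ext ((hκ i).trans (hκ₁ i).symm)
  obtain rfl : κ' = κ₂ := Equiv.ext fun i => Subtype.ext ((hκ' i).trans (hκ₂ i).symm)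
  obtain ⟨g₃, hg₃, hs₃⟩ := Carries.exists_of_conj hβ hαo hβo hζ
  obtain ⟨g₄, hg₄, -, hs₄⟩ := exists_carries_reorient hμ hμo' hμo
  have h := (hg₄.mul (hg₂.inv.mul (hg₃.mul hg₁))).sign_eq_one hμ hμo
  rw [Perm.sign_mul, Perm.sign_mul, Perm.sign_mul, Perm.sign_inv, hs₁, hs₂, hs₃, hs₄] at h
  rw [pow_add, ← mul_assoc]
  set A := (-1 : ℤˣ) ^ Fintype.card {i // o i = false ∧ o' (ζ i) = true}
  set B := (-1 : ℤˣ) ^ Fintype.card {i // o' i = false ∧ o i = true}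
  have := congrArg (· * (Perm.sign ζ * A * B)) h
  simp only [one_mul] at this
  rw [← this]
  have hz := Int.units_mul_self (Perm.sign ζ)
  have hA := Int.units_mul_self A
  have hB := Int.units_mul_self B
  calc _ = Perm.sign κ * Perm.sign κ' * (Perm.sign ζ * Perm.sign ζ) * (A * A) * (B * B) := by
        rw [hz, hA, hB, mul_one, mul_one, mul_one]
    _ = _ := by
        apply Units.ext
        push_cast
        ring

end DirectedMatchings

namespace SimpleGraph

/-! ### Components of a cover as orbits -/

section ComponentCount

variable {V : Type*} [Finite V]

/-- The components of `H` are treated as points, and `ρ` records how the additional edges of `c`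
link them. -/
theorem card_connectedComponent_eq_card_orbits {H c : SimpleGraph V} (hHc : H ≤ c)
    (ρ : Perm H.ConnectedComponent)
    (h1 : ∀ u v, c.Adj u v →
      ρ.SameCycle (H.connectedComponentMk u) (H.connectedComponentMk v))
    (h2 : ∀ u v, ρ (H.connectedComponentMk u) = H.connectedComponentMk v → c.Reachable u v) :
    Nat.card c.ConnectedComponent = Nat.card (Quotient (Perm.SameCycle.setoid ρ)) := by
  have hr : ∀ u v, c.Reachable u v →
      ρ.SameCycle (H.connectedComponentMk u) (H.connectedComponentMk v) := by
    rintro u v ⟨W⟩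
    induction W with
    | nil => exact Perm.SameCycle.refl _ _
    | cons h _ ih => exact (h1 _ _ h).trans ih
  let r : H.ConnectedComponent → H.ConnectedComponent → Prop := fun x y =>
    ∀ u v, H.connectedComponentMk u = x → H.connectedComponentMk v = y → c.Reachable u v
  have hpow : ∀ (n : ℕ) x, r x ((ρ ^ n) x) := by
    intro n
    induction n with
    | zero =>
      intro x u v hu hv
      exact (ConnectedComponent.exact (hu.trans hv.symm)).mono hHc
    | succ n ih =>
      intro x u v hu hv
      obtain ⟨y, hy⟩ : ∃ y, H.connectedComponentMk y = (ρ ^ n) x := ((ρ ^ n) x).exists_rep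
      refine (ih x u y hu hy).trans (h2 y v ?_)
      rw [hv, pow_succ', Perm.mul_apply, ← hy]
  have hr' : ∀ u v, ρ.SameCycle (H.connectedComponentMk u) (H.connectedComponentMk v) →
      c.Reachable u v := by
    intro u v h
    obtain ⟨n, -, -, hn⟩ := h.exists_pow_eq''
    exact hpow n _ u v rfl hn.symm
  refine Nat.card_congr (Equiv.ofBijective
    (Quot.lift (fun v => (Quotient.mk (Perm.SameCycle.setoid ρ) (H.connectedComponentMk v)))
      fun u v h => Quotient.sound (hr u v h)) ⟨?_, ?_⟩)
  · intro x y
    induction x using ConnectedComponent.ind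
    induction y using ConnectedComponent.ind
    exact fun h => ConnectedComponent.sound (hr' _ _ (Quotient.exact h))
  · intro q
    induction q using Quotient.inductionOn with | h x =>
    induction x using ConnectedComponent.ind with | h v =>
    exact ⟨c.connectedComponentMk v, rfl⟩

/-- Adding to `H` the edges of a matching between ends of the paths of `H`. -/
theorem neg_one_pow_card_connectedComponent {ι : Type*} [Fintype ι] [DecidableEq ι]
    {H c : SimpleGraph V} (w : ι → V) {α μ : ι → ι} (hα : Function.Involutive α)
    (hμ : Function.Involutive μ) {o : ι → Bool}
    (hαo : ∀ i, o (α i) = !o i) (hμo : ∀ i, o (μ i) = !o i)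
    (hreach : ∀ i j, H.Reachable (w i) (w j) ↔ j = i ∨ j = μ i)
    (hc : ∀ u v, c.Adj u v ↔ H.Adj u v ∨ ∃ i, u = w i ∧ v = w (α i))
    {κ : Perm {i // o i = false}} (hκ : ∀ i, (κ i : ι) = α (μ i)) :
    (-1 : ℤˣ) ^ Nat.card c.ConnectedComponent =
      (-1) ^ Nat.card H.ConnectedComponent * Perm.sign κ := by
  classical
  have := Fintype.ofFinite H.ConnectedComponent
  let f : {i // o i = false} → H.ConnectedComponent := fun i => H.connectedComponentMk (w i)
  have hf : Function.Injective f := by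
    rintro ⟨i, hi⟩ ⟨j, hj⟩ hij
    rcases (hreach i j).1 (ConnectedComponent.exact hij) with rfl | rfl
    · rfl
    · rw [hμo, hi] at hj; simp at hj
  -- A path of `H` entered at the end `i` is left at `μ i`, and the added edge leads to `α (μ i)`;
  -- components without ends stay fixed.
  let ρ : Perm H.ConnectedComponent := κ.extendDomain (Equiv.ofInjective f hf)
  have hρ : ∀ i, o i = false → ρ (H.connectedComponentMk (w i)) =
      H.connectedComponentMk (w (α (μ i))) := by
    intro i hi
    have := Perm.extendDomain_apply_image κ (Equiv.ofInjective f hf) ⟨i, hi⟩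
    simp only [Equiv.ofInjective_apply] at this
    rw [← hκ ⟨i, hi⟩]
    exact this
  have hρ' : ∀ x, x ∉ Set.range f → ρ x = x := fun x hx =>
    Perm.extendDomain_apply_not_subtype _ _ hx
  have hmk : ∀ i, H.connectedComponentMk (w (μ i)) = H.connectedComponentMk (w i) := fun i =>
    ConnectedComponent.sound ((hreach i (μ i)).2 (Or.inr rfl)).symm
  have hHc : H ≤ c := fun u v h => (hc u v).2 (Or.inl h)
  have hstep : ∀ i, o i = true →
      ρ (H.connectedComponentMk (w i)) = H.connectedComponentMk (w (α i)) := by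
    intro i hi
    rw [← hmk i, hρ _ (by rw [hμo, hi]; rfl), hμ]
  have key := card_connectedComponent_eq_card_orbits hHc ρ ?_ ?_
  · rw [key, Perm.neg_one_pow_card_orbits, Nat.card_eq_fintype_card, Perm.sign_extendDomain]
  · intro u v huv
    rcases (hc u v).1 huv with h | ⟨i, rfl, rfl⟩
    · rw [ConnectedComponent.sound h.reachable]
    · cases hi : o i
      · refine Perm.SameCycle.symm ⟨1, ?_⟩
        rw [zpow_one, hstep _ (by rw [hαo, hi]; rfl), hα]
      · exact ⟨1, by rw [zpow_one, hstep i hi]⟩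
  · intro u v huv
    by_cases hu : H.connectedComponentMk u ∈ Set.range f
    · obtain ⟨⟨i, hi⟩, hiu⟩ := hu
      have hiu' : H.connectedComponentMk (w i) = H.connectedComponentMk u := hiu
      rw [← hiu', hρ i hi] at huv
      have e1 : c.Reachable u (w (μ i)) :=
        (ConnectedComponent.exact (hiu'.symm.trans (hmk i).symm)).mono hHc
      have e2 : c.Adj (w (μ i)) (w (α (μ i))) := (hc _ _).2 (Or.inr ⟨μ i, rfl, rfl⟩)
      exact e1.trans (e2.reachable.trans ((ConnectedComponent.exact huv).mono hHc))
    · rw [hρ' _ hu] at huv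
      exact (ConnectedComponent.exact huv).mono hHc

/-- In a finite graph with vertices of degree one and two only, the vertices of degree one are
connected in pairs. -/
theorem exists_unique_other_end {H : SimpleGraph V} {S : Set V}
    (h1 : ∀ v ∈ S, (H.neighborSet v).ncard = 1) (h2 : ∀ v ∉ S, (H.neighborSet v).ncard = 2)
    {a : V} (ha : a ∈ S) : ∃ b ∈ S, b ≠ a ∧ H.Reachable a b ∧
      ∀ v ∈ S, H.Reachable a v → v = a ∨ v = b := by
  classical
  have := Fintype.ofFinite V
  let K := H.connectedComponentMk a
  let Γ := K.toSimpleGraph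
  have hconn : Γ.Connected := K.connected_toSimpleGraph
  have hdeg : ∀ v : K, Γ.degree v = if (v : V) ∈ S then 1 else 2 := by
    intro v
    have : Γ.degree v = (H.neighborSet v).ncard := by
      rw [← card_neighborSet_eq_degree, ← Nat.card_eq_fintype_card, ← Nat.card_coe_set_eq]
      refine Nat.card_congr (Equiv.ofBijective
        (fun y => ⟨y.1.1, y.2⟩ : Γ.neighborSet v → H.neighborSet v) ⟨?_, ?_⟩)
      · intro x y h
        exact Subtype.ext (Subtype.ext (congrArg (fun z : H.neighborSet v => (z : V)) h))
      · rintro ⟨y, hy⟩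
        have hyK : y ∈ K := by
          have hv : H.connectedComponentMk v = K := v.2
          change H.connectedComponentMk y = K
          rw [← hv]
          exact ConnectedComponent.sound (Adj.reachable hy).symm
        exact ⟨⟨⟨y, hyK⟩, hy⟩, rfl⟩
    rw [this]
    split_ifs with hv
    · exact h1 _ hv
    · exact h2 _ hv
  let T : Finset K := Finset.univ.filter fun v => (v : V) ∈ S
  have hsum : ∑ v, Γ.degree v + T.card = 2 * Fintype.card K := by
    have : T.card = ∑ v : K, if (v : V) ∈ S then 1 else 0 := Finset.card_filter _ _
    rw [this, ← Finset.sum_add_distrib]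
    simp only [hdeg]
    rw [Finset.sum_congr rfl (g := fun _ => 2) (fun v _ => by split_ifs <;> rfl)]
    simp [mul_comm]
  have hedge := hconn.card_vert_le_card_edgeSet_add_one
  rw [sum_degrees_eq_twice_card_edges] at hsum
  rw [Nat.card_eq_fintype_card, Nat.card_eq_fintype_card, ← edgeFinset_card] at hedge
  have haT : (⟨a, rfl⟩ : K) ∈ T := by simpa [T] using ha
  have hpos : 0 < T.card := Finset.card_pos.2 ⟨_, haT⟩
  -- A connected graph has at least one edge fewer than vertices, so there are at most two ends; the
  -- degree sum makes their number even, and `a` is one of them.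
  have hT : T.card = 2 := by omega
  obtain ⟨b, hb⟩ : ∃ b, T.erase ⟨a, rfl⟩ = {b} := by
    rw [← Finset.card_eq_one, Finset.card_erase_of_mem haT, hT]
  have hbT : b ∈ T.erase ⟨a, rfl⟩ := hb ▸ Finset.mem_singleton_self b
  rw [Finset.mem_erase, Finset.mem_filter] at hbT
  refine ⟨b, hbT.2.2, fun h => hbT.1 (Subtype.ext h), (ConnectedComponent.exact b.2).symm, ?_⟩
  intro v hv hav
  by_cases hva : v = a
  · exact Or.inl hva
  · right
    have : (⟨v, ConnectedComponent.sound hav.symm⟩ : K) ∈ T.erase ⟨a, rfl⟩ := by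
      rw [Finset.mem_erase, Finset.mem_filter]
      exact ⟨fun h => hva (congrArg Subtype.val h), Finset.mem_univ _, hv⟩
    rw [hb, Finset.mem_singleton] at this
    exact congrArg Subtype.val this

end ComponentCount

section MatchingSign

variable {n : ℕ} {G : SimpleGraph (Fin n)}

/-- Transport of a directed matching changes its sign by the sign of the permutation. -/
theorem EdgeOrientation.matchingSign_of_carries (D : G.EdgeOrientation) (hn : Even n)
    {M M' : SimpleGraph (Fin n)} {a a' : Fin n → Fin n} {o o' : Fin n → Bool}
    (hMG : M ≤ G) (hM : ∀ u v, M.Adj u v ↔ v = a u) (hM' : ∀ u v, M'.Adj u v ↔ v = a' u)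
    (ho : ∀ v, o v = true ↔ D.Dir v (a v)) (ho' : ∀ v, o' v = true ↔ D.Dir v (a' v))
    {g : Perm (Fin n)} (hg : Carries g a o a' o') :
    D.matchingSign M' = Perm.sign g * D.matchingSign M := by
  obtain ⟨π, hπ⟩ := D.exists_isListing hMG (fun v => ⟨a v, (hM _ _).2 rfl,
    fun w hw => (hM _ _).1 hw⟩)
  have hπ' : D.IsListing M' (g * π) := by
    intro u v
    obtain ⟨u, rfl⟩ := g.surjective u
    obtain ⟨v, rfl⟩ := g.surjective v
    simp only [Perm.mul_apply, g.injective.eq_iff]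
    rw [← hπ u v, hM, hM', ← hg.1, g.injective.eq_iff]
    refine and_congr_right fun h => ?_
    rw [h, hg.1, ← ho', hg.2, ho]
  rw [D.matchingSign_eq hn hπ, D.matchingSign_eq hn hπ', Perm.sign_mul]

end MatchingSign

end SimpleGraph

theorem Finset.even_card_of_involution {α : Type*} [DecidableEq α] (s : Finset α) (f : α → α)
    (hf : ∀ a ∈ s, f a ∈ s) (hff : ∀ a ∈ s, f (f a) = a) (hne : ∀ a ∈ s, f a ≠ a) :
    Even s.card := by
  have h : ∑ _a ∈ s, (1 : ZMod 2) = 0 :=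
    Finset.sum_involution (fun a _ => f a) (fun _ _ => by decide) (fun a ha _ => hne a ha)
      (fun a ha => hf a ha) (fun a ha => hff a ha)
  rw [Finset.sum_const, nsmul_eq_mul, mul_one] at h
  exact even_iff_two_dvd.2 ((ZMod.natCast_eq_zero_iff _ _).1 h)

/-! ### The two perfect matchings of an even cycle -/

section AlternatingSteps

variable {k : ℕ}

/-- On the cyclic order of `Fin (2 * k)`: match `2 * j` with `2 * j + 1`. -/
def evenStep (i : Fin (2 * k)) : Fin (2 * k) :=
  ⟨if (i : ℕ) % 2 = 0 then i + 1 else i - 1, by have := i.2; split_ifs <;> omega⟩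

/-- On the cyclic order of `Fin (2 * k)`: match `2 * j + 1` with its successor. -/
def oddStep (i : Fin (2 * k)) : Fin (2 * k) :=
  ⟨if (i : ℕ) % 2 = 0 then (if (i : ℕ) = 0 then 2 * k - 1 else i - 1) else
    (if (i : ℕ) + 1 = 2 * k then 0 else i + 1), by have := i.2; split_ifs <;> omega⟩

theorem val_finRotate (i : Fin (2 * k)) :
    ((finRotate (2 * k) i : Fin (2 * k)) : ℕ) =
      if (i : ℕ) + 1 = 2 * k then 0 else (i : ℕ) + 1 := by
  generalize 2 * k = L at i
  cases L with
  | zero => exact i.elim0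
  | succ m =>
    rw [coe_finRotate]
    by_cases h : i = Fin.last m
    · simp [h]
    · have : (i : ℕ) ≠ m := fun h' => h (Fin.ext h')
      rw [if_neg h, if_neg (by omega)]

theorem evenStep_involutive : Function.Involutive (evenStep (k := k)) := fun i => by
  have := i.2
  ext
  simp only [evenStep]
  split_ifs <;> omega

theorem oddStep_involutive : Function.Involutive (oddStep (k := k)) := fun i => by
  have := i.2
  ext
  simp only [oddStep]
  grind

theorem finRotate_of_even {i : Fin (2 * k)} (hi : (i : ℕ) % 2 = 0) :
    finRotate (2 * k) i = evenStep i := by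
  have := i.2
  ext
  rw [val_finRotate]
  simp only [evenStep]
  split_ifs <;> omega

theorem finRotate_of_odd {i : Fin (2 * k)} (hi : (i : ℕ) % 2 = 1) :
    finRotate (2 * k) i = oddStep i := by
  have := i.2
  ext
  rw [val_finRotate]
  simp only [oddStep]
  split_ifs <;> omega

theorem finRotate_evenStep (i : Fin (2 * k)) :
    finRotate (2 * k) (evenStep i) = oddStep (finRotate (2 * k) i) := by
  have := i.2
  ext
  rw [val_finRotate]
  simp only [oddStep, val_finRotate, evenStep]
  grind

end AlternatingSteps

/-! ### Directions from ranks within each side -/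

section Colouring

/-- Counting lemma for the comparison of the two directions of a system of chords. -/
theorem two_mul_card_add_card {ι : Type*} [Fintype ι] {α β μ : ι → ι} {ζ : Perm ι}
    {par d χ : ι → Bool} (hα : Function.Involutive α)
    (hμ : Function.Involutive μ) (hαpar : ∀ i, par (α i) = !par i)
    (hζα : ∀ i, par i = false → ζ i = α i) (hζβ : ∀ i, par i = true → ζ i = β i)
    (hβχ : ∀ i, χ (β i) = !χ i) (hμχ : ∀ i, χ (μ i) = !χ i) (hμd : ∀ i, d (μ i) = d i)
    (hαχ : ∀ i, xor (χ (α i)) (d (α i)) = !xor (χ i) (d i))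
    (ht : Fintype.card {i // par i = false ∧ d i = false} =
      Fintype.card {i // par i = true ∧ d i = false}) :
    2 * (Fintype.card {i // xor (χ i) (d i) = false ∧ χ (ζ i) = true} +
      Fintype.card {i // χ i = false ∧ xor (χ i) (d i) = true}) = Fintype.card ι := by
  -- Each index on the left is sent to itself if it is odd and to its partner under `α` otherwise.
  -- The odd `j` with `d j = false` is then reached from itself if `χ j` is false, and from `α j` if
  -- `χ j` is true.
  have h1 : Fintype.card {i // xor (χ i) (d i) = false ∧ χ (ζ i) = true} =
      Fintype.card {i // par i = true ∧ d i = false} := by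
    refine Fintype.card_congr
      { toFun := fun i => if h : par i = true then ⟨i, h, ?_⟩ else ⟨α i, ?_, ?_⟩
        invFun := fun j => if h : χ j = true then ⟨α j, ?_, ?_⟩ else ⟨j, ?_, ?_⟩
        left_inv := ?_
        right_inv := ?_ }
    · have h2 := i.2
      rw [hζβ _ h, hβχ] at h2
      revert h2
      cases χ i <;> cases d i <;> simp
    · rw [hαpar]; simpa using h
    · have h2 := i.2
      have h3 := hαχ i
      rw [hζα _ (by simpa using h)] at h2
      rw [h2.1, h2.2] at h3
      simpa using h3
    · have h3 := hαχ j
      rw [h, j.2.2] at h3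
      simpa using h3
    · rw [hζα _ (by rw [hαpar, j.2.1]; rfl), hα, h]
    · simp [j.2.2, h]
    · rw [hζβ _ j.2.1, hβχ]; simpa using h
    · rintro ⟨i, hi⟩
      by_cases h : par i = true
      · have h2 : ¬ χ i = true := by
          rw [hζβ _ h, hβχ] at hi
          simpa using hi.2
        simp [h, h2]
      · have h2 : χ (α i) = true := by
          rw [hζα _ (by simpa using h)] at hi
          exact hi.2
        simp [h, h2, hα i]
    · rintro ⟨j, hj⟩
      by_cases h : χ j = true
      · have h2 : ¬ par (α j) = true := by rw [hαpar, hj.1]; simp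
        simp [h, h2, hα j]
      · simp [h, hj.1]
  have h2 : Fintype.card {i // χ i = false ∧ xor (χ i) (d i) = true} =
      Fintype.card {i // χ i = false ∧ d i = true} :=
    Fintype.card_congr (Equiv.subtypeEquivRight fun i => by
      cases χ i <;> cases d i <;> simp)
  -- Chords keep `d` and flip `χ`, so exactly half of the indices with `d` true are counted here. By
  -- `ht` the previous set is half of those with `d` false.
  have h3 : Fintype.card {i // χ i = false ∧ d i = true} =
      Fintype.card {i // χ i = true ∧ d i = true} :=
    Fintype.card_congr ((hμ.toPerm μ).subtypeEquiv fun i => by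
      change _ ↔ χ (μ i) = true ∧ d (μ i) = true
      rw [hμχ, hμd]; simp)
  have split : ∀ p q : ι → Bool, Fintype.card {i // q i = true} =
      Fintype.card {i // p i = false ∧ q i = true} +
        Fintype.card {i // p i = true ∧ q i = true} := by
    intro p q
    simp only [Fintype.card_subtype]
    rw [← Finset.card_filter_add_card_filter_not (s := Finset.univ.filter fun i => q i = true)
      (fun i => p i = false), Finset.filter_filter, Finset.filter_filter]
    congr 2 <;> ext i <;> cases p i <;> simp [and_comm]
  have h4 := split χ d
  have h5 := split par fun i => !d i
  have h6 : Fintype.card ι =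
      Fintype.card {i // d i = false} + Fintype.card {i // d i = true} := by
    simpa using split d fun _ => true
  simp only [Bool.not_eq_true'] at h5
  rw [h1, h2]
  omega

variable (d : ℕ → Bool)

/-- The parity of the number of preceding indices of the same colour. -/
def rankParity (i : ℕ) : Bool := decide (Odd (Nat.count (fun j => d j = d i) i))

theorem count_true_add_count_false (m : ℕ) :
    Nat.count (fun j => d j = true) m + Nat.count (fun j => d j = false) m = m := by
  induction m with
  | zero => simp
  | succ m ih =>
    rw [Nat.count_succ, Nat.count_succ]
    cases h : d m <;> simp <;> omega

variable {d} {L : ℕ} {μ : ℕ → ℕ} (hμL : ∀ i < L, μ i < L) (hμμ : ∀ i < L, μ (μ i) = i)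
  (hμne : ∀ i < L, μ i ≠ i) (hμd : ∀ i < L, d (μ i) = d i)
include hμL hμμ hμne hμd

theorem even_count_colour (c : Bool) : Even (Nat.count (fun j => d j = c) L) := by
  rw [Nat.count_eq_card_filter_range]
  refine Finset.even_card_of_involution _ μ ?_ ?_ ?_ <;> intro a ha <;>
    rw [Finset.mem_filter, Finset.mem_range] at ha
  · rw [Finset.mem_filter, Finset.mem_range]
    exact ⟨hμL a ha.1, (hμd a ha.1).trans ha.2⟩
  · exact hμμ a ha.1
  · exact hμne a ha.1

/-- Chords of the same colour do not cross, so the indices of that colour strictly between `i` and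
`μ i` are paired among themselves and even in number. -/
theorem rankParity_chord
    (hcross : ∀ p q r s, p < q → q < r → r < s → s < L → μ p = r → μ q = s → d p = d q → False)
    {i : ℕ} (hi : i < L) : rankParity d (μ i) = !rankParity d i := by
  have key : ∀ i < L, i < μ i → rankParity d (μ i) = !rankParity d i := by
    intro i hi hlt
    have hr := hμL i hi
    have hT : Even (((Finset.Ioo i (μ i)).filter fun j => d j = d i).card) := by
      refine Finset.even_card_of_involution _ μ ?_ ?_ ?_ <;> intro a ha <;>
        rw [Finset.mem_filter, Finset.mem_Ioo] at ha
      · have haL : a < L := by omega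
        rw [Finset.mem_filter, Finset.mem_Ioo]
        refine ⟨⟨?_, ?_⟩, (hμd a haL).trans ha.2⟩
        · by_contra hle
          rcases Nat.lt_or_eq_of_le (not_lt.1 hle) with h | h
          · exact hcross (μ a) i a (μ i) h ha.1.1 ha.1.2 hr (hμμ a haL) rfl
              ((hμd a haL).trans ha.2)
          · have := hμμ a haL
            rw [h] at this
            omega
        · by_contra hle
          rcases Nat.lt_or_eq_of_le (not_lt.1 hle) with h | h
          · exact hcross i a (μ i) (μ a) ha.1.1 ha.1.2 h (hμL a haL) rfl rfl ha.2.symm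
          · have := hμμ a haL
            rw [← h, hμμ i hi] at this
            omega
      · exact hμμ a (by omega)
      · exact hμne a (by omega)
    have hcount : Nat.count (fun j => d j = d (μ i)) (μ i) =
        Nat.count (fun j => d j = d i) i + 1 +
          ((Finset.Ioo i (μ i)).filter fun j => d j = d i).card := by
      rw [hμd i hi, Nat.count_eq_card_filter_range, Nat.count_eq_card_filter_range]
      have : (Finset.range (μ i)).filter (fun j => d j = d i) =
          insert i ((Finset.range i).filter fun j => d j = d i) ∪
            (Finset.Ioo i (μ i)).filter fun j => d j = d i := by
        ext j
        simp only [Finset.mem_filter, Finset.mem_range, Finset.mem_union, Finset.mem_insert,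
          Finset.mem_Ioo]
        constructor
        · rintro ⟨h1, h2⟩
          rcases lt_trichotomy j i with h | h | h
          · exact Or.inl (Or.inr ⟨h, h2⟩)
          · exact Or.inl (Or.inl h)
          · exact Or.inr ⟨⟨h, h1⟩, h2⟩
        · rintro ((rfl | ⟨h, h2⟩) | ⟨h, h2⟩)
          · exact ⟨hlt, rfl⟩
          · exact ⟨by omega, h2⟩
          · exact ⟨h.2, h2⟩
      rw [this, Finset.card_union_of_disjoint, Finset.card_insert_of_notMem (by simp)]
      rw [Finset.disjoint_left]
      intro j hj hj'
      simp only [Finset.mem_filter, Finset.mem_range, Finset.mem_insert, Finset.mem_Ioo] at hj hj'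
      omega
    simp only [rankParity, hcount]
    rw [← decide_not, decide_eq_decide, Nat.odd_add, Nat.odd_add_one]
    simp [hT]
  rcases lt_trichotomy i (μ i) with h | h | h
  · exact key i hi h
  · exact absurd h.symm (hμne i hi)
  · have := key (μ i) (hμL i hi) (by rw [hμμ i hi]; exact h)
    rw [hμμ i hi] at this
    rw [this, Bool.not_not]

/-- Neighbours of equal colour have consecutive ranks. For different colours the ranks of `i` and `i
+ 1` add up to `i`, so their parities differ exactly for odd `i`; for even `i` the twist by `d`
supplies the change. The step from the last index to `0` works because each colour class is even. -/
theorem rankParity_succ {i : ℕ} (hi : i < L) (hL : Even L) :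
    (if i % 2 = 1 then rankParity d (if i + 1 = L then 0 else i + 1) = !rankParity d i else
      xor (rankParity d (if i + 1 = L then 0 else i + 1)) (d (if i + 1 = L then 0 else i + 1)) =
        !xor (rankParity d i) (d i)) := by
  have hsum := count_true_add_count_false d i
  have ht := even_count_colour hμL hμμ hμne hμd (d := d) true
  have hf := even_count_colour hμL hμμ hμne hμd (d := d) false
  rw [Nat.even_iff] at hL
  by_cases hlast : i + 1 = L
  · subst hlast
    rw [Nat.count_succ, Nat.even_iff] at ht hf
    rw [if_pos (by omega), if_pos rfl]
    simp only [rankParity, Nat.count_zero]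
    cases h : d i <;> simp only [h, reduceCtorEq, if_true, if_false] at ht hf <;>
      simp <;> rw [Nat.odd_iff] <;> omega
  · rw [if_neg hlast]
    simp only [rankParity]
    cases h : d i <;> cases h' : d (i + 1) <;>
      simp only [Nat.count_succ, h, reduceCtorEq, if_true, if_false, ← decide_not, add_zero,
        Bool.xor_false, Bool.xor_true, decide_eq_decide, Nat.odd_iff] <;>
      split_ifs <;> omega

end Colouring

/-! ### Comparing the two permutations of heads -/

section Chords

/-- The comparison of the two matchings between the ends of a noncrossing system of chords on the
two sides of a cycle. -/
theorem exists_direction_of_noncrossing {k : ℕ} (hk : 0 < k) {d : ℕ → Bool} {μ : ℕ → ℕ}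
    (hμL : ∀ i < 2 * k, μ i < 2 * k) (hμμ : ∀ i < 2 * k, μ (μ i) = i)
    (hμne : ∀ i < 2 * k, μ i ≠ i) (hμd : ∀ i < 2 * k, d (μ i) = d i)
    (hcross : ∀ p q r s, p < q → q < r → r < s → s < 2 * k → μ p = r → μ q = s → d p = d q →
      False)
    (ht : ((Finset.range (2 * k)).filter fun i => i % 2 = 0 ∧ d i = false).card =
      ((Finset.range (2 * k)).filter fun i => i % 2 = 1 ∧ d i = false).card)
    {ν : Fin (2 * k) → Fin (2 * k)} (hν : ∀ i, (ν i : ℕ) = μ i) :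
    ∃ o o' : Fin (2 * k) → Bool, (∀ i, o (evenStep i) = !o i) ∧ (∀ i, o (ν i) = !o i) ∧
      (∀ i, o' (oddStep i) = !o' i) ∧ (∀ i, o' (ν i) = !o' i) ∧
      ∀ (κ : Perm {i // o i = false}) (κ' : Perm {i // o' i = false}),
        (∀ i, (κ i : Fin (2 * k)) = evenStep (ν i)) →
        (∀ i, (κ' i : Fin (2 * k)) = oddStep (ν i)) →
        Perm.sign κ * Perm.sign κ' = (-1) ^ (k + 1) := by
  let χ : Fin (2 * k) → Bool := fun i => rankParity d i
  let δ : Fin (2 * k) → Bool := fun i => d i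
  let par : Fin (2 * k) → Bool := fun i => decide ((i : ℕ) % 2 = 1)
  have hνν : Function.Involutive ν := fun i => Fin.ext (by rw [hν, hν, hμμ i i.2])
  have hνχ : ∀ i, χ (ν i) = !χ i := fun i => by
    simp only [χ, hν]
    exact rankParity_chord hμL hμμ hμne hμd hcross i.2
  have hνδ : ∀ i, δ (ν i) = δ i := fun i => by
    simp only [δ, hν]
    exact hμd i i.2
  have hχodd : ∀ i : Fin (2 * k), (i : ℕ) % 2 = 1 → χ (oddStep i) = !χ i := fun i hi => by
    have := rankParity_succ hμL hμμ hμne hμd i.2 (even_two_mul k)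
    rw [if_pos hi] at this
    rw [← finRotate_of_odd hi]
    simp only [χ, val_finRotate]
    exact this
  have hχeven : ∀ i : Fin (2 * k), (i : ℕ) % 2 = 0 →
      xor (χ (evenStep i)) (δ (evenStep i)) = !xor (χ i) (δ i) := fun i hi => by
    have := rankParity_succ hμL hμμ hμne hμd i.2 (even_two_mul k)
    rw [if_neg (by omega)] at this
    rw [← finRotate_of_even hi]
    simp only [χ, δ, val_finRotate]
    exact this
  have hpe : ∀ i : Fin (2 * k), ((evenStep i : Fin (2 * k)) : ℕ) % 2 = 1 - (i : ℕ) % 2 :=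
    fun i => by simp only [evenStep]; split_ifs <;> omega
  have hpo : ∀ i : Fin (2 * k), ((oddStep i : Fin (2 * k)) : ℕ) % 2 = 1 - (i : ℕ) % 2 :=
    fun i => by have := i.2; simp only [oddStep]; split_ifs <;> omega
  have hβχ : ∀ i, χ (oddStep i) = !χ i := fun i => by
    rcases Nat.mod_two_eq_zero_or_one i with h | h
    · have := hχodd (oddStep i) (by rw [hpo, h])
      rw [oddStep_involutive i] at this
      rw [this, Bool.not_not]
    · exact hχodd i h
  have hαχ : ∀ i, xor (χ (evenStep i)) (δ (evenStep i)) = !xor (χ i) (δ i) := fun i => by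
    rcases Nat.mod_two_eq_zero_or_one i with h | h
    · exact hχeven i h
    · have := hχeven (evenStep i) (by rw [hpe, h])
      rw [evenStep_involutive i] at this
      rw [this, Bool.not_not]
  have hνo : ∀ i, xor (χ (ν i)) (δ (ν i)) = !xor (χ i) (δ i) := fun i => by
    rw [hνχ, hνδ]
    cases χ i <;> cases δ i <;> rfl
  have hcardFin : ∀ c : ℕ, Fintype.card {i : Fin (2 * k) // (i : ℕ) % 2 = c ∧ δ i = false} =
      ((Finset.range (2 * k)).filter fun i => i % 2 = c ∧ d i = false).card := fun c => by
    rw [Fintype.card_subtype, ← Finset.card_map Fin.valEmbedding]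
    congr 1
    ext i
    simp only [δ, Finset.mem_map, Finset.mem_filter, Finset.mem_univ, true_and,
      Fin.valEmbedding_apply, Finset.mem_range]
    constructor
    · rintro ⟨j, hj, rfl⟩
      exact ⟨j.2, hj⟩
    · rintro ⟨hi, h⟩
      exact ⟨⟨i, hi⟩, h, rfl⟩
  have hcount := two_mul_card_add_card (ζ := finRotate (2 * k)) (par := par) (d := δ) (χ := χ)
    evenStep_involutive hνν
    (fun i => by
      simp only [par, hpe]
      rcases Nat.mod_two_eq_zero_or_one i with h | h <;> simp [h])
    (fun i hi => finRotate_of_even (by simpa [par] using hi))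
    (fun i hi => finRotate_of_odd (by simpa [par] using hi)) hβχ hνχ hνδ hαχ
    (by
      have h0 := hcardFin 0
      have h1 := hcardFin 1
      simp only [par, decide_eq_true_eq, decide_eq_false_iff_not, Nat.mod_two_not_eq_one]
      rw [h0, h1, ht])
  -- The rank parity `χ` alternates on odd steps, its twist by the side alternates on even steps,
  -- and both alternate on chords.
  refine ⟨fun i => xor (χ i) (δ i), χ, hαχ, hνo, hβχ, hνχ, fun κ κ' hκ hκ' => ?_⟩
  rw [sign_heads_mul_sign_heads evenStep_involutive oddStep_involutive hνν hαχ hβχ hνo hνχ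
    finRotate_evenStep hκ hκ', sign_finRotate]
  rw [Fintype.card_fin] at hcount
  rw [show ∀ a b : ℕ, 2 * (a + b) = 2 * k → a + b = k from fun a b h => by omega] <;>
    [skip; exact hcount]
  -- The rotation contributes the exponent `2k - 1` and the reversed edges contribute `k`.
  rw [← pow_add, show 2 * k - 1 + k = k + 1 + 2 * (k - 1) by omega, pow_add _ _ (2 * _), pow_mul]
  simp

end Chords

namespace SimpleGraph

/-! ### Closed walks from sequences of vertices -/

section WalkOfSequence

variable {V : Type*} {G : SimpleGraph V}

theorem exists_walk_of_sequence (m : ℕ) (w : ℕ → V) (h : ∀ i < m, G.Adj (w i) (w (i + 1))) (v : V)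
    (hv : w m = v) :
    ∃ W : G.Walk (w 0) v, W.length = m ∧ (∀ i ≤ m, W.getVert i = w i) ∧
      W.support = (List.range (m + 1)).map w ∧
      W.edges = (List.range m).map (fun i => s(w i, w (i + 1))) ∧
      W.darts.map (fun d => (d.fst, d.snd)) = (List.range m).map (fun i => (w i, w (i + 1))) := by
  induction m generalizing w with
  | zero =>
    subst hv
    exact ⟨Walk.nil, rfl, fun i hi => by rw [Nat.le_zero.1 hi]; rfl, rfl, rfl, rfl⟩
  | succ m ih =>
    obtain ⟨W, h1, h2, h3, h4, h5⟩ := ih (fun i => w (i + 1)) (fun i hi => h (i + 1) (by omega)) hv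
    refine ⟨Walk.cons (h 0 m.succ_pos) W, ?_, ?_, ?_, ?_, ?_⟩
    · rw [Walk.length_cons, h1]
    · rintro (_ | i) hi
      · rfl
      · rw [Walk.getVert_cons_succ, h2 i (by omega)]
    · rw [Walk.support_cons, h3, List.range_succ_eq_map (n := m + 1), List.map_cons, List.map_map]
      rfl
    · rw [Walk.edges_cons, h4, List.range_succ_eq_map, List.map_cons, List.map_map]
      rfl
    · rw [Walk.darts_cons, List.map_cons, h5, List.range_succ_eq_map, List.map_cons,
        List.map_map]
      rfl

theorem isCycle_of_sequence {m : ℕ} {w : ℕ → V} (hm : 3 ≤ m)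
    (hinj : ∀ i j, i < m → j < m → w i = w j → i = j) (hclosed : w m = w 0)
    {C : G.Walk (w 0) (w 0)} (hl : C.length = m) (hs : C.support = (List.range (m + 1)).map w)
    (he : C.edges = (List.range m).map (fun i => s(w i, w (i + 1)))) : C.IsCycle := by
  have hsucc : ∀ i < m, ∃ i' < m, w (i + 1) = w i' ∧
      (i + 1 < m ∧ i' = i + 1 ∨ i + 1 = m ∧ i' = 0) := by
    intro i hi
    rcases Nat.lt_or_ge (i + 1) m with h | h
    · exact ⟨i + 1, h, rfl, Or.inl ⟨h, rfl⟩⟩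
    · have : i + 1 = m := by omega
      exact ⟨0, by omega, by rw [this, hclosed], Or.inr ⟨this, rfl⟩⟩
  rw [Walk.isCycle_def, Walk.isTrail_def]
  refine ⟨?_, ?_, ?_⟩
  · rw [he]
    refine List.Nodup.map_on ?_ List.nodup_range
    intro i hi j hj hij
    rw [List.mem_range] at hi hj
    obtain ⟨i', hi', hwi, hi''⟩ := hsucc i hi
    obtain ⟨j', hj', hwj, hj''⟩ := hsucc j hj
    rcases Sym2.eq_iff.1 hij with ⟨h, -⟩ | ⟨h, h'⟩
    · exact hinj i j hi hj h
    · rw [hwj] at h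
      rw [hwi] at h'
      have e1 := hinj _ _ hi hj' h
      have e2 := hinj _ _ hi' hj h'
      omega
  · rintro rfl
    simp at hl
    omega
  · rw [hs, List.range_succ_eq_map, List.map_cons, List.tail_cons, List.map_map]
    refine List.Nodup.map_on ?_ List.nodup_range
    intro i hi j hj hij
    rw [List.mem_range] at hi hj
    obtain ⟨i', hi', hwi, hi''⟩ := hsucc i hi
    obtain ⟨j', hj', hwj, hj''⟩ := hsucc j hj
    have hij' : w (i + 1) = w (j + 1) := hij
    rw [hwi, hwj] at hij'
    have := hinj _ _ hi' hj' hij'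
    omega

theorem EdgeOrientation.forwardCount_add_reverse (D : G.EdgeOrientation) {u v : V}
    (C : G.Walk u v) : D.forwardCount C + D.forwardCount C.reverse = C.length := by
  classical
  rw [forwardCount, forwardCount, Walk.darts_reverse, List.countP_reverse, List.countP_map,
    ← C.length_darts, List.length_eq_countP_add_countP (fun d => decide (D.Dir d.fst d.snd))]
  congr 1
  refine List.countP_congr fun d _ => ?_
  simp only [Function.comp_apply, decide_eq_true_eq]
  constructor
  · intro h h'
    exact D.not_dir_of_dir _ _ h h'
  · intro h
    exact (D.dir_or_dir _ _ d.adj).resolve_left h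

theorem EdgeOrientation.oddlyOriented_iff (D : G.EdgeOrientation) {v : V} (C : G.Walk v v)
    (hC : Even C.length) : D.OddlyOriented C ↔ Odd (D.forwardCount C) := by
  have := D.forwardCount_add_reverse C
  rw [OddlyOriented, and_iff_left_iff_imp]
  intro h
  rw [Nat.even_iff] at hC
  rw [Nat.odd_iff] at h ⊢
  omega

theorem EdgeOrientation.forwardCount_of_sequence (D : G.EdgeOrientation) {m : ℕ} {w : ℕ → V}
    {u v : V} {C : G.Walk u v}
    (hC : C.darts.map (fun d => (d.fst, d.snd)) = (List.range m).map (fun i => (w i, w (i + 1))))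
    (F : ℕ → Bool) (hF : ∀ i < m, F i = true ↔ D.Dir (w i) (w (i + 1))) :
    D.forwardCount C = ((Finset.range m).filter fun i => F i = true).card := by
  classical
  have h1 : D.forwardCount C =
      (C.darts.map (fun d => (d.fst, d.snd))).countP (fun p => decide (D.Dir p.1 p.2)) := by
    rw [List.countP_map, forwardCount]
    rfl
  rw [h1, hC, List.countP_map, ← Nat.count_eq_card_filter_range, Nat.count]
  refine List.countP_congr fun i hi => ?_
  rw [List.mem_range] at hi
  simp [hF i hi]

end WalkOfSequence

/-! ### Matchings that differ on one alternating cycle -/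

/-- Two perfect matchings of `G`, given by involutions `a` and `a'`, that differ exactly on a
cycle `w 0, w 1, …, w (2 * k) = w 0`, on which the edges belong to `a` and `a'` alternately. -/
structure AlternatingCycle {V : Type*} (G : SimpleGraph V) where
  k : ℕ
  w : ℕ → V
  a : V → V
  a' : V → V
  two_le : 2 ≤ k
  a_invol : Function.Involutive a
  a'_invol : Function.Involutive a'
  adj_a : ∀ v, G.Adj v (a v)
  adj_a' : ∀ v, G.Adj v (a' v)
  w_inj : ∀ i j, i < 2 * k → j < 2 * k → w i = w j → i = j
  w_closed : w (2 * k) = w 0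
  a_w : ∀ i < 2 * k, i % 2 = 0 → a (w i) = w (i + 1)
  a'_w : ∀ i < 2 * k, i % 2 = 1 → a' (w i) = w (i + 1)
  eq_off : ∀ v, (∀ i < 2 * k, v ≠ w i) → a' v = a v

/-- The graph of the edges `v, a v` of an involution `a`. -/
def involutionGraph {V : Type*} (a : V → V) : SimpleGraph V := fromRel fun u v => v = a u

theorem involutionGraph_adj {V : Type*} {G : SimpleGraph V} {a : V → V}
    (ha : Function.Involutive a) (hG : ∀ v, G.Adj v (a v)) (u v : V) :
    (involutionGraph a).Adj u v ↔ v = a u := by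
  rw [involutionGraph, fromRel_adj]
  constructor
  · rintro ⟨-, h | h⟩
    · exact h
    · rw [h, ha]
  · rintro rfl
    exact ⟨(hG u).ne, Or.inl rfl⟩

namespace AlternatingCycle

section Basic

variable {V : Type*} {G : SimpleGraph V} (A : AlternatingCycle G)

theorem w_evenStep (i : Fin (2 * A.k)) : A.a (A.w i) = A.w (evenStep i : Fin (2 * A.k)) := by
  rcases Nat.mod_two_eq_zero_or_one i with h | h
  · rw [A.a_w i i.2 h]
    simp [evenStep, h]
  · have hi := i.2
    have h0 : (i : ℕ) - 1 < 2 * A.k := by omega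
    have := A.a_w _ h0 (by omega)
    rw [show (i : ℕ) - 1 + 1 = i by omega] at this
    rw [← this, A.a_invol]
    simp [evenStep, h]

theorem w_oddStep (i : Fin (2 * A.k)) : A.a' (A.w i) = A.w (oddStep i : Fin (2 * A.k)) := by
  have hi := i.2
  rcases Nat.mod_two_eq_zero_or_one i with h | h
  · by_cases h0 : (i : ℕ) = 0
    · have := A.a'_w (2 * A.k - 1) (by omega) (by omega)
      rw [show 2 * A.k - 1 + 1 = 2 * A.k by omega, A.w_closed] at this
      rw [h0, ← this, A.a'_invol]
      simp [oddStep, h0]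
    · have := A.a'_w (i - 1) (by omega) (by omega)
      rw [show (i : ℕ) - 1 + 1 = i by omega] at this
      rw [← this, A.a'_invol]
      simp [oddStep, h, h0]
  · rw [A.a'_w i i.2 h]
    by_cases h0 : (i : ℕ) + 1 = 2 * A.k
    · simp [oddStep, h, h0, A.w_closed]
    · simp [oddStep, h, h0]

theorem a_ne_a' {i : ℕ} (hi : i < 2 * A.k) : A.a (A.w i) ≠ A.a' (A.w i) := by
  have h1 := A.w_evenStep ⟨i, hi⟩
  have h2 := A.w_oddStep ⟨i, hi⟩
  simp only at h1 h2
  rw [h1, h2]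
  intro h
  have := A.w_inj _ _ (evenStep _).2 (oddStep _).2 h
  have hk := A.two_le
  simp only [evenStep, oddStep] at this
  split_ifs at this <;> omega

theorem exists_a_eq {i : ℕ} (hi : i < 2 * A.k) : ∃ j < 2 * A.k, A.a (A.w i) = A.w j :=
  ⟨_, (evenStep ⟨i, hi⟩).2, A.w_evenStep ⟨i, hi⟩⟩

theorem adj_w {i : ℕ} (hi : i < 2 * A.k) : G.Adj (A.w i) (A.w (i + 1)) := by
  rcases Nat.mod_two_eq_zero_or_one i with h | h
  · rw [← A.a_w i hi h]; exact A.adj_a _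
  · rw [← A.a'_w i hi h]; exact A.adj_a' _

/-- The edges of `G` that belong to neither of the two matchings. -/
def rest : SimpleGraph V where
  Adj u v := G.Adj u v ∧ v ≠ A.a u ∧ v ≠ A.a' u
  symm := ⟨fun u v ⟨h, h1, h2⟩ => ⟨h.symm, fun h3 => h1 (by rw [h3, A.a_invol]),
    fun h3 => h2 (by rw [h3, A.a'_invol])⟩⟩
  loopless := ⟨fun u h => G.loopless.irrefl u h.1⟩

/-- The vertices of the cycle. -/
def vertexSet : Set V := {v | ∃ i < 2 * A.k, v = A.w i}

theorem a_eq_a'_of_notMem {v : V} (hv : v ∉ A.vertexSet) : A.a' v = A.a v :=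
  A.eq_off v fun i hi h => hv ⟨i, hi, h⟩

theorem ncard_neighborSet_rest [Fintype V] [DecidableRel G.Adj] (hG : G.IsRegularOfDegree 3)
    (v : V) : ({A.a v, A.a' v} : Set V).ncard + (A.rest.neighborSet v).ncard = 3 := by
  classical
  have h3 : (G.neighborSet v).ncard = 3 := by
    rw [← hG v, ← card_neighborFinset_eq_degree, ← Set.ncard_coe_finset, coe_neighborFinset]
  have : G.neighborSet v = {A.a v, A.a' v} ∪ A.rest.neighborSet v := by
    ext y
    simp only [mem_neighborSet, Set.mem_union, Set.mem_insert_iff, Set.mem_singleton_iff, rest]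
    constructor
    · intro h
      by_cases h1 : y = A.a v
      · exact Or.inl (Or.inl h1)
      · by_cases h2 : y = A.a' v
        · exact Or.inl (Or.inr h2)
        · exact Or.inr ⟨h, h1, h2⟩
    · rintro ((rfl | rfl) | h)
      · exact A.adj_a v
      · exact A.adj_a' v
      · exact h.1
  rw [← h3, this, Set.ncard_union_eq]
  rw [Set.disjoint_left]
  rintro y (rfl | rfl) h
  · exact h.2.1 rfl
  · exact h.2.2 rfl

theorem ncard_rest_of_mem [Fintype V] [DecidableRel G.Adj] (hG : G.IsRegularOfDegree 3)
    {v : V} (hv : v ∈ A.vertexSet) : (A.rest.neighborSet v).ncard = 1 := by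
  obtain ⟨i, hi, rfl⟩ := hv
  have := A.ncard_neighborSet_rest hG (A.w i)
  rw [Set.ncard_pair (A.a_ne_a' hi)] at this
  omega

theorem ncard_rest_of_notMem [Fintype V] [DecidableRel G.Adj] (hG : G.IsRegularOfDegree 3)
    {v : V} (hv : v ∉ A.vertexSet) : (A.rest.neighborSet v).ncard = 2 := by
  have := A.ncard_neighborSet_rest hG v
  rw [A.a_eq_a'_of_notMem hv, Set.pair_eq_singleton, Set.ncard_singleton] at this
  omega

/-- In a cubic graph two edges at a vertex of the cycle belong to the cycle, which leaves exactly
one edge of `rest`. -/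
theorem exists_chordedCycle [Fintype V] [DecidableRel G.Adj] (hG : G.IsRegularOfDegree 3) :
    ∃ Q : ChordedCycle G, Q.L = 2 * A.k ∧ Q.w = A.w ∧ Q.H = A.rest := by
  have hx : ∀ v, v ∈ A.vertexSet → ∃ x, A.rest.neighborSet v = {x} := fun v hv =>
    Set.ncard_eq_one.1 (A.ncard_rest_of_mem hG hv)
  choose! x hx using hx
  have hx' : ∀ i < 2 * A.k, ∀ y, A.rest.Adj (A.w i) y ↔ y = x (A.w i) := fun i hi y => by
    rw [← mem_neighborSet, hx _ ⟨i, hi, rfl⟩, Set.mem_singleton_iff]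
  have hk := A.two_le
  exact ⟨{ L := 2 * A.k
           w := A.w
           H := A.rest
           x := x
           three_le := by omega
           w_inj := A.w_inj
           w_L := A.w_closed
           adj := fun i hi => A.adj_w hi
           H_le := fun u v h => h.1
           not_H_adj := fun i hi h => by
            rcases Nat.mod_two_eq_zero_or_one i with h0 | h0
            · exact h.2.1 (A.a_w i hi h0).symm
            · exact h.2.2 (A.a'_w i hi h0).symm
           adj_x := fun i hi => (hx' i hi _).2 rfl
           eq_x := fun i hi y h => (hx' i hi y).1 h
           H_adj_or := fun i hi y h => by
            by_cases h1 : y = A.a (A.w i)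
            · right
              rcases Nat.mod_two_eq_zero_or_one i with h0 | h0
              · exact ⟨i, hi, by rw [h1, A.a_w i hi h0]⟩
              · refine ⟨i - 1, by omega, ?_⟩
                have := A.a_w (i - 1) (by omega) (by omega)
                rw [show i - 1 + 1 = i by omega] at this ⊢
                rw [h1, ← this, A.a_invol, Sym2.eq_swap]
            · by_cases h2 : y = A.a' (A.w i)
              · right
                rcases Nat.mod_two_eq_zero_or_one i with h0 | h0
                · by_cases hz : i = 0
                  · refine ⟨2 * A.k - 1, by omega, ?_⟩
                    have := A.a'_w (2 * A.k - 1) (by omega) (by omega)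
                    rw [show 2 * A.k - 1 + 1 = 2 * A.k by omega, A.w_closed] at this ⊢
                    rw [h2, hz, ← this, A.a'_invol, Sym2.eq_swap]
                  · refine ⟨i - 1, by omega, ?_⟩
                    have := A.a'_w (i - 1) (by omega) (by omega)
                    rw [show i - 1 + 1 = i by omega] at this ⊢
                    rw [h2, ← this, A.a'_invol, Sym2.eq_swap]
                · exact ⟨i, hi, by rw [h2, A.a'_w i hi h0]⟩
              · exact Or.inl ⟨h, h1, h2⟩ }, rfl, rfl, rfl⟩

end Basic

end AlternatingCycle

end SimpleGraph

/-- The indices at which `F` holds together with its partner come in pairs and do not affect the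
parity. -/
theorem neg_one_pow_card_eq_of_involutive {ι : Type*} [Fintype ι] [DecidableEq ι] {α : ι → ι}
    (hα : Function.Involutive α) (hne : ∀ i, α i ≠ i) (F : ι → Bool) :
    (-1 : ℤˣ) ^ Fintype.card {i // F i = false ∧ F (α i) = true} =
      (-1) ^ Fintype.card {i // F i = true} := by
  have h1 : Even ((Finset.univ.filter fun i => F i = true ∧ F (α i) = true).card) := by
    refine Finset.even_card_of_involution _ α ?_ (fun i _ => hα i) (fun i _ => hne i)
    intro i hi
    rw [Finset.mem_filter] at hi ⊢
    exact ⟨Finset.mem_univ _, hi.2.2, by rw [hα, hi.2.1]⟩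
  have h2 : Fintype.card {i // F i = false ∧ F (α i) = true} =
      (Finset.univ.filter fun i => F i = true ∧ ¬ F (α i) = true).card := by
    rw [← Fintype.card_subtype]
    exact Fintype.card_congr ((hα.toPerm α).subtypeEquiv fun i => by
      change _ ↔ F (α i) = true ∧ ¬ F (α (α i)) = true
      rw [hα]; simp [and_comm])
  have h3 : Fintype.card {i // F i = true} =
      (Finset.univ.filter fun i => F i = true ∧ F (α i) = true).card +
        (Finset.univ.filter fun i => F i = true ∧ ¬ F (α i) = true).card := by
    rw [Fintype.card_subtype, ← Finset.filter_filter, ← Finset.filter_filter,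
      Finset.card_filter_add_card_filter_not]
  rw [h2, h3, pow_add, h1.neg_one_pow, one_mul]

theorem card_subtype_fin_eq_card_filter_range {m : ℕ} (p : ℕ → Bool) :
    Fintype.card {i : Fin m // p i = true} = ((Finset.range m).filter fun i => p i = true).card := by
  rw [Fintype.card_subtype, ← Finset.card_map Fin.valEmbedding]
  congr 1
  ext i
  simp only [Finset.mem_map, Finset.mem_filter, Finset.mem_univ, true_and,
    Fin.valEmbedding_apply, Finset.mem_range]
  constructor
  · rintro ⟨j, hj, rfl⟩
    exact ⟨j.2, hj⟩
  · rintro ⟨hi, h⟩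
    exact ⟨⟨i, hi⟩, h, rfl⟩

namespace SimpleGraph

open Classical in
/-- The tails of the edges of a matching given by an involution. -/
noncomputable def EdgeOrientation.tails {V : Type*} {G : SimpleGraph V} (D : G.EdgeOrientation)
    (a : V → V) (v : V) : Bool := decide (D.Dir v (a v))

theorem EdgeOrientation.tails_eq_true {V : Type*} {G : SimpleGraph V} (D : G.EdgeOrientation)
    (a : V → V) (v : V) : D.tails a v = true ↔ D.Dir v (a v) := by
  simp [tails]

open Classical in
theorem EdgeOrientation.decide_dir_swap {V : Type*} {G : SimpleGraph V} (D : G.EdgeOrientation)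
    {u v : V} (h : G.Adj u v) : decide (D.Dir v u) = !decide (D.Dir u v) := by
  rcases D.dir_or_dir u v h with h1 | h1
  · simp [h1, D.not_dir_of_dir _ _ h1]
  · simp [h1, D.not_dir_of_dir _ _ h1]

theorem EdgeOrientation.tails_apply {V : Type*} {G : SimpleGraph V} (D : G.EdgeOrientation)
    {a : V → V} (ha : Function.Involutive a) (hG : ∀ v, G.Adj v (a v)) (v : V) :
    D.tails a (a v) = !D.tails a v := by
  rw [tails, tails, ha]
  exact D.decide_dir_swap (hG v)

namespace AlternatingCycle

/-! ### Change of the matching sign along the cycle -/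

section MatchingSigns

variable {n : ℕ} {G : SimpleGraph (Fin n)} (A : AlternatingCycle G) (D : G.EdgeOrientation)

open Classical in
-- The rotation `ζ` of the cycle conjugates `a` to `a'` and is odd. The remaining factor counts
-- edges to be reversed, and `neg_one_pow_card_eq_of_involutive` turns their number, modulo two,
-- into the number of forward edges.
theorem matchingSign_eq (hn : Even n) :
    D.matchingSign (involutionGraph A.a') = -(-1) ^
      ((Finset.range (2 * A.k)).filter fun i =>
        decide (D.Dir (A.w i) (A.w (i + 1))) = true).card *
      D.matchingSign (involutionGraph A.a) := by
  let W : Fin (2 * A.k) → Fin n := fun i => A.w i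
  have hW : Function.Injective W := fun i j h => Fin.ext (A.w_inj _ _ i.2 j.2 h)
  let ζ : Perm (Fin n) := (finRotate (2 * A.k)).extendDomain (Equiv.ofInjective W hW)
  have hζ : ∀ i : Fin (2 * A.k), ζ (W i) = W (finRotate (2 * A.k) i) := fun i =>
    Perm.extendDomain_apply_image _ (Equiv.ofInjective W hW) i
  have hζ' : ∀ v, v ∉ Set.range W → ζ v = v := fun v hv =>
    Perm.extendDomain_apply_not_subtype _ _ hv
  have haW : ∀ i, A.a (W i) = W (evenStep i) := A.w_evenStep
  have haW' : ∀ i, A.a' (W i) = W (oddStep i) := A.w_oddStep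
  have hoff : ∀ v, v ∉ Set.range W → A.a' v = A.a v := fun v hv =>
    A.eq_off v fun i hi h => hv ⟨⟨i, hi⟩, h.symm⟩
  have hoff' : ∀ v, v ∉ Set.range W → A.a v ∉ Set.range W := by
    rintro v hv ⟨i, hi⟩
    exact hv ⟨evenStep i, by rw [← haW, hi, A.a_invol]⟩
  obtain ⟨g, hg, hs⟩ := Carries.exists_of_conj (ζ := ζ) A.a'_invol
    (D.tails_apply A.a_invol A.adj_a) (D.tails_apply A.a'_invol A.adj_a') (fun v => by
      by_cases hv : v ∈ Set.range W
      · obtain ⟨i, rfl⟩ := hv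
        rw [haW, hζ, hζ, haW', finRotate_evenStep]
      · rw [hζ' _ (hoff' v hv), hζ' v hv, hoff v hv])
  let F : Fin (2 * A.k) → Bool := fun i => decide (D.Dir (A.w i) (A.w (i + 1)))
  have hcond : ∀ i, (D.tails A.a (W i) = false ∧ D.tails A.a' (ζ (W i)) = true) ↔
      (F i = false ∧ F (evenStep i) = true) := by
    intro i
    -- At even `i` the edge of `a` and its image in `a'` are both read along the traversal; at odd
    -- `i` both are read against it, which exchanges the two conditions.
    rw [hζ]
    rcases Nat.mod_two_eq_zero_or_one i with h | h
    · have e1 : D.tails A.a (W i) = F i := by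
        simp only [EdgeOrientation.tails, F, W, A.a_w i i.2 h]
      have e2 : D.tails A.a' (W (finRotate (2 * A.k) i)) = F (evenStep i) := by
        rw [finRotate_of_even h]
        have h1 : ((evenStep i : Fin (2 * A.k)) : ℕ) % 2 = 1 := by
          simp only [evenStep, h, if_true]; omega
        simp only [EdgeOrientation.tails, F, W, A.a'_w _ (evenStep i).2 h1]
      rw [e1, e2]
    · have h1 : ((evenStep i : Fin (2 * A.k)) : ℕ) % 2 = 0 := by
        simp only [evenStep, h]; norm_num; omega
      have e1 : D.tails A.a (W i) = !F (evenStep i) := by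
        have h2 := A.a_w _ (evenStep i).2 h1
        have h3 : A.a (W i) = W (evenStep i) := haW i
        have h4 : A.w ((evenStep i : Fin (2 * A.k)) + 1) = W i := by
          rw [← h2]
          change A.a (W (evenStep i)) = W i
          rw [← h3, A.a_invol]
        simp only [EdgeOrientation.tails, F, h3, h4]
        exact D.decide_dir_swap (h3 ▸ (A.adj_a (W i)).symm)
      have e2 : D.tails A.a' (W (finRotate (2 * A.k) i)) = !F i := by
        have h2 : W (finRotate (2 * A.k) i) = A.a' (W i) := by
          rw [finRotate_of_odd h, haW']
        rw [h2, D.tails_apply A.a'_invol A.adj_a']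
        simp only [EdgeOrientation.tails, F, W, A.a'_w i i.2 h]
      rw [e1, e2]
      cases F i <;> cases F (evenStep i) <;> simp
  have hcard : Fintype.card {v // D.tails A.a v = false ∧ D.tails A.a' (ζ v) = true} =
      Fintype.card {i // F i = false ∧ F (evenStep i) = true} := by
    refine (Fintype.card_congr (Equiv.ofBijective
      (fun i => ⟨W i.1, (hcond i.1).2 i.2⟩) ⟨?_, ?_⟩)).symm
    · intro i j h
      exact Subtype.ext (hW (congrArg Subtype.val h))
    · rintro ⟨v, hv⟩
      by_cases h : v ∈ Set.range W
      · obtain ⟨i, rfl⟩ := h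
        exact ⟨⟨i, (hcond i).1 hv⟩, rfl⟩
      · exfalso
        rw [hζ' v h] at hv
        simp only [EdgeOrientation.tails, hoff v h] at hv
        rw [hv.1] at hv
        exact absurd hv.2 (by simp)
  have hsζ : Perm.sign ζ = -1 := by
    rw [Perm.sign_extendDomain, sign_finRotate]
    have := A.two_le
    exact Odd.neg_one_pow ⟨A.k - 1, by omega⟩
  have hne : ∀ i : Fin (2 * A.k), evenStep i ≠ i := fun i h => by
    have := congrArg Fin.val h
    simp only [evenStep] at this
    split_ifs at this <;> omega
  rw [D.matchingSign_of_carries hn (fun u v h => ?_) (involutionGraph_adj A.a_invol A.adj_a)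
    (involutionGraph_adj A.a'_invol A.adj_a') (D.tails_eq_true _) (D.tails_eq_true _) hg, hs, hsζ,
    hcard, neg_one_pow_card_eq_of_involutive evenStep_involutive hne,
    card_subtype_fin_eq_card_filter_range
      (fun i => decide (D.Dir (A.w i) (A.w (i + 1)))), neg_one_mul]
  rw [involutionGraph_adj A.a_invol A.adj_a] at h
  exact h ▸ A.adj_a u

end MatchingSigns

/-! ### The two covers and the centrality of the cycle -/

section Components

variable {V : Type*} {G : SimpleGraph V} (A : AlternatingCycle G)

/-- Off the cycle the matchings agree, so the edges of `a'` that survive the removal of `a` are the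
odd steps of the cycle. -/
theorem sdiff_a_adj (u v : V) : (G \ involutionGraph A.a).Adj u v ↔
    A.rest.Adj u v ∨ ∃ i : Fin (2 * A.k), u = A.w i ∧ v = A.w (oddStep i : Fin (2 * A.k)) := by
  rw [sdiff_adj, involutionGraph_adj A.a_invol A.adj_a]
  constructor
  · rintro ⟨h1, h2⟩
    by_cases h3 : v = A.a' u
    · right
      by_cases hu : ∃ i < 2 * A.k, u = A.w i
      · obtain ⟨i, hi, rfl⟩ := hu
        exact ⟨⟨i, hi⟩, rfl, h3.trans (A.w_oddStep ⟨i, hi⟩)⟩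
      · exact absurd (h3.trans (A.a_eq_a'_of_notMem hu)) h2
    · exact Or.inl ⟨h1, h2, h3⟩
  · rintro (h | ⟨i, rfl, rfl⟩)
    · exact ⟨h.1, h.2.1⟩
    · rw [← A.w_oddStep]
      exact ⟨A.adj_a' _, (A.a_ne_a' i.2).symm⟩

theorem sdiff_a'_adj (u v : V) : (G \ involutionGraph A.a').Adj u v ↔
    A.rest.Adj u v ∨ ∃ i : Fin (2 * A.k), u = A.w i ∧ v = A.w (evenStep i : Fin (2 * A.k)) := by
  rw [sdiff_adj, involutionGraph_adj A.a'_invol A.adj_a']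
  constructor
  · rintro ⟨h1, h2⟩
    by_cases h3 : v = A.a u
    · right
      by_cases hu : ∃ i < 2 * A.k, u = A.w i
      · obtain ⟨i, hi, rfl⟩ := hu
        exact ⟨⟨i, hi⟩, rfl, h3.trans (A.w_evenStep ⟨i, hi⟩)⟩
      · exact absurd (h3.trans (A.a_eq_a'_of_notMem hu).symm) h2
    · exact Or.inl ⟨h1, h3, h2⟩
  · rintro (h | ⟨i, rfl, rfl⟩)
    · exact ⟨h.1, h.2.2⟩
    · rw [← A.w_evenStep]
      exact ⟨A.adj_a _, A.a_ne_a' i.2⟩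

/-- The cycle as a closed walk. -/
theorem exists_walk : ∃ C : G.Walk (A.w 0) (A.w 0), C.IsCycle ∧ C.length = 2 * A.k ∧
    (∀ i ≤ 2 * A.k, C.getVert i = A.w i) ∧ (∀ v, v ∈ C.support ↔ v ∈ A.vertexSet) ∧
    (∀ e, e ∈ C.edges ↔ ∃ i < 2 * A.k, e = s(A.w i, A.w (i + 1))) ∧
    C.darts.map (fun d => (d.fst, d.snd)) =
      (List.range (2 * A.k)).map (fun i => (A.w i, A.w (i + 1))) := by
  obtain ⟨C, h1, h2, h3, h4, h5⟩ := exists_walk_of_sequence (2 * A.k) A.w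
    (fun i hi => A.adj_w hi) (A.w 0) A.w_closed
  have hk := A.two_le
  refine ⟨C, isCycle_of_sequence (by omega) A.w_inj A.w_closed h1 h3 h4, h1, h2, ?_, ?_, h5⟩
  · intro v
    rw [h3, List.mem_map]
    constructor
    · rintro ⟨i, hi, rfl⟩
      rw [List.mem_range] at hi
      rcases Nat.lt_or_ge i (2 * A.k) with h | h
      · exact ⟨i, h, rfl⟩
      · exact ⟨0, by omega, by rw [show i = 2 * A.k by omega, A.w_closed]⟩
    · rintro ⟨i, hi, rfl⟩
      exact ⟨i, List.mem_range.2 (by omega), rfl⟩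
  · intro e
    rw [h4, List.mem_map]
    simp only [List.mem_range, eq_comm]

/-- The involution `a` preserves the cycle, hence also its complement, and matches the latter. -/
theorem isCentral {C : G.Walk (A.w 0) (A.w 0)} (hC : ∀ v, v ∈ C.support ↔ v ∈ A.vertexSet) :
    C.IsCentral := by
  have hoff : ∀ v, v ∉ A.vertexSet → A.a v ∉ A.vertexSet := by
    rintro v hv ⟨i, hi, h⟩
    obtain ⟨j, hj, h'⟩ := A.exists_a_eq hi
    rw [← h, A.a_invol] at h'
    exact hv ⟨j, hj, h'⟩
  refine ⟨{ verts := {w | w ∉ C.support}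
            Adj := fun u v => u ∉ A.vertexSet ∧ v = A.a u
            adj_sub := ?_
            edge_vert := ?_
            symm := ?_ }, ?_, rfl⟩
  · rintro u v ⟨-, rfl⟩
    exact A.adj_a u
  · rintro u v ⟨h, -⟩
    change u ∉ C.support
    rwa [hC]
  · constructor
    rintro u v ⟨h, rfl⟩
    exact ⟨hoff u h, (A.a_invol u).symm⟩
  · intro v hv
    have hv' : v ∉ A.vertexSet := by
      rw [← hC]
      exact hv
    exact ⟨A.a v, ⟨hv', rfl⟩, fun y hy => hy.2⟩

end Components

/-! ### Parity of the component counts -/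

section CubicPlane

variable {V : Type*} [Fintype V] {G : SimpleGraph V} (A : AlternatingCycle G)

/-- The only place where planarity and tension enter. Both counts are the number of components of
`rest` corrected by the sign of a permutation of heads; the common part cancels and
`exists_direction_of_noncrossing` evaluates the rest. -/
theorem neg_one_pow_card_mul [DecidableRel G.Adj] (hG : G.IsRegularOfDegree 3)
    (P : G.PlaneEmbedding) (hP : P.WithoutTension) :
    (-1 : ℤˣ) ^ Nat.card (G \ involutionGraph A.a).ConnectedComponent *
      (-1) ^ Nat.card (G \ involutionGraph A.a').ConnectedComponent = (-1) ^ (A.k + 1) := by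
  classical
  have hk := A.two_le
  obtain ⟨C, hC, hlen, hget, hsupp, hedges, -⟩ := A.exists_walk
  obtain ⟨Q, hQL, hQw, hQH⟩ := A.exists_chordedCycle hG
  let d : ℕ → Bool := fun i => decide (Q.Inner P i)
  have hin : ∀ i < 2 * A.k, P.IsInVertex C (A.w i) ↔ Q.Inner P i := by
    intro i hi
    rw [show A.w i = Q.w i by rw [hQw]]
    refine Q.isInVertex_iff P C ?_ ?_ (hQL ▸ hi)
    · intro e
      rw [hedges]
      simp [ChordedCycle.edgesIn, hQL, hQw]
    · intro i hi
      rw [hsupp, hQw]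
      exact ⟨i, hQL ▸ hi, rfl⟩
  have hout : ∀ i < 2 * A.k, P.IsOutVertex C (C.getVert i) ↔ d i = false := by
    intro i hi
    rw [hget i hi.le, PlaneEmbedding.IsOutVertex, hin i hi, hsupp]
    simp only [d, decide_eq_false_iff_not, and_iff_right_iff_imp]
    exact fun _ => ⟨i, hi, rfl⟩
  -- Out-vertices are the indices with `d` false, and the bipartition of the cycle is by parity of
  -- the index.
  have ht : ((Finset.range (2 * A.k)).filter fun i => i % 2 = 0 ∧ d i = false).card =
      ((Finset.range (2 * A.k)).filter fun i => i % 2 = 1 ∧ d i = false).card := by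
    have h0 := hP _ C hC (hlen ▸ even_two_mul _) (A.isCentral hsupp)
    rw [PlaneEmbedding.tension, abs_eq_zero, sub_eq_zero, hlen] at h0
    have h1 : ∀ i ∈ Finset.range (2 * A.k), (Even i ∧ P.IsOutVertex C (C.getVert i)) ↔
        (i % 2 = 0 ∧ d i = false) := fun i hi => by
      rw [hout i (Finset.mem_range.1 hi), Nat.even_iff]
    have h2 : ∀ i ∈ Finset.range (2 * A.k), (Odd i ∧ P.IsOutVertex C (C.getVert i)) ↔
        (i % 2 = 1 ∧ d i = false) := fun i hi => by
      rw [hout i (Finset.mem_range.1 hi), Nat.odd_iff]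
    rw [Finset.filter_congr h1, Finset.filter_congr h2] at h0
    exact_mod_cast h0
  -- In `rest` the vertices of the cycle have degree one and all others degree two, so its paths
  -- pair the vertices of the cycle.
  have hμ : ∀ i, i < 2 * A.k → ∃ j, j < 2 * A.k ∧ j ≠ i ∧ A.rest.Reachable (A.w i) (A.w j) ∧
      ∀ l < 2 * A.k, A.rest.Reachable (A.w i) (A.w l) → l = i ∨ l = j := by
    intro i hi
    obtain ⟨b, ⟨j, hj, rfl⟩, hne, hr, honly⟩ := exists_unique_other_end
      (fun v hv => A.ncard_rest_of_mem hG hv) (fun v hv => A.ncard_rest_of_notMem hG hv)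
      (show A.w i ∈ A.vertexSet from ⟨i, hi, rfl⟩)
    refine ⟨j, hj, fun h => hne (h ▸ rfl), hr, fun l hl h => ?_⟩
    exact (honly _ ⟨l, hl, rfl⟩ h).imp (A.w_inj _ _ hl hi) (A.w_inj _ _ hl hj)
  choose! μ hμL hμne hμr hμonly using hμ
  have hμμ : ∀ i < 2 * A.k, μ (μ i) = i := fun i hi =>
    ((hμonly (μ i) (hμL i hi) i hi (hμr i hi).symm).resolve_left (hμne i hi).symm).symm
  have hμd : ∀ i < 2 * A.k, d (μ i) = d i := fun i hi => by
    simp only [d, decide_eq_decide]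
    refine Q.inner_iff_of_reachable P (hQL ▸ hμL i hi) (hQL ▸ hi) ?_
    rw [hQH, hQw]
    exact (hμr i hi).symm
  have hcross : ∀ p q r s, p < q → q < r → r < s → s < 2 * A.k → μ p = r → μ q = s →
      d p = d q → False := by
    rintro p q _ _ hpq hqr hrs hs rfl rfl hd
    refine Q.not_crossing P hpq hqr hrs (hQL ▸ hs) ?_ ?_ ?_ ?_ (decide_eq_decide.1 hd) <;>
      rw [hQH, hQw]
    · exact hμr p (by omega)
    · exact hμr q (by omega)
    · rw [hQL]; exact hμonly p (by omega)
    · rw [hQL]; exact hμonly q (by omega)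
  let ν : Fin (2 * A.k) → Fin (2 * A.k) := fun i => ⟨μ i, hμL i i.2⟩
  have hνν : Function.Involutive ν := fun i => Fin.ext (hμμ i i.2)
  have hreach : ∀ i j : Fin (2 * A.k), A.rest.Reachable (A.w i) (A.w j) ↔ j = i ∨ j = ν i := by
    intro i j
    constructor
    · intro h
      exact (hμonly i i.2 j j.2 h).imp (fun h => Fin.ext h) (fun h => Fin.ext h)
    · rintro (rfl | rfl)
      · exact Reachable.refl _
      · exact hμr i i.2
  obtain ⟨o, o', ho, hoν, ho', hoν', hsign⟩ := exists_direction_of_noncrossing (by omega) hμL hμμ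
    hμne hμd hcross ht (ν := ν) (fun i => rfl)
  obtain ⟨κ, hκ, -⟩ := exists_perm_heads evenStep_involutive hνν ho hoν
  obtain ⟨κ', hκ', -⟩ := exists_perm_heads oddStep_involutive hνν ho' hoν'
  rw [neg_one_pow_card_connectedComponent (fun i : Fin (2 * A.k) => A.w i) oddStep_involutive hνν
      ho' hoν' hreach A.sdiff_a_adj hκ',
    neg_one_pow_card_connectedComponent (fun i : Fin (2 * A.k) => A.w i) evenStep_involutive hνν
      ho hoν hreach A.sdiff_a'_adj hκ, ← hsign κ κ' hκ hκ', mul_mul_mul_comm, Int.units_mul_self,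
    one_mul, mul_comm]

end CubicPlane

/-! ### Invariance under one switch -/

section Step

variable {n : ℕ} {G : SimpleGraph (Fin n)} (A : AlternatingCycle G)

theorem sdiff_sdiff_involutionGraph {a : Fin n → Fin n} (ha : Function.Involutive a)
    (hG : ∀ v, G.Adj v (a v)) : G \ (G \ involutionGraph a) = involutionGraph a := by
  refine sdiff_sdiff_eq_self fun u v h => ?_
  rw [involutionGraph_adj ha hG] at h
  exact h ▸ hG u

/-- The semi-Pfaffian condition makes the ratio of the matching signs `-(-1)^k`, which is also the
ratio of the component signs. -/
theorem coverSign_eq [DecidableRel G.Adj] (hG : G.IsRegularOfDegree 3)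
    (P : G.PlaneEmbedding) (hP : P.WithoutTension) (D : G.EdgeOrientation)
    (hD : D.IsSemiPfaffian) (hn : Even n) :
    D.coverSign (G \ involutionGraph A.a) = D.coverSign (G \ involutionGraph A.a') := by
  classical
  obtain ⟨C, hC, hlen, -, hsupp, -, hdarts⟩ := A.exists_walk
  have hodd := hD _ C hC (A.isCentral hsupp) A.k hlen
  rw [D.oddlyOriented_iff C (hlen ▸ even_two_mul _), D.forwardCount_of_sequence hdarts
    (fun i => decide (D.Dir (A.w i) (A.w (i + 1)))) (fun i _ => decide_eq_true_iff)] at hodd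
  have hpow : (-1 : ℤˣ) ^ ((Finset.range (2 * A.k)).filter fun i =>
      decide (D.Dir (A.w i) (A.w (i + 1))) = true).card = (-1) ^ A.k := by
    rcases Nat.even_or_odd A.k with h | h
    · rw [h.neg_one_pow, Even.neg_one_pow]
      rw [← Nat.not_odd_iff_even, hodd, Nat.not_odd_iff_even]
      exact h
    · rw [h.neg_one_pow, (hodd.2 h).neg_one_pow]
  have hcomp := A.neg_one_pow_card_mul hG P hP
  rw [EdgeOrientation.coverSign, EdgeOrientation.coverSign,
    sdiff_sdiff_involutionGraph A.a_invol A.adj_a,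
    sdiff_sdiff_involutionGraph A.a'_invol A.adj_a', A.matchingSign_eq D hn, hpow, ← mul_assoc]
  congr 1
  rw [pow_succ] at hcomp
  calc _ = (-1 : ℤˣ) ^ Nat.card (G \ involutionGraph A.a).ConnectedComponent *
        ((-1) ^ Nat.card (G \ involutionGraph A.a').ConnectedComponent *
          (-1) ^ Nat.card (G \ involutionGraph A.a').ConnectedComponent) := by
        rw [Int.units_mul_self, mul_one]
    _ = _ := by
        rw [← mul_assoc, hcomp, mul_neg_one, mul_comm]

end Step

end AlternatingCycle

end SimpleGraph

namespace SimpleGraph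

/-! ### Finding an alternating cycle -/

section Alternating

variable {V : Type*} {a b : V → V}

/-- Both involutions conjugate `b ∘ a` to its inverse, so an equality could be moved to `(b ∘ a)^[i
+ j] v = a v`. Balancing the exponents then gives a fixed point of `a` if `i + j` is even and of `b`
if it is odd. -/
theorem iterate_ne_apply_iterate (ha : Function.Involutive a) (hb : Function.Involutive b)
    (hane : ∀ v, a v ≠ v) (hbne : ∀ v, b v ≠ v) (v : V) (i j : ℕ) :
    (b ∘ a)^[i] v ≠ a ((b ∘ a)^[j] v) := by
  have hs : ∀ i, (b ∘ a)^[i + 1] v = b (a ((b ∘ a)^[i] v)) := fun i =>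
    Function.iterate_succ_apply' _ _ _
  have shift : ∀ i j, (b ∘ a)^[i + 1] v = a ((b ∘ a)^[j] v) ↔
      (b ∘ a)^[i] v = a ((b ∘ a)^[j + 1] v) := by
    intro i j
    rw [hs, hs]
    constructor
    · intro h
      rw [← h, hb, ha]
    · intro h
      rw [h, ha, hb]
  have move : ∀ l i j, (b ∘ a)^[i + l] v = a ((b ∘ a)^[j] v) ↔
      (b ∘ a)^[i] v = a ((b ∘ a)^[j + l] v) := by
    intro l
    induction l with
    | zero => exact fun i j => Iff.rfl
    | succ l ih =>
      intro i j
      rw [← add_assoc, shift, ih, show j + 1 + l = j + (l + 1) by omega]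
  intro h
  have h0 : (b ∘ a)^[i + j] v = a ((b ∘ a)^[0] v) := by
    rw [move j i 0, zero_add]; exact h
  rcases Nat.even_or_odd' (i + j) with ⟨l, hl | hl⟩
  · rw [show i + j = l + l by omega, move l l 0, zero_add] at h0
    exact hane _ h0.symm
  · rw [show i + j = (l + 1) + l by omega, move l (l + 1) 0, zero_add, hs] at h0
    exact hbne _ h0

/-- Two perfect matchings that differ at a vertex differ along an alternating cycle. -/
theorem exists_alternatingCycle [Finite V] {G : SimpleGraph V} (ha : Function.Involutive a)
    (hb : Function.Involutive b) (haG : ∀ v, G.Adj v (a v)) (hbG : ∀ v, G.Adj v (b v)) {v : V}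
    (hv : a v ≠ b v) : ∃ A : AlternatingCycle G, A.a = a ∧ A.a' v = b v ∧
      ∀ x, A.a' x = b x ∨ A.a' x = a x := by
  classical
  have hinj : Function.Injective (b ∘ a) := hb.injective.comp ha.injective
  let k := Function.minimalPeriod (b ∘ a) v
  have hkpos : 0 < k :=
    Function.minimalPeriod_pos_of_mem_periodicPts (hinj.mem_periodicPts v)
  have hper : (b ∘ a)^[k] v = v := Function.iterate_minimalPeriod
  have hk1 : k ≠ 1 := fun h => by
    rw [h] at hper
    have h1 : b (a v) = v := hper
    exact hv (by rw [← hb (a v), h1])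
  -- Alternate applications of `a` and `b` to `v`; the even positions form the orbit of `v` under `b
  -- ∘ a`, so the cycle closes after `2k` steps.
  let w : ℕ → V := fun i => if i % 2 = 0 then (b ∘ a)^[i / 2] v else a ((b ∘ a)^[i / 2] v)
  have hwe : ∀ j, w (2 * j) = (b ∘ a)^[j] v := fun j => by
    simp only [w]
    rw [if_pos (by omega), show 2 * j / 2 = j by omega]
  have hwo : ∀ j, w (2 * j + 1) = a ((b ∘ a)^[j] v) := fun j => by
    simp only [w]
    rw [if_neg (by omega), show (2 * j + 1) / 2 = j by omega]
  have hpar : ∀ i : ℕ, (∃ j, i = 2 * j) ∨ ∃ j, i = 2 * j + 1 := fun i => by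
    rcases Nat.even_or_odd' i with ⟨j, h | h⟩
    · exact Or.inl ⟨j, h⟩
    · exact Or.inr ⟨j, h⟩
  have hinjOn : ∀ i j, i < k → j < k → (b ∘ a)^[i] v = (b ∘ a)^[j] v → i = j :=
    fun i j hi hj h => Function.iterate_injOn_Iio_minimalPeriod hi hj h
  have hne := iterate_ne_apply_iterate ha hb (fun v => (haG v).ne') (fun v => (hbG v).ne') v
  have hw_inj : ∀ i j, i < 2 * k → j < 2 * k → w i = w j → i = j := by
    intro i j hi hj h
    rcases hpar i with ⟨i, rfl⟩ | ⟨i, rfl⟩ <;> rcases hpar j with ⟨j, rfl⟩ | ⟨j, rfl⟩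
    · rw [hwe, hwe] at h
      rw [hinjOn i j (by omega) (by omega) h]
    · rw [hwe, hwo] at h
      exact absurd h (hne i j)
    · rw [hwe, hwo] at h
      exact absurd h.symm (hne j i)
    · rw [hwo, hwo] at h
      rw [hinjOn i j (by omega) (by omega) (ha.injective h)]
  have hclosed : w (2 * k) = w 0 := by
    rw [hwe, hper, show (0 : ℕ) = 2 * 0 from rfl, hwe]; rfl
  have haw : ∀ i, i % 2 = 0 → a (w i) = w (i + 1) := by
    intro i hi
    obtain ⟨j, rfl⟩ : ∃ j, i = 2 * j := ⟨i / 2, by omega⟩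
    rw [hwe, hwo]
  have hbw : ∀ i, i % 2 = 1 → b (w i) = w (i + 1) := by
    intro i hi
    obtain ⟨j, rfl⟩ : ∃ j, i = 2 * j + 1 := ⟨i / 2, by omega⟩
    rw [hwo, show 2 * j + 1 + 1 = 2 * (j + 1) by ring, hwe, Function.iterate_succ_apply']
    rfl
  let S : Set V := {x | ∃ i < 2 * k, x = w i}
  have hle : ∀ i ≤ 2 * k, w i ∈ S := fun i hi => by
    rcases Nat.lt_or_eq_of_le hi with h | rfl
    · exact ⟨i, h, rfl⟩
    · exact ⟨0, by omega, hclosed⟩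
  have haS : ∀ x ∈ S, a x ∈ S := by
    rintro _ ⟨i, hi, rfl⟩
    rcases Nat.mod_two_eq_zero_or_one i with h | h
    · rw [haw i h]
      exact hle _ hi
    · have := haw (i - 1) (by omega)
      rw [show i - 1 + 1 = i by omega] at this
      rw [← this, ha]
      exact hle _ (by omega)
  have hbS : ∀ x ∈ S, b x ∈ S := by
    rintro _ ⟨i, hi, rfl⟩
    have hodd : ∀ i ≤ 2 * k, 0 < i → i % 2 = 0 → b (w i) ∈ S := by
      intro i hi h0 h
      have := hbw (i - 1) (by omega)
      rw [show i - 1 + 1 = i by omega] at this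
      rw [← this, hb]
      exact hle _ (by omega)
    rcases Nat.mod_two_eq_zero_or_one i with h | h
    · rcases Nat.eq_zero_or_pos i with rfl | h0
      · rw [← hclosed]
        exact hodd _ le_rfl (by omega) (by omega)
      · exact hodd i hi.le h0 h
    · rw [hbw i h]
      exact hle _ hi
  -- Only the cycle through `v` is switched to `b`; any other disagreement between `a` and `b`
  -- remains.
  let a' : V → V := fun x => if x ∈ S then b x else a x
  have ha'S : ∀ x ∈ S, a' x = b x := fun x hx => if_pos hx
  have ha'n : ∀ x, x ∉ S → a' x = a x := fun x hx => if_neg hx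
  refine ⟨{ k := k
            w := w
            a := a
            a' := a'
            two_le := by omega
            a_invol := ha
            a'_invol := fun x => by
              by_cases hx : x ∈ S
              · rw [ha'S x hx, ha'S _ (hbS x hx), hb]
              · rw [ha'n x hx, ha'n _ fun h => hx (by rw [← ha x]; exact haS _ h), ha]
            adj_a := haG
            adj_a' := fun x => by
              by_cases hx : x ∈ S
              · rw [ha'S x hx]; exact hbG x
              · rw [ha'n x hx]; exact haG x
            w_inj := hw_inj
            w_closed := hclosed
            a_w := fun i _ h => haw i h
            a'_w := fun i hi h => by rw [ha'S _ ⟨i, hi, rfl⟩, hbw i h]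
            eq_off := fun x hx => ha'n x fun ⟨i, hi, h⟩ => hx i hi h }, rfl,
    ha'S v ⟨0, by omega, ?_⟩, fun x => ?_⟩
  · rw [show (0 : ℕ) = 2 * 0 from rfl, hwe]; rfl
  · by_cases hx : x ∈ S
    · exact Or.inl (ha'S x hx)
    · exact Or.inr (ha'n x hx)

end Alternating

/-! ### From matchings to cycle covers -/

section Covers

variable {n : ℕ} {G : SimpleGraph (Fin n)} [DecidableRel G.Adj]

/-- Induction on the number of vertices at which the matchings disagree: one switch removes `v` from
the disagreements and creates none. -/
theorem coverSign_eq_coverSign (hG : G.IsRegularOfDegree 3) (P : G.PlaneEmbedding)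
    (hP : P.WithoutTension) (D : G.EdgeOrientation) (hD : D.IsSemiPfaffian)
    {a b : Fin n → Fin n} (ha : Function.Involutive a) (hb : Function.Involutive b)
    (haG : ∀ v, G.Adj v (a v)) (hbG : ∀ v, G.Adj v (b v)) :
    D.coverSign (G \ involutionGraph a) = D.coverSign (G \ involutionGraph b) := by
  have hn : Even n := by
    simpa using Finset.even_card_of_involution Finset.univ a (fun _ _ => Finset.mem_univ _)
      (fun v _ => ha v) (fun v _ => (haG v).ne')
  induction hN : (Finset.univ.filter fun v => a v ≠ b v).card using Nat.strong_induction_on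
    generalizing a with | _ N ih =>
  by_cases hab : a = b
  · rw [hab]
  · obtain ⟨v, hv⟩ := Function.ne_iff.1 hab
    obtain ⟨A, rfl, hAv, hA⟩ := exists_alternatingCycle ha hb haG hbG hv
    rw [A.coverSign_eq hG P hP D hD hn]
    refine ih _ ?_ A.a'_invol A.adj_a' rfl
    rw [← hN]
    refine Finset.card_lt_card (Finset.ssubset_iff_of_subset ?_ |>.2 ⟨v, ?_, ?_⟩)
    · intro x hx
      simp only [Finset.mem_filter, Finset.mem_univ, true_and] at hx ⊢
      rwa [(hA x).resolve_left hx] at hx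
    · simpa using hv
    · simpa using hAv

/-- The complement of a cycle cover of a cubic graph is a perfect matching. -/
theorem IsCycleCover.exists_involution (hG : G.IsRegularOfDegree 3) {c : SimpleGraph (Fin n)}
    (hc : G.IsCycleCover c) : ∃ a : Fin n → Fin n, Function.Involutive a ∧
      (∀ v, G.Adj v (a v)) ∧ c = G \ involutionGraph a := by
  have h1 : ∀ v, ∃ y, (G \ c).neighborSet v = {y} := by
    intro v
    rw [← Set.ncard_eq_one]
    have h3 : (G.neighborSet v).ncard = 3 := by
      rw [← hG v, ← card_neighborFinset_eq_degree, ← Set.ncard_coe_finset, coe_neighborFinset]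
    have h2 : (G \ c).neighborSet v = G.neighborSet v \ c.neighborSet v := by
      ext y
      simp
    have hsub : c.neighborSet v ⊆ G.neighborSet v := fun y hy => hc.1 hy
    rw [h2, Set.ncard_sdiff hsub, h3, hc.2]
  choose a ha using h1
  have hadj : ∀ u v, (G \ c).Adj u v ↔ v = a u := fun u v => by
    rw [← mem_neighborSet, ha, Set.mem_singleton_iff]
  have hinv : Function.Involutive a := fun v =>
    ((hadj _ _).1 ((hadj v (a v)).2 rfl).symm).symm
  have hGa : ∀ v, G.Adj v (a v) := fun v => ((sdiff_adj G c _ _).1 ((hadj v (a v)).2 rfl)).1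
  refine ⟨a, hinv, hGa, ?_⟩
  have : involutionGraph a = G \ c := by
    ext u v
    rw [involutionGraph_adj hinv hGa, hadj]
  rw [this, sdiff_sdiff_eq_self hc.1]

end Covers

end SimpleGraph

end PerfectMatchings

theorem proposition6p5 {n : ℕ} (G : SimpleGraph (Fin n)) [DecidableRel G.Adj]
    (hG : G.IsRegularOfDegree 3) (P : G.PlaneEmbedding) (hP : P.WithoutTension)
    (D : G.EdgeOrientation) (hD : D.IsSemiPfaffian) :
    ∃ ε : ℤˣ, ∀ c : SimpleGraph (Fin n), G.IsCycleCover c → D.coverSign c = ε := by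
  by_cases h : ∃ c, G.IsCycleCover c
  · obtain ⟨c₀, hc₀⟩ := h
    refine ⟨D.coverSign c₀, fun c hc => ?_⟩
    obtain ⟨a, ha, haG, rfl⟩ := hc.exists_involution hG
    obtain ⟨b, hb, hbG, rfl⟩ := hc₀.exists_involution hG
    exact SimpleGraph.coverSign_eq_coverSign hG P hP D hD ha hb haG hbG
  · exact ⟨1, fun c hc => absurd ⟨c, hc⟩ h⟩
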